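/- Let $E$ be a finite-dimensional Euclidean space with inner product $(\cdot,\cdot)$ and let $\Phi\subseteq E$ be an irreducible reduced (finite, crystallographic) root system spanning $E$, with Weyl group $W$. Let $\Delta=\{\alpha_1,\dots,\alpha_\ell\}$ be a basis (set of simple roots) of $\Phi$, $\tilde\alpha$ the highest root (the root of maximal height) and $\alpha_0=-\tilde\alpha$. Let $Z=\{x\in E : (\alpha,x)\in\mathbb{Z}\ \text{for all}\ \alpha\in\Phi\}$ be the coweight lattice, and let $A_\circ=\{x\in E : (\alpha_i,x)>0\ \text{for}\ 1\le i\le \ell,\ (\tilde\alpha,x)<1\}$ be the fundamental alcove. Let $\Omega\subseteq W$ be the image, under the projection $Z\rtimes W\to W$, of the stabilizer $\{\hat\omega\in Z\rtimes W : \hat\omega(A_\circ)=A_\circ\}$ of $A_\circ$ in the extended affine Weyl group $Z\rtimes W$, which acts on $E$ by $x\mapsto z+w(x)$. The group $\Omega$ permutes $\{\alpha_0,\alpha_1,\dots,\alpha_\ell\}$. Let $\omega\in\Omega$, let $o(\omega)$ be its order, let $E^\omega=\{x\in E:\omega(x)=x\}$, and for $x\in E$ put $$x^\omega=\frac{1}{o(\omega)}\sum_{t=1}^{o(\omega)}\omega^t(x)\in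 E^\omega .$$ Put $\Phi_{\mathrm{re}}^\omega=\{\beta^\omega : \beta\in\Phi,\ \beta^\omega\ne 0\}$ and $\Delta^\omega=\{\alpha^\omega : \alpha\in\Delta,\ \omega^t(\alpha)\neq\alpha_0\ \text{for all}\ t\in\mathbb{Z}\}$. Let $\varpi_1^\vee,\dots,\varpi_\ell^\vee$ be the basis of $E$ dual to $\alpha_1,\dots,\alpha_\ell$, so that $(\alpha_i,\varpi_j^\vee)=\delta_{ij}$, and let $\varpi_0^\vee=0$. Let $\sigma$ be the permutation of $\{0,1,\dots,\ell\}$ with $\omega(\alpha_i)=\alpha_{\sigma(i)}$, let $S_0,\dots,S_r$ be its orbits, with $0\in S_0$, and for $1\le k\le r$ put $\bar\pi_k^\omega=\bigl(\sum_{s\in S_k}\varpi_s^\vee\bigr)^\omega$. Then $\Phi_{\mathrm{re}}^\omega$ is a (not necessarily reduced, possibly empty) root system in $E^\omega$, and $\Delta^\omega$ is a basis of it: $\Delta^\omega\subseteq\Phi_{\mathrm{re}}^\omega$ is a basis of the vector space $E^\omega$, every element of $\Phi_{\mathrm{re}}^\omega$ is a linear combination of $\Delta^\omega$ with integer coefficients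 that are all nonnegative or all nonpositive, and no element of $\Delta^\omega$ is twice an element of $\Phi_{\mathrm{re}}^\omega$. Moreover, the subgroup of $E^\omega$ generated by $\bar\pi_1^\omega,\dots,\bar\pi_r^\omega$ is the coweight lattice $\{x\in E^\omega : (\gamma,x)\in\mathbb{Z}\ \text{for all}\ \gamma\in\Phi_{\mathrm{re}}^\omega\}$ of $\Phi_{\mathrm{re}}^\omega$. -/

import Mathlib

open scoped InnerProductSpace

noncomputable section

namespace FoldedRoots

variable {E : Type*} [NormedAddCommGroup E] [InnerProductSpace ℝ E]

/-! ### Root systems in a Euclidean space -/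

/-- The coroot `α^∨ = 2 α / (α, α)`. -/
def coroot (α : E) : E := (2 / ⟪α, α⟫_ℝ) • α

/-- The reflection `s_α`, as a linear isometry of `E`. -/
def refl (α : E) : E ≃ₗᵢ[ℝ] E := Submodule.reflection (ℝ ∙ α)ᗮ

/-- `s_α x = x - (α^∨, x) α`. -/
theorem refl_apply (α x : E) : refl α x = x - ⟪coroot α, x⟫_ℝ • α := by
  rw [refl, Submodule.reflection_orthogonal_apply, Submodule.reflection_singleton_apply, coroot,
    real_inner_smul_left, real_inner_self_eq_norm_sq]
  simp only [RCLike.ofReal_real_eq_id, id_eq, neg_sub]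
  rw [two_smul, ← add_smul]
  congr 2
  ring

/-- `Φ` is a finite (crystallographic, not necessarily reduced) root system in `E`.
The empty set is a root system in the zero space. -/
structure IsRootSystem (Φ : Set E) : Prop where
  finite : Φ.Finite
  zero_notMem : (0 : E) ∉ Φ
  span_eq_top : Submodule.span ℝ Φ = ⊤
  refl_mem : ∀ α ∈ Φ, ∀ β ∈ Φ, refl α β ∈ Φ
  integral : ∀ α ∈ Φ, ∀ β ∈ Φ, ∃ n : ℤ, ⟪coroot α, β⟫_ℝ = n

/-- `Φ` is nonempty and not the union of two nonempty mutually orthogonal subsets. -/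
def IsIrred (Φ : Set E) : Prop :=
  Φ.Nonempty ∧ ∀ Φ₁ Φ₂ : Set E, Φ = Φ₁ ∪ Φ₂ →
    (∀ β ∈ Φ₁, ∀ γ ∈ Φ₂, ⟪β, γ⟫_ℝ = 0) → Φ₁ = ∅ ∨ Φ₂ = ∅

/-- A root `α` of `Φ` is indivisible if `α / 2` is not a root. -/
def IsIndivisible (Φ : Set E) (α : E) : Prop := (1 / 2 : ℝ) • α ∉ Φ

/-- All roots are indivisible. -/
def IsReduced (Φ : Set E) : Prop := ∀ α ∈ Φ, IsIndivisible Φ α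

/-- `Δ ⊆ Φ` is a basis (a set of simple roots) of `Φ`: it is a basis of the vector space `E`, every
root is an integral combination of `Δ` with all coefficients nonnegative or all nonpositive,
and the elements of `Δ` are indivisible. -/
structure IsRootBasis (Φ Δ : Set E) : Prop where
  subset : Δ ⊆ Φ
  linearIndepOn : LinearIndepOn ℝ id Δ
  span_eq_top : Submodule.span ℝ Δ = ⊤
  mem_or_neg_mem : ∀ β ∈ Φ, β ∈ AddSubmonoid.closure Δ ∨ -β ∈ AddSubmonoid.closure Δ
  indivisible : ∀ α ∈ Δ, IsIndivisible Φ α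

/-- The Weyl group, generated by the reflections in the roots. -/
def weylGroup (Φ : Set E) : Subgroup (E ≃ₗᵢ[ℝ] E) := Subgroup.closure (refl '' Φ)

/-- The coweight lattice `{x ∈ E | (α, x) ∈ ℤ for all α ∈ Φ}`. -/
def coweightLattice (Φ : Set E) : AddSubgroup E where
  carrier := {x | ∀ α ∈ Φ, ∃ n : ℤ, ⟪α, x⟫_ℝ = n}
  zero_mem' := fun α _ => ⟨0, by simp⟩
  add_mem' := by
    intro x y hx hy α hα
    obtain ⟨m, hm⟩ := hx α hα
    obtain ⟨n, hn⟩ := hy α hα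
    exact ⟨m + n, by rw [inner_add_right, hm, hn]; push_cast; rfl⟩
  neg_mem' := by
    intro x hx α hα
    obtain ⟨m, hm⟩ := hx α hα
    exact ⟨-m, by rw [inner_neg_right, hm]; push_cast; rfl⟩

/-! ### Data attached to the simple roots `α i` and the highest root -/

section Simple

variable {ι : Type*} [Fintype ι]

/-- The height of `β`: the sum of its coefficients with respect to the simple roots `α i`. -/
def height (α : Module.Basis ι ℝ E) (β : E) : ℝ := ∑ i, α.repr β i

/-- `θ` is the highest root of `Φ`, i.e. the root of maximal height. -/
def IsHighestRoot (Φ : Set E) (α : Module.Basis ι ℝ E) (θ : E) : Prop :=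
  θ ∈ Φ ∧ ∀ β ∈ Φ, height α β ≤ height α θ

/-- The extended simple roots: the index `none` stands for `0`, with `α_0 = -θ`. -/
def extSimple (α : Module.Basis ι ℝ E) (θ : E) : Option ι → E
  | none => -θ
  | some i => α i

theorem inner_nondegenerate : (innerₗ E : LinearMap.BilinForm ℝ E).Nondegenerate := by
  constructor
  · intro x hx
    exact inner_self_eq_zero.1 (hx x)
  · intro x hx
    exact inner_self_eq_zero.1 (hx x)

/-- The fundamental coweights `ϖ_i^∨` (the basis dual to the simple roots for the inner product),
with `ϖ_0^∨ = 0`. -/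
def coweight (α : Module.Basis ι ℝ E) : Option ι → E
  | none => 0
  | some i =>
    letI := Classical.decEq ι
    LinearMap.BilinForm.dualBasis (innerₗ E) inner_nondegenerate α i

theorem inner_coweight [DecidableEq ι] (α : Module.Basis ι ℝ E) (i j : ι) :
    ⟪α i, coweight α (some j)⟫_ℝ = if i = j then 1 else 0 := by
  let _ := Classical.decEq ι
  have h := LinearMap.BilinForm.apply_dualBasis_left (B := innerₗ E) inner_nondegenerate α j i
  rw [real_inner_comm]
  simp only [coweight]
  exact h.trans (by congr)

/-- The fundamental alcove `{x | (α_i, x) > 0 for all i, (θ, x) < 1}`. -/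
def alcove (α : Module.Basis ι ℝ E) (θ : E) : Set E :=
  {x | (∀ i, 0 < ⟪α i, x⟫_ℝ) ∧ ⟪θ, x⟫_ℝ < 1}

/-- The group `Ω`: the linear parts `ω ∈ W` of those elements `x ↦ z + ω x` (with `z` in the coweight
lattice `Z`, `ω ∈ W`) of the extended affine Weyl group `Z ⋊ W` that map the fundamental alcove
onto itself. -/
def omegaGroup (Φ : Set E) (α : Module.Basis ι ℝ E) (θ : E) : Set (E ≃ₗᵢ[ℝ] E) :=
  {ω | ω ∈ weylGroup Φ ∧ ∃ z ∈ coweightLattice Φ, (fun x => z + ω x) '' alcove α θ = alcove α θ}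

end Simple

/-! ### Folding by `ω` -/

/-- The space `E^ω` of fixed points of `ω`. -/
def fixedSpace (ω : E ≃ₗᵢ[ℝ] E) : Submodule ℝ E where
  carrier := {x | ω x = x}
  zero_mem' := map_zero ω
  add_mem' := by
    intro x y hx hy
    simp only [Set.mem_ofPred_eq] at hx hy ⊢
    rw [map_add, hx, hy]
  smul_mem' := by
    intro c x hx
    simp only [Set.mem_ofPred_eq] at hx ⊢
    rw [map_smul, hx]

/-- The average `x^ω = (1 / o(ω)) ∑_{t = 1}^{o(ω)} ω^t x`, as a vector of `E`. -/
def average (ω : E ≃ₗᵢ[ℝ] E) (x : E) : E :=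
  (1 / (orderOf ω : ℝ)) • ∑ t ∈ Finset.Icc 1 (orderOf ω), (ω ^ t) x

theorem average_mem (ω : E ≃ₗᵢ[ℝ] E) (x : E) : average ω x ∈ fixedSpace ω := by
  change ω (average ω x) = average ω x
  have key : ∀ n : ℕ, ω (∑ t ∈ Finset.Icc 1 n, (ω ^ t) x) + ω x =
      (∑ t ∈ Finset.Icc 1 n, (ω ^ t) x) + (ω ^ (n + 1)) x := by
    intro n
    induction n with
    | zero => simp
    | succ n ih =>
      rw [Finset.sum_Icc_succ_top (by omega), map_add, add_right_comm, ih]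
      have : ω ((ω ^ (n + 1)) x) = (ω ^ (n + 1 + 1)) x := by
        rw [pow_succ' ω (n + 1)]; rfl
      rw [this]
  have h := key (orderOf ω)
  rw [pow_succ, pow_orderOf_eq_one, one_mul] at h
  rw [average, map_smul, add_right_cancel h]

/-- The map `φ_ω : E → E^ω`, `x ↦ x^ω`. -/
def fold (ω : E ≃ₗᵢ[ℝ] E) (x : E) : fixedSpace ω := ⟨average ω x, average_mem ω x⟩

/-- `Φ_re^ω = {β^ω | β ∈ Φ, β^ω ≠ 0}`. -/
def foldedRoots (Φ : Set E) (ω : E ≃ₗᵢ[ℝ] E) : Set (fixedSpace ω) :=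
  {x | x ≠ 0 ∧ ∃ β ∈ Φ, x = fold ω β}

section Simple

variable {ι : Type*} [Fintype ι]

/-- `Δ^ω = {α^ω | α ∈ Δ, ω^t α ≠ α_0 for all t ∈ ℤ}`. -/
def foldedSimple (α : Module.Basis ι ℝ E) (θ : E) (ω : E ≃ₗᵢ[ℝ] E) : Set (fixedSpace ω) :=
  {x | ∃ i : ι, (∀ t : ℤ, (ω ^ t) (α i) ≠ -θ) ∧ x = fold ω (α i)}

open Classical in
/-- The orbit `S` of the index `i` under the permutation `σ` of the indices of the extended simple
roots that is given by `ω α_k = α_{σ k}`. -/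
def indexOrbit (α : Module.Basis ι ℝ E) (θ : E) (ω : E ≃ₗᵢ[ℝ] E) (i : Option ι) :
    Finset (Option ι) :=
  {k | ∃ t : ℤ, (ω ^ t) (extSimple α θ i) = extSimple α θ k}

/-- For the orbit `S` of `i`, the vector `φ_ω (∑_{s ∈ S} ϖ_s^∨)` of `E^ω`. -/
def foldedCoweight (α : Module.Basis ι ℝ E) (θ : E) (ω : E ≃ₗᵢ[ℝ] E) (i : Option ι) :
    fixedSpace ω :=
  fold ω (∑ s ∈ indexOrbit α θ ω i, coweight α s)

/-- The set of the vectors `π̄_k^ω`, one for each orbit of indices that does not contain `0`. -/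
def foldedCoweights (α : Module.Basis ι ℝ E) (θ : E) (ω : E ≃ₗᵢ[ℝ] E) : Set (fixedSpace ω) :=
  {x | ∃ i : Option ι, none ∉ indexOrbit α θ ω i ∧ x = foldedCoweight α θ ω i}

end Simple

end FoldedRoots

end

/-! Let `f x = z + ω x` stabilize the fundamental alcove and put `d = orderOf ω`. The map `f`
permutes the walls of the alcove and `f ^ d = 1`. Folding is the orthogonal projection onto `E^ω`.
Everything rests on one point, the mean `v` of the `f`-orbit of `0` (`exists_isFoldingPoint`). It is
fixed by `f`, lies in the closed alcove, and lies off the walls indexed by the orbit of `0`. A root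
with zero projection takes the same value at `v` as at an `f`-fixed point of the open alcove, so
that value is not an integer.

First consequence: two distinct roots in one `ω`-orbit never have positive inner product, since
their difference would be a root with zero projection and integral value at `v`. So an orbit with
nonzero projection is either orthogonal or made of pairs spanning an `A₂`. Multiplying the
reflections in the roots of the orbit, or in the sums of the pairs, lifts the reflection in the
folded root (`exists_reflectionLift`). Hence the folded roots form a root system.

Second consequence: every folded root is the projection of a root that is integral at `v`
(`exists_integral_lift`). If such a root is positive, its value at `v` lies in `[0, 1)`, hence is
`0`, and it only involves simple roots vanishing at `v`. None of these is in the orbit of `-θ`, so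
the projection is a natural combination of the folded simple roots. The folded coweights are dual to
these, which yields independence, indivisibility and the lattice statement.

The integral lift uses that the affine Weyl group acts freely on alcoves (`eq_one_of_sameAlcove`).
This is used once to write `ω` as a product of reflections in roots with zero projection
(`mem_weylGroup_vanishing`), and once to bound the period of `ω` on a root (`pow_apply_eq_self`).
The freeness is proved from an abstract deletion argument on walls. -/

noncomputable section

namespace FoldedRoots

/-! ### A simple transitivity criterion for groups generated by reflections -/

section Abstract

variable {G : Type*} [Group G]

/-- `S t a b` is thought of as: the wall of `t` separates the chambers of `a` and `b`. -/
structure IsWallSystem (T : Set G) (S : G → G → G → Prop) : Prop where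
  mul_self : ∀ t ∈ T, t * t = 1
  conj_mem : ∀ s ∈ T, ∀ t ∈ T, s * t * s⁻¹ ∈ T
  not_sep_self : ∀ t a, ¬ S t a a
  sep_trans : ∀ t ∈ T, ∀ a ∈ Subgroup.closure T, ∀ b ∈ Subgroup.closure T,
    ∀ c ∈ Subgroup.closure T, (S t a c ↔ ¬ (S t a b ↔ S t b c))
  sep_conj : ∀ g t a b, S (g * t * g⁻¹) (g * a) (g * b) ↔ S t a b
  sep_one : ∀ t ∈ T, S t 1 t
  finite : ∀ t ∈ T, {s | s ∈ T ∧ S s 1 t}.Finite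
  eq_of_comm : ∀ s ∈ T, ∀ t ∈ T, t * s * t = s → S s 1 t → t = s
  exists_wall : ∀ t ∈ T, ∃ s ∈ T, S s 1 t ∧ ∀ r ∈ T, S r 1 s → r = s

namespace IsWallSystem

variable {T : Set G} {S : G → G → G → Prop}

/-- The reflections in the walls of the base chamber. -/
def simple (T : Set G) (S : G → G → G → Prop) : Set G :=
  {s | s ∈ T ∧ ∀ r ∈ T, S r 1 s → r = s}

theorem inv_eq (h : IsWallSystem T S) {t : G} (ht : t ∈ T) : t⁻¹ = t :=
  inv_eq_of_mul_eq_one_left (h.mul_self t ht)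

theorem conj_mem_of_closure (h : IsWallSystem T S) {g : G} (hg : g ∈ Subgroup.closure T) :
    ∀ t ∈ T, g * t * g⁻¹ ∈ T ∧ g⁻¹ * t * g ∈ T := by
  induction hg using Subgroup.closure_induction with
  | mem s hs =>
    intro t ht
    have h1 := h.conj_mem s hs t ht
    refine ⟨h1, ?_⟩
    rwa [h.inv_eq hs] at h1 ⊢
  | one => intro t ht; simpa using ht
  | mul a b _ _ iha ihb =>
    intro t ht
    constructor
    · have := (iha _ (ihb t ht).1).1
      simpa [mul_assoc] using this
    · have := (ihb _ (iha t ht).2).2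
      simpa [mul_assoc] using this
  | inv a _ iha =>
    intro t ht
    simpa using (iha t ht).symm

/-- The prefixes of `l` give a gallery of chambers; a wall that separates its ends separates two
consecutive chambers. -/
theorem exists_split (h : IsWallSystem T S) {t : G} (ht : t ∈ T) (l : List G) :
    ∀ w ∈ Subgroup.closure T, (∀ x ∈ l, x ∈ T) → S t w (w * l.prod) →
      ∃ a b c, l = a ++ b :: c ∧ S t (w * a.prod) (w * a.prod * b) := by
  induction l with
  | nil =>
    intro w _ _ hs
    simp only [List.prod_nil, mul_one] at hs
    exact absurd hs (h.not_sep_self _ _)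
  | cons x l ih =>
    intro w hw hl hs
    have hx : w * x ∈ Subgroup.closure T :=
      mul_mem hw (Subgroup.subset_closure (hl x (by simp)))
    have hlm : l.prod ∈ Subgroup.closure T :=
      list_prod_mem fun y hy => Subgroup.subset_closure (hl y (by simp [hy]))
    by_cases h1 : S t w (w * x)
    · exact ⟨[], x, l, by simp, by simpa using h1⟩
    · rw [List.prod_cons, ← mul_assoc] at hs
      have h2 := (h.sep_trans t ht w hw _ hx _ (mul_mem hx hlm)).1 hs
      have h3 : S t (w * x) (w * x * l.prod) := by tauto
      obtain ⟨a, b, c, rfl, h4⟩ := ih _ hx (fun y hy => hl y (by simp [hy])) h3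
      exact ⟨x :: a, b, c, by simp, by simpa [mul_assoc] using h4⟩

/-- Deletion argument. The wall of the first letter `t` is crossed at once, so it must be crossed
back at a later letter `b`. Pulled back to the base chamber, this crossing is through a wall
separating `1` from the simple `b`, hence through that of `b`. This gives `t * a.prod * b = a.prod`,
and both letters can be dropped. -/
theorem list_prod_eq_one (h : IsWallSystem T S) (n : ℕ) : ∀ l : List G, l.length ≤ n →
    (∀ x ∈ l, x ∈ simple T S) → (∀ t ∈ T, ¬ S t 1 l.prod) → l.prod = 1 := by
  induction n with
  | zero =>
    intro l hl _ _
    rw [List.length_eq_zero_iff.1 (Nat.le_zero.1 hl), List.prod_nil]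
  | succ n ih =>
    intro l hn hl hs
    cases l with
    | nil => rfl
    | cons t l =>
      have ht : t ∈ T := (hl t (by simp)).1
      have hlT : ∀ x ∈ l, x ∈ T := fun x hx => (hl x (by simp [hx])).1
      have htc := Subgroup.subset_closure (k := T) ht
      have hlm : l.prod ∈ Subgroup.closure T :=
        list_prod_mem fun y hy => Subgroup.subset_closure (hlT y hy)
      have h1 := h.sep_trans t ht 1 (one_mem _) t htc _ (mul_mem htc hlm)
      have h2 := hs t ht
      rw [List.prod_cons] at h2
      have h3 := h.sep_one t ht
      have h4 : S t t (t * l.prod) := by tauto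
      obtain ⟨a, b, c, rfl, h5⟩ := h.exists_split ht l t htc hlT h4
      have ham : a.prod ∈ Subgroup.closure T :=
        list_prod_mem fun y hy => Subgroup.subset_closure (hlT y (by simp [hy]))
      have hwm := mul_mem htc ham
      have h6 := ((h.conj_mem_of_closure hwm) t ht).2
      have h7 := (h.sep_conj (t * a.prod) ((t * a.prod)⁻¹ * t * (t * a.prod)) 1 b).1
        (by simpa [mul_assoc] using h5)
      have h8 := (hl b (by simp)).2 _ h6 h7
      have h9 : t * a.prod * b = a.prod := by
        rw [← h8]
        have := h.mul_self t ht
        calc t * a.prod * ((t * a.prod)⁻¹ * t * (t * a.prod)) = t * t * a.prod := by group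
          _ = _ := by rw [this, one_mul]
      have h10 : (t :: (a ++ b :: c)).prod = (a ++ c).prod := by
        simp only [List.prod_cons, List.prod_append]
        rw [← mul_assoc, ← mul_assoc, h9]
      rw [h10] at hs ⊢
      refine ih (a ++ c) ?_ ?_ hs
      · simp only [List.length_cons, List.length_append] at hn ⊢
        omega
      · intro x hx
        rcases List.mem_append.1 hx with hx | hx
        · exact hl x (by simp [hx])
        · exact hl x (by simp [hx])

/-- Induction on the number of walls between the base chamber and its image under `t`. For a simple
`s` among them, conjugation by `s` sends the walls counted for `s * t * s` injectively into those
counted for `t`, and misses `s`. -/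
theorem mem_closure_simple (h : IsWallSystem T S) (n : ℕ) : ∀ t ∈ T,
    {s | s ∈ T ∧ S s 1 t}.ncard ≤ n → t ∈ Subgroup.closure (simple T S) := by
  induction n with
  | zero =>
    intro t ht hn
    have := (Set.ncard_eq_zero (h.finite t ht)).1 (Nat.le_zero.1 hn)
    have hmem : t ∈ {s | s ∈ T ∧ S s 1 t} := ⟨ht, h.sep_one t ht⟩
    rw [this] at hmem
    exact absurd hmem (Set.notMem_empty _)
  | succ n ih =>
    intro t ht hn
    obtain ⟨s, hs, hst, hsimple⟩ := h.exists_wall t ht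
    have hsP : s ∈ Subgroup.closure (simple T S) := Subgroup.subset_closure ⟨hs, hsimple⟩
    by_cases hts : t = s
    · rwa [hts]
    have htc := Subgroup.subset_closure (k := T) ht
    have hsc := Subgroup.subset_closure (k := T) hs
    have hss := h.mul_self s hs
    have htt := h.mul_self t ht
    -- applying an element of the group to a separation
    have tr : ∀ g ∈ T, ∀ r a b, S r a b → S (g * r * g) (g * a) (g * b) := by
      intro g hg r a b hr
      have := (h.sep_conj g r a b).2 hr
      rwa [h.inv_eq hg] at this
    have cj : ∀ g ∈ T, ∀ r ∈ T, g * r * g ∈ T := by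
      intro g hg r hr
      have := h.conj_mem g hg r hr
      rwa [h.inv_eq hg] at this
    have dbl : ∀ g ∈ T, ∀ r, g * (g * r * g) * g = r := by
      intro g hg r
      have := h.mul_self g hg
      calc g * (g * r * g) * g = (g * g) * r * (g * g) := by group
        _ = r := by rw [this]; simp
    have symm : ∀ r ∈ T, ∀ a ∈ Subgroup.closure T, ∀ b ∈ Subgroup.closure T,
        S r a b → S r b a := by
      intro r hr a ha b hb hab
      have h1 := h.sep_trans r hr a ha b hb a ha
      have h2 := h.not_sep_self r a
      tauto
    have one := one_mem (Subgroup.closure T)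
    have ne : t * s * t ≠ s := fun he => hts (h.eq_of_comm s hs t ht he hst)
    have h1 : ¬ S s t (t * s) := by
      intro h2
      have h3 := tr t ht s _ _ h2
      rw [htt, ← mul_assoc, htt, one_mul] at h3
      exact ne (hsimple _ (cj t ht s hs) h3)
    have h2 : S s 1 (t * s) := by
      have := h.sep_trans s hs 1 one t htc _ (mul_mem htc hsc)
      tauto
    have h3 : ¬ S s 1 (s * t * s) := by
      have h4 := tr s hs s _ _ h2
      rw [hss, one_mul, mul_one, ← mul_assoc] at h4
      have := h.sep_trans s hs 1 one s hsc _ (mul_mem (mul_mem hsc htc) hsc)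
      have := h.sep_one s hs
      tauto
    have key : (fun r => s * r * s) '' {r | r ∈ T ∧ S r 1 (s * t * s)} ⊆
        {r | r ∈ T ∧ S r 1 t} \ {s} := by
      rintro _ ⟨r, ⟨hr, hrs⟩, rfl⟩
      have hrne : r ≠ s := by
        rintro rfl
        exact h3 hrs
      have hr' := cj s hs r hr
      have h4 : ¬ S r 1 s := fun h5 => hrne (hsimple r hr h5)
      have h5 : S r s (s * t * s) := by
        have := h.sep_trans r hr 1 one s hsc _ (mul_mem (mul_mem hsc htc) hsc)
        tauto
      have h6 := tr s hs r _ _ h5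
      rw [hss, ← mul_assoc, ← mul_assoc, hss, one_mul] at h6
      refine ⟨⟨hr', ?_⟩, ?_⟩
      -- If not, this wall separates `t` from `t * s`, so it is the wall of `t * s * t`. That is the
      -- `t`-image of a wall separating `1` from `t`, so it separates them after all.
      · by_cases h7 : S (s * r * s) 1 t
        · exact h7
        · have h8 : S (s * r * s) t (t * s) := by
            have := h.sep_trans _ hr' 1 one t htc _ (mul_mem htc hsc)
            tauto
          have h9 := tr t ht _ _ _ h8
          rw [htt, show t * (t * s) = s by rw [← mul_assoc, htt, one_mul]] at h9
          have h10 := hsimple _ (cj t ht _ hr') h9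
          have h11 := dbl t ht (s * r * s)
          rw [h10] at h11
          have h12 := tr t ht _ _ _ hst
          rw [htt, mul_one, h11] at h12
          exact symm _ hr' _ htc _ one h12
      · intro h7
        have h7 : s * r * s = s := h7
        have h8 := dbl s hs r
        rw [h7, hss, one_mul] at h8
        exact hrne h8.symm
    have hinj : Function.Injective (fun r => s * r * s) := by
      intro a b hab
      simpa using hab
    have hlt : {r | r ∈ T ∧ S r 1 (s * t * s)}.ncard < {r | r ∈ T ∧ S r 1 t}.ncard := by
      rw [← Set.ncard_image_of_injective _ hinj]
      refine (Set.ncard_le_ncard key ((h.finite t ht).sdiff)).trans_lt ?_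
      exact Set.ncard_sdiff_singleton_lt_of_mem ⟨hs, hst⟩ (h.finite t ht)
    have h4 := ih (s * t * s) (cj s hs t ht) (by omega)
    have h5 := mul_mem (mul_mem hsP h4) hsP
    rwa [dbl s hs t] at h5

/-- An element of the group that does not move the base chamber is trivial. -/
theorem eq_one (h : IsWallSystem T S) {u : G} (hu : u ∈ Subgroup.closure T)
    (hs : ∀ t ∈ T, ¬ S t 1 u) : u = 1 := by
  have hle : Subgroup.closure T ≤ Subgroup.closure (simple T S) :=
    (Subgroup.closure_le _).2 fun t ht => h.mem_closure_simple _ t ht le_rfl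
  have hu' : u ∈ (Subgroup.closure (simple T S)).toSubmonoid := hle hu
  rw [Subgroup.closure_toSubmonoid] at hu'
  obtain ⟨l, hl, rfl⟩ := Submonoid.exists_list_of_mem_closure hu'
  refine h.list_prod_eq_one _ l le_rfl ?_ hs
  intro x hx
  rcases hl x hx with h1 | h1
  · exact h1
  · have h1 : x⁻¹ ∈ simple T S := h1
    have h2 := h.inv_eq h1.1
    rw [inv_inv] at h2
    rwa [h2]

end IsWallSystem
end Abstract

/-! ### Affine reflections -/

section Affine

variable {E : Type*} [NormedAddCommGroup E] [InnerProductSpace ℝ E]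

/-- A finite set of nonzero vectors that is closed under its reflections and crystallographic;
it need not span. -/
structure IsRootSet (Γ : Set E) : Prop where
  finite : Γ.Finite
  zero_notMem : (0 : E) ∉ Γ
  refl_mem : ∀ α ∈ Γ, ∀ β ∈ Γ, refl α β ∈ Γ
  integral : ∀ α ∈ Γ, ∀ β ∈ Γ, ∃ n : ℤ, ⟪coroot α, β⟫_ℝ = n

theorem IsRootSystem.isRootSet {Φ : Set E} (h : IsRootSystem Φ) : IsRootSet Φ :=
  ⟨h.finite, h.zero_notMem, h.refl_mem, h.integral⟩

theorem IsRootSet.ne_zero {Γ : Set E} (h : IsRootSet Γ) {γ : E} (hγ : γ ∈ Γ) : γ ≠ 0 := by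
  rintro rfl
  exact h.zero_notMem hγ

theorem inner_coroot_smul_comm (γ x : E) : ⟪coroot γ, x⟫_ℝ • γ = ⟪γ, x⟫_ℝ • coroot γ := by
  rw [coroot, real_inner_smul_left, smul_smul, mul_comm]

theorem refl_apply' (γ x : E) : refl γ x = x - ⟪γ, x⟫_ℝ • coroot γ := by
  rw [refl_apply, inner_coroot_smul_comm]

theorem inner_self_coroot {γ : E} (hγ : γ ≠ 0) : ⟪γ, coroot γ⟫_ℝ = 2 := by
  have : ⟪γ, γ⟫_ℝ ≠ 0 := inner_self_ne_zero.2 hγ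
  rw [coroot, real_inner_smul_right]
  field_simp

theorem coroot_ne_zero {γ : E} (hγ : γ ≠ 0) : coroot γ ≠ 0 := by
  intro h
  have := inner_self_coroot hγ
  rw [h, inner_zero_right] at this
  norm_num at this

theorem refl_self {γ : E} (hγ : γ ≠ 0) : refl γ γ = -γ := by
  rw [refl_apply, real_inner_comm, inner_self_coroot hγ, two_smul]
  abel

theorem refl_refl (γ x : E) : refl γ (refl γ x) = x := by
  rw [refl]
  exact Submodule.reflection_reflection _ x

theorem refl_mul_self (γ : E) : refl γ * refl γ = 1 := by
  ext x
  exact refl_refl γ x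

theorem refl_inv (γ : E) : (refl γ)⁻¹ = refl γ := inv_eq_of_mul_eq_one_left (refl_mul_self γ)

theorem coroot_map (g : E ≃ₗᵢ[ℝ] E) (γ : E) : coroot (g γ) = g (coroot γ) := by
  rw [coroot, coroot, g.inner_map_map, map_smul]

theorem coroot_smul (c : ℝ) (γ : E) : coroot (c • γ) = c⁻¹ • coroot γ := by
  rcases eq_or_ne c 0 with rfl | hc
  · simp [coroot]
  rw [coroot, coroot, real_inner_smul_left, real_inner_smul_right, smul_smul, smul_smul]
  congr 1
  field_simp

theorem IsRootSet.neg_mem {Γ : Set E} (h : IsRootSet Γ) {γ : E} (hγ : γ ∈ Γ) : -γ ∈ Γ := by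
  rw [← refl_self (h.ne_zero hγ)]
  exact h.refl_mem γ hγ γ hγ

/-- The reflection in the affine hyperplane `⟪γ, x⟫ = c`. -/
def affRefl (γ : E) (c : ℝ) : E ≃ᵃⁱ[ℝ] E :=
  AffineIsometryEquiv.constVAdd ℝ E (c • coroot γ) * (refl γ).toAffineIsometryEquiv

theorem affRefl_apply (γ : E) (c : ℝ) (x : E) :
    affRefl γ c x = x - (⟪γ, x⟫_ℝ - c) • coroot γ := by
  have : affRefl γ c x = c • coroot γ + refl γ x := rfl
  rw [this, refl_apply', sub_smul]
  abel

theorem sub_affRefl (γ : E) (c : ℝ) (x : E) :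
    x - affRefl γ c x = (⟪γ, x⟫_ℝ - c) • coroot γ := by
  rw [affRefl_apply, sub_sub_cancel]

theorem inner_affRefl (γ : E) (hγ : γ ≠ 0) (c : ℝ) (x : E) :
    ⟪γ, affRefl γ c x⟫_ℝ - c = -(⟪γ, x⟫_ℝ - c) := by
  rw [affRefl_apply, inner_sub_right, real_inner_smul_right, inner_self_coroot hγ]
  ring

theorem affRefl_mul_self (γ : E) (hγ : γ ≠ 0) (c : ℝ) : affRefl γ c * affRefl γ c = 1 := by
  ext x
  change affRefl γ c (affRefl γ c x) = x
  rw [affRefl_apply γ c (affRefl γ c x), inner_affRefl γ hγ, affRefl_apply, neg_smul]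
  abel

theorem isom_apply (g : E ≃ᵃⁱ[ℝ] E) (x : E) : g x = g.linearIsometryEquiv x + g 0 := by
  have := g.map_vadd 0 x
  simpa using this

theorem isom_sub (g : E ≃ᵃⁱ[ℝ] E) (x y : E) : g x - g y = g.linearIsometryEquiv (x - y) := by
  rw [isom_apply g x, isom_apply g y, map_sub]
  abel

theorem affRefl_linear (γ : E) (c : ℝ) : (affRefl γ c).linearIsometryEquiv = refl γ := by
  ext x
  have := isom_sub (affRefl γ c) x 0
  rw [sub_zero] at this
  rw [← this, affRefl_apply, affRefl_apply, refl_apply', inner_zero_right, sub_smul, sub_smul,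
    zero_smul]
  abel

theorem affRefl_zero (γ : E) (c : ℝ) : affRefl γ c 0 = c • coroot γ := by
  rw [affRefl_apply, inner_zero_right, zero_sub, zero_sub, neg_smul, neg_neg]

theorem conj_affRefl (g : E ≃ᵃⁱ[ℝ] E) (γ : E) (c : ℝ) :
    g * affRefl γ c * g⁻¹ = affRefl (g.linearIsometryEquiv γ)
      (c + ⟪g.linearIsometryEquiv γ, g 0⟫_ℝ) := by
  rw [mul_inv_eq_iff_eq_mul]
  ext x
  change g (affRefl γ c x) = affRefl _ _ (g x)
  rw [affRefl_apply, affRefl_apply, coroot_map, isom_apply g x, inner_add_right,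
    LinearIsometryEquiv.inner_map_map, isom_apply g, map_sub, map_smul]
  rw [show ⟪γ, x⟫_ℝ + ⟪g.linearIsometryEquiv γ, g 0⟫_ℝ -
    (c + ⟪g.linearIsometryEquiv γ, g 0⟫_ℝ) = ⟪γ, x⟫_ℝ - c by ring]
  abel

/-- The reflections of the affine Weyl group of `Γ`. -/
def affReflections (Γ : Set E) : Set (E ≃ᵃⁱ[ℝ] E) :=
  {t | ∃ γ ∈ Γ, ∃ n : ℤ, t = affRefl γ n}

/-- The fixed hyperplane of the reflection `t` separates `x` from `y`. -/
def Separates (t : E ≃ᵃⁱ[ℝ] E) (x y : E) : Prop := ⟪x - t x, y - t y⟫_ℝ < 0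

/-- `x - t x` is the coroot times the signed level of `x`. So a definition by `t` alone, with no
choice of root and level, amounts to the usual sign test. -/
theorem separates_affRefl {γ : E} (hγ : γ ≠ 0) (c : ℝ) (x y : E) :
    Separates (affRefl γ c) x y ↔ (⟪γ, x⟫_ℝ - c) * (⟪γ, y⟫_ℝ - c) < 0 := by
  rw [Separates, sub_affRefl, sub_affRefl, real_inner_smul_left, real_inner_smul_right, ← mul_assoc]
  have : 0 < ⟪coroot γ, coroot γ⟫_ℝ := real_inner_self_pos.2 (coroot_ne_zero hγ)
  exact ⟨fun h => by nlinarith, fun h => mul_neg_of_neg_of_pos h this⟩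

theorem separates_conj (g t : E ≃ᵃⁱ[ℝ] E) (x y : E) :
    Separates (g * t * g⁻¹) (g x) (g y) ↔ Separates t x y := by
  have h : ∀ z, (g * t * g⁻¹) (g z) = g (t z) := by
    intro z
    change g (t (g⁻¹ (g z))) = _
    congr 2
    exact g.symm_apply_apply z
  rw [Separates, Separates, h, h, isom_sub, isom_sub, LinearIsometryEquiv.inner_map_map]

/-- `x` lies on none of the hyperplanes `⟪γ, x⟫ = n`. -/
def IsRegular (Γ : Set E) (x : E) : Prop := ∀ γ ∈ Γ, ∀ n : ℤ, ⟪γ, x⟫_ℝ ≠ n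

/-- `x` and `y` are in the same alcove. -/
def SameAlcove (Γ : Set E) (x y : E) : Prop := ∀ t ∈ affReflections Γ, ¬ Separates t x y

variable {Γ : Set E}

theorem conj_mem_affReflections (h : IsRootSet Γ) {s t : E ≃ᵃⁱ[ℝ] E}
    (hs : s ∈ affReflections Γ) (ht : t ∈ affReflections Γ) : s * t * s⁻¹ ∈ affReflections Γ := by
  obtain ⟨γ, hγ, n, rfl⟩ := hs
  obtain ⟨δ, hδ, m, rfl⟩ := ht
  have h1 := h.refl_mem γ hγ δ hδ
  obtain ⟨k, hk⟩ := h.integral γ hγ _ h1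
  refine ⟨refl γ δ, h1, m + n * k, ?_⟩
  rw [conj_affRefl, affRefl_linear, affRefl_zero, real_inner_smul_right, real_inner_comm, hk]
  push_cast
  rfl

theorem isRegular_affRefl (h : IsRootSet Γ) {t : E ≃ᵃⁱ[ℝ] E} (ht : t ∈ affReflections Γ) {x : E}
    (hx : IsRegular Γ x) : IsRegular Γ (t x) := by
  obtain ⟨γ, hγ, n, rfl⟩ := ht
  intro δ hδ m hm
  have h1 := h.refl_mem γ hγ δ hδ
  obtain ⟨k, hk⟩ := h.integral γ hγ _ hδ
  refine hx _ h1 (m - n * k) ?_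
  rw [affRefl_apply, sub_smul, inner_sub_right, inner_sub_right, real_inner_smul_right,
    real_inner_smul_right, real_inner_comm (coroot γ) δ, hk] at hm
  rw [refl_apply, inner_sub_left, real_inner_smul_left, hk]
  push_cast
  linarith

theorem isRegular_iff_of_mem (h : IsRootSet Γ) {g : E ≃ᵃⁱ[ℝ] E}
    (hg : g ∈ Subgroup.closure (affReflections Γ)) : ∀ x, IsRegular Γ (g x) ↔ IsRegular Γ x := by
  induction hg using Subgroup.closure_induction with
  | mem t ht =>
    intro x
    refine ⟨fun hx => ?_, isRegular_affRefl h ht⟩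
    have h1 := isRegular_affRefl h ht hx
    obtain ⟨γ, hγ, n, rfl⟩ := ht
    have h2 : affRefl γ n (affRefl γ n x) = x :=
      congrArg (fun g : E ≃ᵃⁱ[ℝ] E => g x) (affRefl_mul_self γ (h.ne_zero hγ) n)
    rwa [h2] at h1
  | one => intro x; rfl
  | mul a b _ _ iha ihb =>
    intro x
    exact (iha (b x)).trans (ihb x)
  | inv a _ iha =>
    intro x
    rw [← iha (a⁻¹ x)]
    have : a (a⁻¹ x) = x := a.apply_symm_apply x
    rw [this]

theorem finite_separating (h : IsRootSet Γ) (x y : E) :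
    {t | t ∈ affReflections Γ ∧ Separates t x y}.Finite := by
  have : {t | t ∈ affReflections Γ ∧ Separates t x y} ⊆
      ⋃ γ ∈ Γ, (fun n : ℤ => affRefl γ (n : ℝ)) ''
        Set.Icc ⌊min ⟪γ, x⟫_ℝ ⟪γ, y⟫_ℝ⌋ ⌈max ⟪γ, x⟫_ℝ ⟪γ, y⟫_ℝ⌉ := by
    rintro _ ⟨⟨γ, hγ, n, rfl⟩, hs⟩
    rw [separates_affRefl (h.ne_zero hγ)] at hs
    refine Set.mem_iUnion₂.2 ⟨γ, hγ, n, ⟨?_, ?_⟩, rfl⟩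
    · rcases mul_neg_iff.1 hs with h1 | h1
      · have : (⌊min ⟪γ, x⟫_ℝ ⟪γ, y⟫_ℝ⌋ : ℝ) ≤ n :=
          (Int.floor_le _).trans ((min_le_right _ _).trans (by linarith))
        exact_mod_cast this
      · have : (⌊min ⟪γ, x⟫_ℝ ⟪γ, y⟫_ℝ⌋ : ℝ) ≤ n :=
          (Int.floor_le _).trans ((min_le_left _ _).trans (by linarith))
        exact_mod_cast this
    · rcases mul_neg_iff.1 hs with h1 | h1
      · have : (n : ℝ) ≤ ⌈max ⟪γ, x⟫_ℝ ⟪γ, y⟫_ℝ⌉ :=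
          le_trans (le_trans (by linarith) (le_max_left _ _)) (Int.le_ceil _)
        exact_mod_cast this
      · have : (n : ℝ) ≤ ⌈max ⟪γ, x⟫_ℝ ⟪γ, y⟫_ℝ⌉ :=
          le_trans (le_trans (by linarith) (le_max_right _ _)) (Int.le_ceil _)
        exact_mod_cast this
  exact (h.finite.biUnion fun γ _ => (Set.finite_Icc _ _).image _).subset this

/-- Commuting reflections have equal or orthogonal hyperplanes. In the orthogonal case the second
reflection keeps every point on its side of the first hyperplane, which the separation excludes. -/
theorem eq_of_affRefl_comm {γ δ : E} (hγ : γ ≠ 0) (hδ : δ ≠ 0) {c d : ℝ} {x : E}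
    (hc : affRefl δ d * affRefl γ c * affRefl δ d = affRefl γ c)
    (hs : Separates (affRefl γ c) x (affRefl δ d x)) : affRefl δ d = affRefl γ c := by
  rw [separates_affRefl hγ] at hs
  have hc' : affRefl δ d * affRefl γ c = affRefl γ c * affRefl δ d := by
    conv_rhs => rw [← hc]
    rw [mul_assoc, affRefl_mul_self δ hδ, mul_one]
  have h0 : ⟪γ, coroot δ⟫_ℝ ≠ 0 := by
    intro h0
    rw [affRefl_apply, inner_sub_right, real_inner_smul_right, h0, mul_zero, sub_zero] at hs
    nlinarith [sq_nonneg (⟪γ, x⟫_ℝ - c)]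
  have key : ∀ y, ((⟪δ, y⟫_ℝ - d) * ⟪γ, coroot δ⟫_ℝ) • coroot γ =
      ((⟪γ, y⟫_ℝ - c) * ⟪δ, coroot γ⟫_ℝ) • coroot δ := by
    intro y
    have h1 : affRefl δ d (affRefl γ c y) = affRefl γ c (affRefl δ d y) :=
      congrArg (fun g : E ≃ᵃⁱ[ℝ] E => g y) hc'
    rw [affRefl_apply δ d (affRefl γ c y), affRefl_apply γ c (affRefl δ d y), affRefl_apply γ c y,
      affRefl_apply δ d y, inner_sub_right, inner_sub_right, real_inner_smul_right,
      real_inner_smul_right] at h1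
    have h2 : ((⟪δ, y⟫_ℝ - d) * ⟪γ, coroot δ⟫_ℝ) • coroot γ -
      ((⟪γ, y⟫_ℝ - c) * ⟪δ, coroot γ⟫_ℝ) • coroot δ = 0 := by
      rw [← sub_eq_zero] at h1
      rw [← neg_eq_zero, ← h1]
      module
    exact sub_eq_zero.1 h2
  -- Subtracting the relation `key` at two points that differ by `coroot δ` removes the levels `c`
  -- and `d`.
  have h1 : coroot γ = (⟪δ, coroot γ⟫_ℝ / 2) • coroot δ := by
    have h2 := key (x + coroot δ)
    have h3 := key x
    simp only [inner_add_right, inner_self_coroot hδ] at h2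
    rw [← sub_eq_zero] at h2 h3
    have h4 : (2 * ⟪γ, coroot δ⟫_ℝ) • (coroot γ - (⟪δ, coroot γ⟫_ℝ / 2) • coroot δ) = 0 := by
      linear_combination (norm := module) h2 - h3
    exact sub_eq_zero.1 ((smul_eq_zero.1 h4).resolve_left (mul_ne_zero two_ne_zero h0))
  have h2 : ⟪δ, coroot γ⟫_ℝ * ⟪γ, coroot δ⟫_ℝ = 4 := by
    have := congrArg (fun z => ⟪γ, z⟫_ℝ) h1
    simp only [inner_self_coroot hγ, real_inner_smul_right] at this
    linarith
  ext y
  rw [affRefl_apply, affRefl_apply]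
  congr 1
  have h3 := congrArg (fun z => ⟪γ, z⟫_ℝ) (key y)
  simp only [real_inner_smul_right, inner_self_coroot hγ] at h3
  rw [h1, smul_smul]
  congr 1
  have h4 : (⟪δ, y⟫_ℝ - d) * ⟪γ, coroot δ⟫_ℝ = 2 * (⟪γ, y⟫_ℝ - c) := by
    linear_combination h3 / 2 + (⟪γ, y⟫_ℝ - c) / 2 * h2
  linear_combination ⟪δ, coroot γ⟫_ℝ / 4 * h4 - (⟪δ, y⟫_ℝ - d) / 4 * h2

end Affine

/-! ### The affine Weyl group acts freely on alcoves -/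

section Affine

variable {E : Type*} [NormedAddCommGroup E] [InnerProductSpace ℝ E] {Γ : Set E}

/-- The gradients are proportional with the same ratio as the values at `y`, so the two affine
functions are proportional and have the same zero set. -/
theorem affRefl_eq_of_smul_eq {γ δ y : E} {c d : ℝ} (hδ : δ ≠ 0) (ha : ⟪γ, y⟫_ℝ - c ≠ 0)
    (hb : ⟪δ, y⟫_ℝ - d ≠ 0) (h : (⟪δ, y⟫_ℝ - d) • γ = (⟪γ, y⟫_ℝ - c) • δ) :
    affRefl γ c = affRefl δ d := by
  obtain ⟨k, hk, hk0⟩ : ∃ k : ℝ, γ = k • δ ∧ k ≠ 0 := by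
    refine ⟨(⟪γ, y⟫_ℝ - c) / (⟪δ, y⟫_ℝ - d), ?_, div_ne_zero ha hb⟩
    rw [div_eq_inv_mul, mul_smul, ← h, smul_smul, inv_mul_cancel₀ hb, one_smul]
  ext x
  rw [affRefl_apply, affRefl_apply]
  congr 1
  have h1 : ⟪γ, y⟫_ℝ - c = k * (⟪δ, y⟫_ℝ - d) := by
    have h2 : ((⟪δ, y⟫_ℝ - d) * k - (⟪γ, y⟫_ℝ - c)) • δ = 0 := by
      rw [sub_smul, mul_smul, ← hk, h, sub_self]
    have := (smul_eq_zero.1 h2).resolve_right hδ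
    linarith
  rw [hk, coroot_smul, smul_smul]
  congr 1
  rw [hk] at h1
  rw [real_inner_smul_left] at h1 ⊢
  field_simp
  linarith

theorem eventually_sameAlcove (h : IsRootSet Γ) {p : E} (hp : IsRegular Γ p) :
    ∀ᶠ x in nhds p, IsRegular Γ x ∧ SameAlcove Γ p x := by
  have h1 : ∀ γ ∈ Γ, ∀ᶠ x in nhds p,
      (⌊⟪γ, p⟫_ℝ⌋ : ℝ) < ⟪γ, x⟫_ℝ ∧ ⟪γ, x⟫_ℝ < ⌊⟪γ, p⟫_ℝ⌋ + 1 := by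
    intro γ hγ
    have hc : ContinuousAt (fun x : E => ⟪γ, x⟫_ℝ) p := by fun_prop
    have h2 : (⌊⟪γ, p⟫_ℝ⌋ : ℝ) < ⟪γ, p⟫_ℝ := lt_of_le_of_ne (Int.floor_le _) (hp γ hγ _).symm
    exact (hc.eventually_const_lt h2).and (hc.eventually_lt_const (Int.lt_floor_add_one _))
  filter_upwards [(Filter.eventually_all_finite h.finite).2 h1] with x hx
  constructor
  · intro γ hγ n hn
    obtain ⟨h2, h3⟩ := hx γ hγ
    rw [hn] at h2 h3
    have h2 : ⌊⟪γ, p⟫_ℝ⌋ < n := by exact_mod_cast h2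
    have h3 : n < ⌊⟪γ, p⟫_ℝ⌋ + 1 := by exact_mod_cast h3
    omega
  · rintro _ ⟨γ, hγ, n, rfl⟩ hs
    rw [separates_affRefl (h.ne_zero hγ)] at hs
    obtain ⟨h2, h3⟩ := hx γ hγ
    have h4 := Int.floor_le ⟪γ, p⟫_ℝ
    have h5 := Int.lt_floor_add_one ⟪γ, p⟫_ℝ
    rcases le_or_gt n ⌊⟪γ, p⟫_ℝ⌋ with h6 | h6
    · have h6 : (n : ℝ) ≤ ⌊⟪γ, p⟫_ℝ⌋ := by exact_mod_cast h6
      nlinarith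
    · have h6 : (⌊⟪γ, p⟫_ℝ⌋ : ℝ) + 1 ≤ n := by exact_mod_cast h6
      nlinarith

theorem IsRegular.ne_zero {x : E} (hx : IsRegular Γ x) {γ : E} (hγ : γ ∈ Γ) (n : ℤ) :
    ⟪γ, x⟫_ℝ - n ≠ 0 := sub_ne_zero.2 (hx γ hγ n)

theorem separates_trans (h : IsRootSet Γ) {t : E ≃ᵃⁱ[ℝ] E} (ht : t ∈ affReflections Γ)
    {x y z : E} (hx : IsRegular Γ x) (hy : IsRegular Γ y) (hz : IsRegular Γ z) :
    Separates t x z ↔ ¬ (Separates t x y ↔ Separates t y z) := by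
  obtain ⟨γ, hγ, n, rfl⟩ := ht
  simp only [separates_affRefl (h.ne_zero hγ)]
  have h1 := hx.ne_zero hγ n
  have h2 := hy.ne_zero hγ n
  have h3 := hz.ne_zero hγ n
  rcases h1.lt_or_gt with h1 | h1 <;> rcases h2.lt_or_gt with h2 | h2 <;>
    rcases h3.lt_or_gt with h3 | h3 <;>
    simp [mul_neg_iff, h1, h2, h3, h1.not_gt, h2.not_gt, h3.not_gt]

theorem exists_inner_ne_zero {κ : Type*} [Finite κ] (g : κ → E) (hg : ∀ k, g k ≠ 0) :
    ∃ e : E, ∀ k, ⟪g k, e⟫_ℝ ≠ 0 := by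
  obtain ⟨e, -, he⟩ := Module.Dual.exists_forall_mem_ne_zero_of_forall_exists (K := ℝ)
    (⊤ : Submodule ℝ E) (fun k => (innerₗ E (g k) : Module.Dual ℝ E))
    (fun k => ⟨g k, trivial, by simpa using hg k⟩)
  exact ⟨e, fun k => by simpa using he k⟩

/-- Walk towards `y` from a general point `p'` of the alcove of `p`, and let `s` be the first wall
met. A wall that separates `p` from `s p` must contain the point where the segment meets `s`; by
general position only `s` does. -/
theorem exists_wall_separating (h : IsRootSet Γ) {p y : E} (hp : IsRegular Γ p)
    (hy : IsRegular Γ y) (hpy : ¬ SameAlcove Γ p y) :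
    ∃ s ∈ affReflections Γ, Separates s p y ∧
      ∀ r ∈ affReflections Γ, Separates r p (s p) → r = s := by
  have hrep : ∀ t : E ≃ᵃⁱ[ℝ] E, t ∈ affReflections Γ → ∃ γ, γ ∈ Γ ∧ ∃ n : ℤ, t = affRefl γ n :=
    fun t ht => ht
  choose! γ hγ n hn using hrep
  set φ : (E ≃ᵃⁱ[ℝ] E) → E → ℝ := fun t x => ⟪γ t, x⟫_ℝ - n t with hφ
  have hsep : ∀ t ∈ affReflections Γ, ∀ x z, Separates t x z ↔ φ t x * φ t z < 0 := by
    intro t ht x z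
    conv_lhs => rw [hn t ht]
    exact separates_affRefl (h.ne_zero (hγ t ht)) _ _ _
  have hreg : ∀ t ∈ affReflections Γ, ∀ x, IsRegular Γ x → φ t x ≠ 0 :=
    fun t ht x hx => hx.ne_zero (hγ t ht) _
  set T₀ := {t | t ∈ affReflections Γ ∧ Separates t p y} with hT₀
  have hfin : T₀.Finite := finite_separating h p y
  have hne : T₀.Nonempty := by
    unfold SameAlcove at hpy
    push Not at hpy
    obtain ⟨t, ht, hs⟩ := hpy
    exact ⟨t, ht, hs⟩
  -- a point of the alcove of `p` in general position with respect to `y`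
  obtain ⟨p', ⟨hp', hpp'⟩, hgen⟩ : ∃ p', (IsRegular Γ p' ∧ SameAlcove Γ p p') ∧
      ∀ i ∈ T₀, ∀ j ∈ T₀, i ≠ j → φ j y * φ i p' - φ i y * φ j p' ≠ 0 := by
    let κ := {q : T₀ × T₀ // q.1 ≠ q.2}
    have : Finite T₀ := hfin
    let g : κ → E := fun q => φ q.1.2 y • γ q.1.1 - φ q.1.1 y • γ q.1.2
    have hg : ∀ k, g k ≠ 0 := by
      rintro ⟨⟨⟨i, hi⟩, ⟨j, hj⟩⟩, hij⟩ h0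
      have h1 : φ j y • γ i = φ i y • γ j := sub_eq_zero.1 h0
      apply hij
      have h2 := affRefl_eq_of_smul_eq (h.ne_zero (hγ j hj.1)) (hreg i hi.1 y hy) (hreg j hj.1 y hy) h1
      rw [← hn i hi.1, ← hn j hj.1] at h2
      exact Subtype.ext h2
    obtain ⟨e, he⟩ := exists_inner_ne_zero g hg
    have h1 : ∀ᶠ ε in nhdsWithin (0 : ℝ) (Set.Ioi 0),
        IsRegular Γ (p + ε • e) ∧ SameAlcove Γ p (p + ε • e) := by
      have hc : Filter.Tendsto (fun ε : ℝ => p + ε • e) (nhdsWithin 0 (Set.Ioi 0)) (nhds p) := by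
        have : ContinuousAt (fun ε : ℝ => p + ε • e) 0 := by fun_prop
        have h2 := this.tendsto
        rw [zero_smul, add_zero] at h2
        exact h2.mono_left nhdsWithin_le_nhds
      exact hc.eventually (eventually_sameAlcove h hp)
    have h2 : ∀ᶠ ε in nhdsWithin (0 : ℝ) (Set.Ioi 0), ∀ k : κ,
        φ k.1.2 y * φ k.1.1 (p + ε • e) - φ k.1.1 y * φ k.1.2 (p + ε • e) ≠ 0 := by
      rw [Filter.eventually_all]
      intro k
      set a := φ k.1.2 y * φ k.1.1 p - φ k.1.1 y * φ k.1.2 p with ha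
      have h3 : ∀ ε : ℝ, φ k.1.2 y * φ k.1.1 (p + ε • e) - φ k.1.1 y * φ k.1.2 (p + ε • e) =
          a + ε * ⟪g k, e⟫_ℝ := by
        intro ε
        simp only [hφ, ha, g, inner_add_right, real_inner_smul_right, inner_sub_left,
          real_inner_smul_left]
        ring
      have h4 : ∀ᶠ ε in nhdsWithin (0 : ℝ) (Set.Ioi 0), ε ≠ -a / ⟪g k, e⟫_ℝ := by
        rcases eq_or_ne (-a / ⟪g k, e⟫_ℝ) 0 with h0 | h0
        · rw [h0]
          filter_upwards [self_mem_nhdsWithin] with ε hε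
          exact ne_of_gt hε
        · exact (isOpen_ne.eventually_mem h0.symm).filter_mono nhdsWithin_le_nhds
      filter_upwards [h4] with ε hε h0
      rw [h3] at h0
      apply hε
      rw [eq_div_iff (he k)]
      linarith
    obtain ⟨ε, h3, h4⟩ := (h1.and h2).exists
    exact ⟨p + ε • e, h3, fun i hi j hj hij => h4 ⟨⟨⟨i, hi⟩, ⟨j, hj⟩⟩, by simpa using hij⟩⟩
  have hpos : ∀ t ∈ affReflections Γ, 0 < φ t p * φ t p' := by
    intro t ht
    have h1 := hpp' t ht
    rw [hsep t ht] at h1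
    exact lt_of_le_of_ne (not_lt.1 h1) (mul_ne_zero (hreg t ht p hp) (hreg t ht p' hp')).symm
  have hsep' : ∀ t ∈ affReflections Γ, ∀ z, φ t p * φ t z < 0 ↔ φ t p' * φ t z < 0 := by
    intro t ht z
    have h1 := hpos t ht
    rcases pos_and_pos_or_neg_and_neg_of_mul_pos h1 with h2 | h2
    · simp [mul_neg_iff, h2.1, h2.2, h2.1.not_gt, h2.2.not_gt]
    · simp [mul_neg_iff, h2.1, h2.2, h2.1.not_gt, h2.2.not_gt]
  -- The quotient is the parameter at which the segment from `p'` to `y` meets the wall of `t`.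
  obtain ⟨s, hs, hmin⟩ := Set.exists_min_image T₀ (fun t => φ t p' / (φ t p' - φ t y)) hfin hne
  refine ⟨s, hs.1, hs.2, fun r hr hrs => ?_⟩
  set τ := φ s p' / (φ s p' - φ s y) with hτ
  have cross : ∀ t ∈ T₀, φ t p' * φ t y < 0 := by
    intro t ht
    rw [← hsep' t ht.1, ← hsep t ht.1]
    exact ht.2
  have hden : ∀ t ∈ T₀, φ t p' - φ t y ≠ 0 := by
    intro t ht h0
    have := cross t ht
    rw [sub_eq_zero.1 h0] at this
    nlinarith [sq_nonneg (φ t y)]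
  have hτeq : τ * (φ s p' - φ s y) = φ s p' := div_mul_cancel₀ _ (hden s hs)
  have hτ0 : 0 < τ := by
    have h1 := cross s hs
    have h2 : τ * (φ s p' * φ s p' - φ s p' * φ s y) = φ s p' * φ s p' := by
      linear_combination φ s p' * hτeq
    have h3 := mul_self_pos.2 (hreg s hs.1 p' hp')
    exact pos_of_mul_pos_left (h2 ▸ h3) (by linarith)
  have hτ1 : τ < 1 := by
    have h1 := cross s hs
    have h2 : (1 - τ) * (φ s y * φ s y - φ s p' * φ s y) = φ s y * φ s y := by
      linear_combination φ s y * hτeq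
    have h3 := mul_self_pos.2 (hreg s hs.1 y hy)
    exact sub_pos.1 (pos_of_mul_pos_left (h2 ▸ h3) (by linarith))
  set x : ℝ → E := fun ε => p' + ε • (y - p') with hx
  have hφx : ∀ t ε, φ t (x ε) = (1 - ε) * φ t p' + ε * φ t y := by
    intro t ε
    simp only [hφ, hx, inner_add_right, real_inner_smul_right, inner_sub_right]
    ring
  -- before the parameter `τ` the segment stays in the alcove
  have hbefore : ∀ t ∈ affReflections Γ, ∀ ε, 0 < ε → ε < τ → 0 ≤ φ t p' * φ t (x ε) := by
    intro t ht ε h0 h1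
    rw [hφx]
    by_cases h2 : t ∈ T₀
    · have h3 := cross t h2
      have h4 : ε ≤ φ t p' / (φ t p' - φ t y) := h1.le.trans (hmin t h2)
      have h5 : 0 < φ t p' * (φ t p' - φ t y) := by nlinarith [sq_nonneg (φ t p')]
      have h6 : φ t p' / (φ t p' - φ t y) * (φ t p' * (φ t p' - φ t y)) = φ t p' * φ t p' := by
        field_simp [hden t h2]
      have h7 := mul_le_mul_of_nonneg_right h4 h5.le
      rw [h6] at h7
      nlinarith
    · have h3 : ¬ φ t p' * φ t y < 0 := by
        rw [← hsep' t ht, ← hsep t ht]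
        exact fun h4 => h2 ⟨ht, h4⟩
      nlinarith [mul_nonneg (sub_nonneg.2 (h1.trans hτ1).le) (mul_self_nonneg (φ t p')),
        mul_nonneg h0.le (not_lt.1 h3)]
  have hsγ : γ s ≠ 0 := h.ne_zero (hγ s hs.1)
  have hss : s * s = 1 := by rw [hn s hs.1]; exact affRefl_mul_self _ hsγ _
  have hsinv : s⁻¹ = s := inv_eq_of_mul_eq_one_left hss
  have hsp : IsRegular Γ (s p) := isRegular_affRefl h hs.1 hp
  have hsp' : IsRegular Γ (s p') := isRegular_affRefl h hs.1 hp'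
  have hsrs : s * r * s⁻¹ ∈ affReflections Γ := conj_mem_affReflections h hs.1 hr
  have hconj : ∀ a b, Separates r (s a) (s b) ↔ Separates (s * r * s⁻¹) a b := by
    intro a b
    have h1 := separates_conj s (s * r * s⁻¹) a b
    have h2 : s * (s * r * s⁻¹) * s⁻¹ = r := by
      rw [hsinv]
      calc s * (s * r * s) * s = (s * s) * r * (s * s) := by group
        _ = r := by rw [hss]; simp
    rwa [h2] at h1
  have hr1 : φ r p' * φ r (s p') < 0 := by
    have h1 : ¬ Separates r (s p) (s p') := by
      rw [hconj]
      exact hpp' _ hsrs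
    have h2 := separates_trans h hr hp hsp hsp'
    have h3 : Separates r p (s p') := by tauto
    rwa [hsep r hr, hsep' r hr] at h3
  have hr2 : ∀ ε, 0 < ε → ε < τ → φ r (x ε) * φ r (s (x ε)) ≤ 0 := by
    intro ε h0 h1
    have h2 := hbefore r hr ε h0 h1
    have h3 : 0 ≤ φ r (s p') * φ r (s (x ε)) := by
      rw [← not_lt, ← hsep r hr, hconj, hsep _ hsrs, not_lt]
      exact hbefore _ hsrs ε h0 h1
    have h4 := mul_nonneg h2 h3
    by_contra h5
    nlinarith
  -- Since `s` fixes `x τ`, this limit inequality will say that a square is at most `0`.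
  have hr3 : φ r (x τ) * φ r (s (x τ)) ≤ 0 := by
    have hc : Continuous fun ε => φ r (x ε) * φ r (s (x ε)) := by
      have h1 : Continuous (s : E → E) := s.continuous
      simp only [hφ, hx]
      fun_prop
    have h1 : Filter.Tendsto (fun ε => φ r (x ε) * φ r (s (x ε))) (nhdsWithin τ (Set.Iio τ))
        (nhds (φ r (x τ) * φ r (s (x τ)))) := (hc.tendsto τ).mono_left nhdsWithin_le_nhds
    refine le_of_tendsto h1 ?_
    filter_upwards [Ioo_mem_nhdsLT hτ0] with ε hε
    exact hr2 ε hε.1 hε.2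
  have hsx : φ s (x τ) = 0 := by
    rw [hφx]
    linarith
  have hsx' : s (x τ) = x τ := by
    conv_lhs => rw [hn s hs.1]
    rw [affRefl_apply]
    change x τ - φ s (x τ) • _ = _
    rw [hsx, zero_smul, sub_zero]
  rw [hsx'] at hr3
  have hrx : φ r (x τ) = 0 := by
    have : φ r (x τ) * φ r (x τ) = 0 := le_antisymm hr3 (mul_self_nonneg _)
    exact mul_self_eq_zero.1 this
  rw [hφx] at hrx hsx
  by_contra hne'
  have hrT : r ∈ T₀ := by
    refine ⟨hr, ?_⟩
    rw [hsep r hr, hsep' r hr]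
    have h1 := mul_self_pos.2 (hreg r hr p' hp')
    by_contra h2
    have h3 : (1 - τ) * (φ r p' * φ r p') + τ * (φ r p' * φ r y) = 0 := by
      linear_combination φ r p' * hrx
    nlinarith [mul_pos (sub_pos.2 hτ1) h1]
  apply hgen r hrT s hs hne'
  have h1 : (1 - τ) * (φ s y * φ r p' - φ r y * φ s p') = 0 := by
    linear_combination φ s y * hrx - φ r y * hsx
  exact (mul_eq_zero.1 h1).resolve_left (sub_pos.2 hτ1).ne'

theorem isWallSystem (h : IsRootSet Γ) {p : E} (hp : IsRegular Γ p) :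
    IsWallSystem (affReflections Γ) (fun t a b => Separates t (a p) (b p)) where
  mul_self := by
    rintro _ ⟨γ, hγ, n, rfl⟩
    exact affRefl_mul_self γ (h.ne_zero hγ) _
  conj_mem s hs t ht := conj_mem_affReflections h hs ht
  not_sep_self t a := not_lt.2 real_inner_self_nonneg
  sep_trans t ht a ha b hb c hc := separates_trans h ht ((isRegular_iff_of_mem h ha p).2 hp)
    ((isRegular_iff_of_mem h hb p).2 hp) ((isRegular_iff_of_mem h hc p).2 hp)
  sep_conj g t a b := separates_conj g t (a p) (b p)
  sep_one := by
    rintro _ ⟨γ, hγ, n, rfl⟩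
    rw [separates_affRefl (h.ne_zero hγ), inner_affRefl γ (h.ne_zero hγ)]
    have := mul_self_pos.2 (hp.ne_zero hγ n)
    change (⟪γ, p⟫_ℝ - n) * _ < 0
    linarith
  finite t _ := finite_separating h p (t p)
  eq_of_comm := by
    rintro _ ⟨γ, hγ, n, rfl⟩ _ ⟨δ, hδ, m, rfl⟩ hc hs
    exact eq_of_affRefl_comm (h.ne_zero hγ) (h.ne_zero hδ) hc hs
  exists_wall := by
    intro t ht
    refine exists_wall_separating h hp (isRegular_affRefl h ht hp) ?_
    intro hs
    apply hs t ht
    obtain ⟨γ, hγ, n, rfl⟩ := ht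
    rw [separates_affRefl (h.ne_zero hγ), inner_affRefl γ (h.ne_zero hγ)]
    have := mul_self_pos.2 (hp.ne_zero hγ n)
    change (⟪γ, p⟫_ℝ - n) * _ < 0
    linarith

/-- An element of the affine Weyl group that maps some point of an alcove into that alcove is
trivial. -/
theorem eq_one_of_sameAlcove (h : IsRootSet Γ) {u : E ≃ᵃⁱ[ℝ] E}
    (hu : u ∈ Subgroup.closure (affReflections Γ)) {p : E} (hp : IsRegular Γ p)
    (hs : SameAlcove Γ p (u p)) : u = 1 :=
  (isWallSystem h hp).eq_one hu hs

end Affine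

/-! ### Root systems, simple roots and the highest root -/

section Roots

variable {E : Type*} [NormedAddCommGroup E] [InnerProductSpace ℝ E] {Φ : Set E}

theorem inner_coroot_mul (a b : E) (ha : a ≠ 0) : ⟪coroot a, b⟫_ℝ * ⟪a, a⟫_ℝ = 2 * ⟪a, b⟫_ℝ := by
  have : ⟪a, a⟫_ℝ ≠ 0 := inner_self_ne_zero.2 ha
  rw [coroot, real_inner_smul_left]
  field_simp

/-- If one of the two Cartan integers is `1`, a reflection produces `a - b` up to sign. Otherwise
both are at least `2`, so both squared norms are at most `⟪a, b⟫` and `a - b` has norm `0`. -/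
theorem IsRootSet.sub_mem (h : IsRootSet Φ) {a b : E} (ha : a ∈ Φ) (hb : b ∈ Φ)
    (hab : 0 < ⟪a, b⟫_ℝ) (hne : a ≠ b) : a - b ∈ Φ := by
  have ha0 := h.ne_zero ha
  have hb0 := h.ne_zero hb
  have haa : 0 < ⟪a, a⟫_ℝ := real_inner_self_pos.2 ha0
  have hbb : 0 < ⟪b, b⟫_ℝ := real_inner_self_pos.2 hb0
  obtain ⟨m, hm⟩ := h.integral a ha b hb
  obtain ⟨n, hn⟩ := h.integral b hb a ha
  have h1 := inner_coroot_mul a b ha0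
  have h2 := inner_coroot_mul b a hb0
  rw [hm] at h1
  rw [hn, real_inner_comm a b] at h2
  have hm0 : 0 < m := by
    have : (0 : ℝ) < m := pos_of_mul_pos_left (by rw [h1]; positivity) haa.le
    exact_mod_cast this
  have hn0 : 0 < n := by
    have : (0 : ℝ) < n := pos_of_mul_pos_left (by rw [h2]; positivity) hbb.le
    exact_mod_cast this
  by_cases hm1 : m = 1
  · have h3 := h.neg_mem (h.refl_mem a ha b hb)
    rw [refl_apply, hm, hm1] at h3
    simpa using h3
  by_cases hn1 : n = 1
  · have h3 := h.refl_mem b hb a ha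
    rw [refl_apply, hn, hn1] at h3
    simpa using h3
  exfalso
  have hm2 : (2 : ℝ) ≤ m := by exact_mod_cast (by omega : 2 ≤ m)
  have hn2 : (2 : ℝ) ≤ n := by exact_mod_cast (by omega : 2 ≤ n)
  have h3 : ⟪a, a⟫_ℝ ≤ ⟪a, b⟫_ℝ := by nlinarith
  have h4 : ⟪b, b⟫_ℝ ≤ ⟪a, b⟫_ℝ := by nlinarith
  have h5 : 0 < ⟪a - b, a - b⟫_ℝ := real_inner_self_pos.2 (sub_ne_zero.2 hne)
  rw [inner_sub_left, inner_sub_right, inner_sub_right, real_inner_comm a b] at h5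
  linarith

theorem IsRootSet.add_mem (h : IsRootSet Φ) {a b : E} (ha : a ∈ Φ) (hb : b ∈ Φ)
    (hab : ⟪a, b⟫_ℝ < 0) (hne : a ≠ -b) : a + b ∈ Φ := by
  have := h.sub_mem ha (h.neg_mem hb) (by rw [inner_neg_right]; linarith) hne
  rwa [sub_neg_eq_add] at this

/-- Elements of a subgroup of the Weyl group preserve `Φ`. -/
theorem map_mem_of_mem_weylGroup (h : IsRootSet Φ) {Γ : Set E} (hΓ : Γ ⊆ Φ) {g : E ≃ₗᵢ[ℝ] E}
    (hg : g ∈ weylGroup Γ) : ∀ β, g β ∈ Φ ↔ β ∈ Φ := by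
  induction hg using Subgroup.closure_induction with
  | mem t ht =>
    obtain ⟨γ, hγ, rfl⟩ := ht
    intro β
    refine ⟨fun hβ => ?_, h.refl_mem γ (hΓ hγ) β⟩
    have := h.refl_mem γ (hΓ hγ) _ hβ
    rwa [refl_refl] at this
  | one => intro β; rfl
  | mul a b _ _ iha ihb => intro β; exact (iha (b β)).trans (ihb β)
  | inv a _ iha =>
    intro β
    rw [← iha (a⁻¹ β)]
    have : a (a⁻¹ β) = β := a.apply_symm_apply β
    rw [this]

theorem finite_weylGroup (h : IsRootSystem Φ) : Finite (weylGroup Φ) := by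
  have : Finite Φ := h.finite
  let f : weylGroup Φ → (Φ → Φ) := fun g β =>
    ⟨g.1 β.1, (map_mem_of_mem_weylGroup h.isRootSet subset_rfl g.2 _).2 β.2⟩
  refine Finite.of_injective f ?_
  intro g g' hgg
  apply Subtype.ext
  apply LinearIsometryEquiv.toLinearEquiv_injective
  apply LinearEquiv.toLinearMap_injective
  refine LinearMap.ext_on h.span_eq_top ?_
  intro β hβ
  exact congrArg Subtype.val (congrFun hgg ⟨β, hβ⟩)

theorem orderOf_pos_of_mem_weylGroup (h : IsRootSystem Φ) {g : E ≃ₗᵢ[ℝ] E}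
    (hg : g ∈ weylGroup Φ) : 0 < orderOf g := by
  have := finite_weylGroup h
  have h1 := orderOf_pos (⟨g, hg⟩ : weylGroup Φ)
  rwa [← Subgroup.orderOf_coe] at h1

variable {ι : Type*} [Fintype ι] {α : Module.Basis ι ℝ E}

theorem exists_nat_of_mem_closure {κ : Type*} [Fintype κ] {v : κ → E} {x : E}
    (hx : x ∈ AddSubmonoid.closure (Set.range v)) : ∃ c : κ → ℕ, x = ∑ k, c k • v k := by
  classical
  induction hx using AddSubmonoid.closure_induction with
  | mem x hx =>
    obtain ⟨k, rfl⟩ := hx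
    exact ⟨Pi.single k 1, by simp [Pi.single_apply, ite_smul]⟩
  | zero => exact ⟨0, by simp⟩
  | add x y _ _ hx hy =>
    obtain ⟨c, rfl⟩ := hx
    obtain ⟨d, rfl⟩ := hy
    exact ⟨c + d, by simp [add_smul, Finset.sum_add_distrib]⟩

theorem repr_sum_nat (c : ι → ℕ) (i : ι) : α.repr (∑ k, c k • α k) i = c i := by
  have : ∑ k, c k • α k = ∑ k, (c k : ℝ) • α k := by
    simp only [Nat.cast_smul_eq_nsmul]
  rw [this, α.repr_sum_self]

theorem inner_eq_sum_repr (x y : E) : ⟪x, y⟫_ℝ = ∑ i, α.repr x i * ⟪α i, y⟫_ℝ := by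
  conv_lhs => rw [← α.sum_repr x]
  simp only [sum_inner, real_inner_smul_left]

theorem repr_nonneg_or (hα : IsRootBasis Φ (Set.range α)) {β : E} (hβ : β ∈ Φ) :
    (∀ i, 0 ≤ α.repr β i) ∨ (∀ i, α.repr β i ≤ 0) := by
  rcases hα.mem_or_neg_mem β hβ with h1 | h1
  · obtain ⟨c, rfl⟩ := exists_nat_of_mem_closure h1
    left
    intro i
    rw [repr_sum_nat]
    positivity
  · obtain ⟨c, hc⟩ := exists_nat_of_mem_closure h1
    right
    intro i
    have := repr_sum_nat (α := α) c i
    rw [← hc, map_neg, Finsupp.neg_apply] at this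
    have h2 : (0 : ℝ) ≤ c i := by positivity
    linarith

theorem repr_nonneg_of_pos (hα : IsRootBasis Φ (Set.range α)) {β : E} (hβ : β ∈ Φ) {i : ι}
    (hi : 0 < α.repr β i) : ∀ j, 0 ≤ α.repr β j := by
  rcases repr_nonneg_or hα hβ with h1 | h1
  · exact h1
  · exact absurd (h1 i) hi.not_ge

theorem exists_repr_ne_zero {x : E} (hx : x ≠ 0) : ∃ i, α.repr x i ≠ 0 := by
  by_contra! h
  apply hx
  rw [← α.sum_repr x]
  simp [h]

theorem simple_mem (hα : IsRootBasis Φ (Set.range α)) (i : ι) : α i ∈ Φ := hα.subset ⟨i, rfl⟩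

theorem inner_simple_nonpos (h : IsRootSet Φ) (hα : IsRootBasis Φ (Set.range α)) {i j : ι}
    (hij : i ≠ j) : ⟪α i, α j⟫_ℝ ≤ 0 := by
  classical
  by_contra! h1
  have h2 := h.sub_mem (simple_mem hα i) (simple_mem hα j) h1 (α.injective.ne hij)
  have h3 : α.repr (α i - α j) i = 1 := by
    simp [hij.symm]
  have h4 : α.repr (α i - α j) j = -1 := by
    simp [hij]
  have h5 := repr_nonneg_of_pos hα h2 (i := i) (by rw [h3]; norm_num) j
  rw [h4] at h5
  norm_num at h5

/-- Reflecting `γ + α i` in `α i` would give `γ - α i`, which has coefficients of both signs. -/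
theorem add_simple_notMem (h : IsRootSet Φ) (hα : IsRootBasis Φ (Set.range α)) {γ : E} {i : ι}
    (hγ : γ ∈ Φ) (hpos : ∀ j, 0 ≤ α.repr γ j) (hi : α.repr γ i = 0) (hin : ⟪γ, α i⟫_ℝ = 0) :
    γ + α i ∉ Φ := by
  classical
  intro h1
  have h2 := h.refl_mem _ (simple_mem hα i) _ h1
  have h3 : refl (α i) (γ + α i) = γ - α i := by
    have h4 : ⟪coroot (α i), γ⟫_ℝ = 0 := by
      rw [coroot, real_inner_smul_left, real_inner_comm γ, hin, mul_zero]
    rw [refl_apply, inner_add_right, h4, real_inner_comm,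
      inner_self_coroot (h.ne_zero (simple_mem hα i)), zero_add, two_smul]
    abel
  rw [h3] at h2
  obtain ⟨j, hj⟩ := exists_repr_ne_zero (α := α) (h.ne_zero hγ)
  have hij : i ≠ j := by
    rintro rfl
    exact hj hi
  have h4 : α.repr (γ - α i) j = α.repr γ j := by
    simp [hij]
  have h5 : α.repr (γ - α i) i = -1 := by
    simp [hi]
  have h6 := repr_nonneg_of_pos hα h2 (i := j) (by rw [h4]; exact lt_of_le_of_ne (hpos j) hj.symm) i
  rw [h5] at h6
  norm_num at h6

theorem repr_add_simple [DecidableEq ι] (x : E) (i j : ι) :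
    α.repr (x + α i) j = α.repr x j + if i = j then 1 else 0 := by
  simp [Finsupp.single_apply]

theorem height_add (x y : E) : height α (x + y) = height α x + height α y := by
  simp [height, Finset.sum_add_distrib]

theorem height_simple (i : ι) : height α (α i) = 1 := by
  classical
  simp [height, Finsupp.single_apply]

/-- From a positive counterexample of minimal height some simple root can be subtracted, leaving a
root supported on one side. Adding it back either stays on that side or is forbidden by
`add_simple_notMem`. -/
theorem support_subset_or (h : IsRootSet Φ) (hα : IsRootBasis Φ (Set.range α)) (J : ι → Prop)
    (hJ : ∀ i j, J i → ¬ J j → ⟪α i, α j⟫_ℝ = 0) {γ : E} (hγ : γ ∈ Φ) :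
    (∀ i, ¬ J i → α.repr γ i = 0) ∨ (∀ i, J i → α.repr γ i = 0) := by
  classical
  set P : E → Prop := fun γ => (∀ i, ¬ J i → α.repr γ i = 0) ∨ (∀ i, J i → α.repr γ i = 0)
    with hP
  -- a counterexample of minimal height
  have key : ∀ γ ∈ Φ, (∀ i, 0 ≤ α.repr γ i) → P γ := by
    by_contra! hcon
    set S := {γ | γ ∈ Φ ∧ (∀ i, 0 ≤ α.repr γ i) ∧ ¬ P γ} with hS
    have hfin : S.Finite := h.finite.subset fun γ hγ => hγ.1
    have hne : S.Nonempty := hcon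
    obtain ⟨γ, ⟨hγ, hpos, hPγ⟩, hmin⟩ := Set.exists_min_image S (height α) hfin hne
    have h1 : ∃ i, 0 < α.repr γ i * ⟪α i, γ⟫_ℝ := by
      by_contra! h2
      have h3 : 0 < ⟪γ, γ⟫_ℝ := real_inner_self_pos.2 (h.ne_zero hγ)
      rw [inner_eq_sum_repr (α := α)] at h3
      exact absurd (Finset.sum_nonpos fun i _ => h2 i) h3.not_ge
    obtain ⟨i, hi⟩ := h1
    have hi2 : 0 < ⟪γ, α i⟫_ℝ := by
      rw [real_inner_comm]
      exact pos_of_mul_pos_right hi (hpos i)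
    have hsimple : ∀ i, P (α i) := by
      intro i
      by_cases hi : J i
      · left
        intro j hj
        have : i ≠ j := by rintro rfl; exact hj hi
        simp [this]
      · right
        intro j hj
        have : i ≠ j := by rintro rfl; exact hi hj
        simp [this]
    have hne' : γ ≠ α i := by
      rintro rfl
      exact hPγ (hsimple i)
    have h2 := h.sub_mem hγ (simple_mem hα i) hi2 hne'
    set γ' := γ - α i with hγ'
    have hγeq : γ = γ' + α i := by rw [hγ']; abel
    have hpos' : ∀ j, 0 ≤ α.repr γ' j := by
      by_contra hcon'
      have h3 := (repr_nonneg_or hα h2).resolve_left hcon'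
      apply hPγ
      have h4 : ∀ j, j ≠ i → α.repr γ j = 0 := by
        intro j hj
        have h5 := h3 j
        have h6 := hpos j
        rw [hγeq, repr_add_simple, if_neg hj.symm, add_zero] at h6 ⊢
        exact le_antisymm h5 h6
      rcases hsimple i with h5 | h5
      · left
        intro j hj
        apply h4
        rintro rfl
        have := h5 j hj
        simp at this
      · right
        intro j hj
        apply h4
        rintro rfl
        have := h5 j hj
        simp at this
    have hP' : P γ' := by
      by_contra hcon'
      have h3 := hmin γ' ⟨h2, hpos', hcon'⟩
      rw [hγeq, height_add, height_simple] at h3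
      linarith
    have hfinal : α.repr γ' i = 0 → ⟪γ', α i⟫_ℝ = 0 → False := by
      intro h3 h4
      apply add_simple_notMem h hα h2 hpos' h3 h4
      rwa [← hγeq]
    rcases hP' with h3 | h3
    · by_cases hi : J i
      · apply hPγ
        left
        intro j hj
        have : i ≠ j := by rintro rfl; exact hj hi
        rw [hγeq, repr_add_simple, h3 j hj, if_neg this, add_zero]
      · apply hfinal (h3 i hi)
        rw [inner_eq_sum_repr (α := α)]
        refine Finset.sum_eq_zero fun j _ => ?_
        by_cases hj : J j
        · rw [hJ j i hj hi, mul_zero]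
        · rw [h3 j hj, zero_mul]
    · by_cases hi : J i
      · apply hfinal (h3 i hi)
        rw [inner_eq_sum_repr (α := α)]
        refine Finset.sum_eq_zero fun j _ => ?_
        by_cases hj : J j
        · rw [h3 j hj, zero_mul]
        · rw [real_inner_comm, hJ i j hi hj, mul_zero]
      · apply hPγ
        right
        intro j hj
        have : i ≠ j := by rintro rfl; exact hi hj
        rw [hγeq, repr_add_simple, h3 j hj, if_neg this, add_zero]
  rcases repr_nonneg_or hα hγ with h1 | h1
  · exact key γ hγ h1
  · have h2 := key (-γ) (h.neg_mem hγ) (by simpa using h1)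
    simpa [hP] using h2

/-- Against a simple root outside the support, dominance leaves a sum of nonpositive terms that is
nonnegative. So support and complement are orthogonal, contradicting irreducibility. -/
theorem repr_pos_of_dominant (h : IsRootSet Φ) (hirr : IsIrred Φ)
    (hα : IsRootBasis Φ (Set.range α)) {β : E} (hβ : β ∈ Φ) (hpos : ∀ i, 0 ≤ α.repr β i)
    (hdom : ∀ i, 0 ≤ ⟪β, α i⟫_ℝ) (i : ι) : 0 < α.repr β i := by
  classical
  by_contra! hi
  set J : ι → Prop := fun j => 0 < α.repr β j with hJdef
  have hzero : ∀ j, ¬ J j → α.repr β j = 0 := fun j hj => le_antisymm (not_lt.1 hj) (hpos j)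
  have hJ : ∀ k j, J k → ¬ J j → ⟪α k, α j⟫_ℝ = 0 := by
    intro k j hk hj
    have h1 := hdom j
    rw [inner_eq_sum_repr (α := α)] at h1
    have h2 : ∀ l ∈ Finset.univ, α.repr β l * ⟪α l, α j⟫_ℝ ≤ 0 := by
      intro l _
      by_cases hl : l = j
      · rw [hl, hzero j hj, zero_mul]
      · exact mul_nonpos_of_nonneg_of_nonpos (hpos l) (inner_simple_nonpos h hα hl)
    have h3 := (Finset.sum_eq_zero_iff_of_nonpos h2).1 (le_antisymm (Finset.sum_nonpos h2) h1) k
      (Finset.mem_univ _)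
    exact (mul_eq_zero.1 h3).resolve_left hk.ne'
  have h1 := hirr.2 {γ | γ ∈ Φ ∧ ∀ i, ¬ J i → α.repr γ i = 0}
    {γ | γ ∈ Φ ∧ ∀ i, J i → α.repr γ i = 0} ?_ ?_
  · rcases h1 with h1 | h1
    · exact (h1 ▸ (Set.notMem_empty β)) ⟨hβ, hzero⟩
    · refine (h1 ▸ (Set.notMem_empty (α i))) ⟨simple_mem hα i, ?_⟩
      intro j hj
      have : i ≠ j := by
        rintro rfl
        exact absurd hj hi.not_gt
      simp [this]
  · ext γ
    constructor
    · intro hγ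
      rcases support_subset_or h hα J hJ hγ with h2 | h2
      · exact Or.inl ⟨hγ, h2⟩
      · exact Or.inr ⟨hγ, h2⟩
    · rintro (h2 | h2) <;> exact h2.1
  · rintro x ⟨-, hx⟩ y ⟨-, hy⟩
    rw [inner_eq_sum_repr (α := α)]
    refine Finset.sum_eq_zero fun k _ => ?_
    by_cases hk : J k
    · rw [real_inner_comm, inner_eq_sum_repr (α := α), Finset.sum_eq_zero, mul_zero]
      intro l _
      by_cases hl : J l
      · rw [hy l hl, zero_mul]
      · rw [real_inner_comm, hJ k l hk hl, mul_zero]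
    · rw [hx k hk, zero_mul]

theorem dominant_of_maximal (h : IsRootSet Φ) (hα : IsRootBasis Φ (Set.range α)) {β : E}
    (hβ : β ∈ Φ) (hpos : ∀ i, 0 ≤ α.repr β i)
    (hmax : ∀ γ ∈ Φ, (∀ i, α.repr β i ≤ α.repr γ i) → height α γ ≤ height α β) (i : ι) :
    0 ≤ ⟪β, α i⟫_ℝ := by
  classical
  by_contra! hi
  have h1 : β ≠ -α i := by
    rintro rfl
    have := hpos i
    simp at this
    linarith
  have h2 := hmax _ (h.add_mem hβ (simple_mem hα i) hi h1) (by
    intro j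
    rw [repr_add_simple]
    split_ifs <;> linarith)
  rw [height_add, height_simple] at h2
  linarith

variable {θ : E}

theorem highest_nonneg (hα : IsRootBasis Φ (Set.range α)) (hθ : IsHighestRoot Φ α θ) :
    ∀ i, 0 ≤ α.repr θ i := by
  rcases repr_nonneg_or hα hθ.1 with h1 | h1
  · exact h1
  · intro i
    have h2 := hθ.2 _ (simple_mem hα i)
    rw [height_simple] at h2
    have h3 : height α θ ≤ 0 := Finset.sum_nonpos fun j _ => h1 j
    linarith

/-- A root `γ` of maximal height among those above `β` is dominant. As `θ` has full support, `⟪θ, γ⟫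
> 0`, so `θ - γ` is zero or a root, and the height of `θ` makes it positive. -/
theorem repr_le_highest (h : IsRootSet Φ) (hirr : IsIrred Φ) (hα : IsRootBasis Φ (Set.range α))
    (hθ : IsHighestRoot Φ α θ) {β : E} (hβ : β ∈ Φ) (i : ι) : α.repr β i ≤ α.repr θ i := by
  have hθ0 := highest_nonneg hα hθ
  have hθd := dominant_of_maximal h hα hθ.1 hθ0 fun γ hγ _ => hθ.2 γ hγ
  have hθp := repr_pos_of_dominant h hirr hα hθ.1 hθ0 hθd
  rcases repr_nonneg_or hα hβ with hβ0 | hβ0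
  swap
  · exact (hβ0 i).trans (hθ0 i)
  obtain ⟨γ, ⟨hγ, hβγ⟩, hmax⟩ := Set.exists_max_image
    {γ | γ ∈ Φ ∧ ∀ i, α.repr β i ≤ α.repr γ i} (height α) (h.finite.subset fun γ hγ => hγ.1)
    ⟨β, hβ, fun i => le_rfl⟩
  have hγ0 : ∀ i, 0 ≤ α.repr γ i := fun i => (hβ0 i).trans (hβγ i)
  have hγd := dominant_of_maximal h hα hγ hγ0 fun δ hδ hle =>
    hmax δ ⟨hδ, fun i => (hβγ i).trans (hle i)⟩
  refine (hβγ i).trans ?_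
  by_cases heq : θ = γ
  · rw [heq]
  have hin : 0 < ⟪θ, γ⟫_ℝ := by
    rw [inner_eq_sum_repr (α := α)]
    have h1 : ∀ j, 0 ≤ α.repr θ j * ⟪α j, γ⟫_ℝ := fun j =>
      mul_nonneg (hθ0 j) (by rw [real_inner_comm]; exact hγd j)
    refine lt_of_le_of_ne (Finset.sum_nonneg fun j _ => h1 j) fun h0 => ?_
    have h2 := (Finset.sum_eq_zero_iff_of_nonneg fun j _ => h1 j).1 h0.symm
    have h3 : ⟪γ, γ⟫_ℝ = 0 := by
      rw [inner_eq_sum_repr (α := α)]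
      refine Finset.sum_eq_zero fun j hj => ?_
      rw [(mul_eq_zero.1 (h2 j hj)).resolve_left (hθp j).ne', mul_zero]
    exact h.ne_zero hγ (inner_self_eq_zero.1 h3)
  have h1 := h.sub_mem hθ.1 hγ hin heq
  rcases repr_nonneg_or hα h1 with h2 | h2
  · have := h2 i
    rw [map_sub, Finsupp.sub_apply] at this
    linarith
  · exfalso
    obtain ⟨j, hj⟩ := exists_repr_ne_zero (α := α) (h.ne_zero h1)
    have h3 : height α (θ - γ) < 0 :=
      Finset.sum_neg' (fun k _ => h2 k) ⟨j, Finset.mem_univ _, lt_of_le_of_ne (h2 j) hj⟩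
    have h4 := hθ.2 γ hγ
    have h5 : height α θ = height α (θ - γ) + height α γ := by
      rw [← height_add, sub_add_cancel]
    linarith

/-- On the closed fundamental alcove, the positive roots take values between `0` and `⟪θ, x⟫`. -/
theorem inner_le_inner_highest (h : IsRootSet Φ) (hirr : IsIrred Φ)
    (hα : IsRootBasis Φ (Set.range α)) (hθ : IsHighestRoot Φ α θ) {β x : E} (hβ : β ∈ Φ)
    (hx : ∀ i, 0 ≤ ⟪α i, x⟫_ℝ) : ⟪β, x⟫_ℝ ≤ ⟪θ, x⟫_ℝ := by
  rw [inner_eq_sum_repr (α := α), inner_eq_sum_repr (α := α) θ]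
  exact Finset.sum_le_sum fun i _ =>
    mul_le_mul_of_nonneg_right (repr_le_highest h hirr hα hθ hβ i) (hx i)

theorem inner_pos_of_repr_nonneg {β x : E} (hβ0 : β ≠ 0) (hβ : ∀ i, 0 ≤ α.repr β i)
    (hx : ∀ i, 0 < ⟪α i, x⟫_ℝ) : 0 < ⟪β, x⟫_ℝ := by
  rw [inner_eq_sum_repr (α := α)]
  obtain ⟨j, hj⟩ := exists_repr_ne_zero (α := α) hβ0
  exact Finset.sum_pos' (fun i _ => mul_nonneg (hβ i) (hx i).le)
    ⟨j, Finset.mem_univ _, mul_pos (lt_of_le_of_ne (hβ j) hj.symm) (hx j)⟩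

theorem isRegular_of_mem_alcove (h : IsRootSet Φ) (hirr : IsIrred Φ)
    (hα : IsRootBasis Φ (Set.range α)) (hθ : IsHighestRoot Φ α θ) {x : E} (hx : x ∈ alcove α θ) :
    IsRegular Φ x := by
  have key : ∀ β ∈ Φ, (∀ i, 0 ≤ α.repr β i) → ∀ n : ℤ, ⟪β, x⟫_ℝ ≠ n := by
    intro β hβ hpos n hn
    have h1 := inner_pos_of_repr_nonneg (h.ne_zero hβ) hpos hx.1
    have h2 := (inner_le_inner_highest h hirr hα hθ hβ fun i => (hx.1 i).le).trans_lt hx.2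
    rw [hn] at h1 h2
    have h3 : 0 < n := by exact_mod_cast h1
    have h4 : n < 1 := by exact_mod_cast h2
    omega
  intro β hβ n hn
  rcases repr_nonneg_or hα hβ with h1 | h1
  · exact key β hβ h1 n hn
  · refine key (-β) (h.neg_mem hβ) (by simpa using h1) (-n) ?_
    rw [inner_neg_left, hn]
    push_cast
    rfl

end Roots

/-! ### Folding as an orthogonal projection -/

section Fold

variable {E : Type*} [NormedAddCommGroup E] [InnerProductSpace ℝ E] {ω : E ≃ₗᵢ[ℝ] E}

/-- Folding as a linear map. -/
def foldLin (ω : E ≃ₗᵢ[ℝ] E) : E →ₗ[ℝ] fixedSpace ω where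
  toFun := fold ω
  map_add' x y := by
    apply Subtype.ext
    simp [fold, average, Finset.sum_add_distrib]
  map_smul' c x := by
    apply Subtype.ext
    simp [fold, average, ← Finset.smul_sum, smul_comm c]

theorem foldLin_apply (x : E) : foldLin ω x = fold ω x := rfl

theorem fold_add (x y : E) : fold ω (x + y) = fold ω x + fold ω y := (foldLin ω).map_add x y
theorem fold_sub (x y : E) : fold ω (x - y) = fold ω x - fold ω y := (foldLin ω).map_sub x y
theorem fold_neg (x : E) : fold ω (-x) = -fold ω x := (foldLin ω).map_neg x
theorem fold_smul (c : ℝ) (x : E) : fold ω (c • x) = c • fold ω x := (foldLin ω).map_smul c x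
theorem fold_sum {κ : Type*} (s : Finset κ) (x : κ → E) :
    fold ω (∑ k ∈ s, x k) = ∑ k ∈ s, fold ω (x k) := map_sum (foldLin ω) x s

theorem pow_apply_of_fixed {x : E} (hx : ω x = x) (t : ℕ) : (ω ^ t) x = x := by
  induction t with
  | zero => rfl
  | succ t ih =>
    rw [pow_succ']
    change ω ((ω ^ t) x) = x
    rw [ih, hx]

/-- All powers of `ω` are isometries fixing `y`, so every term pairs alike: averaging is the
orthogonal projection onto the fixed space. -/
theorem inner_average (hd : 0 < orderOf ω) (x : E) {y : E} (hy : ω y = y) :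
    ⟪average ω x, y⟫_ℝ = ⟪x, y⟫_ℝ := by
  have h1 : ∀ t ∈ Finset.Icc 1 (orderOf ω), ⟪(ω ^ t) x, y⟫_ℝ = ⟪x, y⟫_ℝ := by
    intro t _
    conv_lhs => rw [← pow_apply_of_fixed hy t]
    exact (ω ^ t).inner_map_map x y
  have h2 : (orderOf ω : ℝ) ≠ 0 := by positivity
  rw [average, real_inner_smul_left, sum_inner, Finset.sum_congr rfl h1]
  simp
  field_simp

theorem inner_fold (hd : 0 < orderOf ω) (x : E) (y : fixedSpace ω) :
    ⟪fold ω x, y⟫_ℝ = ⟪x, (y : E)⟫_ℝ := inner_average hd x y.2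

theorem fold_eq_iff (hd : 0 < orderOf ω) {x : E} {y : fixedSpace ω} :
    fold ω x = y ↔ ∀ e : E, ω e = e → ⟪x, e⟫_ℝ = ⟪(y : E), e⟫_ℝ := by
  constructor
  · rintro rfl e he
    exact (inner_average hd x he).symm
  · intro h
    refine ext_inner_right ℝ fun e => ?_
    rw [inner_fold hd]
    exact h e e.2

theorem fold_map (hd : 0 < orderOf ω) (x : E) : fold ω (ω x) = fold ω x := by
  rw [fold_eq_iff hd]
  intro e he
  conv_lhs => rw [← he]
  rw [ω.inner_map_map]
  exact (inner_average hd x he).symm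

theorem fold_pow (hd : 0 < orderOf ω) (t : ℕ) (x : E) : fold ω ((ω ^ t) x) = fold ω x := by
  induction t with
  | zero => rfl
  | succ t ih =>
    rw [pow_succ']
    change fold ω (ω ((ω ^ t) x)) = _
    rw [fold_map hd, ih]

theorem fold_of_fixed (hd : 0 < orderOf ω) {x : E} (hx : ω x = x) : (fold ω x : E) = x := by
  have : fold ω x = (⟨x, hx⟩ : fixedSpace ω) := (fold_eq_iff hd).2 fun e _ => rfl
  rw [this]

end Fold

/-! ### The action on the extended simple roots -/

section Alcove

variable {E : Type*} [NormedAddCommGroup E] [InnerProductSpace ℝ E] {Φ : Set E}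
variable {ι : Type*} [Fintype ι] {α : Module.Basis ι ℝ E} {θ : E}

/-- The Cartan integers `2 * c` and `2 / c` have product `4`, leaving `c = 1/2, 1, 2`; reducedness
excludes the outer two. -/
theorem eq_one_of_smul_mem (h : IsRootSet Φ) (hred : IsReduced Φ) {β : E} {c : ℝ} (hβ : β ∈ Φ)
    (hc : 0 < c) (hcβ : c • β ∈ Φ) : c = 1 := by
  have hβ0 := h.ne_zero hβ
  obtain ⟨m, hm⟩ := h.integral _ hβ _ hcβ
  obtain ⟨n, hn⟩ := h.integral _ hcβ _ hβ
  rw [real_inner_smul_right, real_inner_comm, inner_self_coroot hβ0] at hm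
  rw [coroot_smul, real_inner_smul_left, real_inner_comm, inner_self_coroot hβ0] at hn
  have hmn : m * n = 4 := by
    have : (m : ℝ) * n = 4 := by
      rw [← hm, ← hn]
      field_simp
      norm_num
    exact_mod_cast this
  have hm0 : 0 < m := by
    have : (0 : ℝ) < m := by rw [← hm]; positivity
    exact_mod_cast this
  have hm4 : m ≤ 4 := Int.le_of_dvd (by norm_num) ⟨n, hmn.symm⟩
  interval_cases m
  · exfalso
    apply hred β hβ
    have : c = 1 / 2 := by push_cast at hm; linarith
    rwa [← this]
  · push_cast at hm; linarith
  · omega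
  · exfalso
    apply hred _ hcβ
    have : c = 2 := by push_cast at hm; linarith
    rw [this, smul_smul]
    norm_num
    exact hβ

/-- The constant terms of the affine functions that define the fundamental alcove. -/
def extConst : Option ι → ℤ
  | none => 1
  | some _ => 0

/-- The affine functions that define the fundamental alcove. -/
def extValue (α : Module.Basis ι ℝ E) (θ : E) (i : Option ι) (x : E) : ℝ :=
  ⟪extSimple α θ i, x⟫_ℝ + (extConst i : ℤ)

theorem extValue_none (x : E) : extValue α θ none x = 1 - ⟪θ, x⟫_ℝ := by
  simp [extValue, extSimple, extConst]
  ring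

theorem extValue_some (i : ι) (x : E) : extValue α θ (some i) x = ⟪α i, x⟫_ℝ := by
  simp [extValue, extSimple, extConst]

theorem mem_alcove_iff {x : E} : x ∈ alcove α θ ↔ ∀ i, 0 < extValue α θ i x := by
  simp only [Option.forall, extValue_none, extValue_some, sub_pos]
  exact and_comm

theorem extSimple_mem (h : IsRootSet Φ) (hα : IsRootBasis Φ (Set.range α))
    (hθ : IsHighestRoot Φ α θ) (i : Option ι) : extSimple α θ i ∈ Φ := by
  cases i with
  | none => exact h.neg_mem hθ.1
  | some i => exact simple_mem hα i

theorem extSimple_injective (hα : IsRootBasis Φ (Set.range α)) (hθ : IsHighestRoot Φ α θ) :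
    Function.Injective (extSimple α θ) := by
  have key : ∀ i, -θ ≠ α i := by
    intro i hi
    have h1 := highest_nonneg hα hθ i
    have h2 : α.repr (-θ) i = 1 := by rw [hi]; simp
    rw [map_neg, Finsupp.neg_apply] at h2
    linarith
  intro i j hij
  cases i <;> cases j
  · rfl
  · exact absurd hij (key _)
  · exact absurd hij.symm (key _)
  · exact congrArg some (α.injective hij)

/-- The coefficients come from writing `β + n` as `n * (1 - θ)` plus the sum of `(β_i + n * θ_i) *
α_i`. -/
theorem exists_nonneg_combination (h : IsRootSet Φ) (hirr : IsIrred Φ)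
    (hα : IsRootBasis Φ (Set.range α)) (hθ : IsHighestRoot Φ α θ) {β x₀ : E} {n : ℤ}
    (hβ : β ∈ Φ) (hx₀ : x₀ ∈ alcove α θ) (hn : 0 < ⟪β, x₀⟫_ℝ + n) :
    ∃ c : Option ι → ℝ, (∀ i, 0 ≤ c i) ∧
      ∀ x, ⟪β, x⟫_ℝ + n = ∑ i, c i * extValue α θ i x := by
  have hθ0 := highest_nonneg hα hθ
  have hx0 := fun i => (hx₀.1 i).le
  have hn1 : ⟪β, x₀⟫_ℝ < 1 := (inner_le_inner_highest h hirr hα hθ hβ hx0).trans_lt hx₀.2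
  have hn0 : 0 ≤ n := by
    have : (-1 : ℝ) < n := by linarith
    have : -1 < n := by exact_mod_cast this
    omega
  have hc : ∀ i, 0 ≤ α.repr β i + n * α.repr θ i := by
    intro i
    have h3 : (0 : ℝ) ≤ n := by exact_mod_cast hn0
    rcases repr_nonneg_or hα hβ with h1 | h1
    · exact add_nonneg (h1 i) (mul_nonneg h3 (hθ0 i))
    -- For negative `β`, positivity at `x₀` forces `n ≥ 1`, and the coefficients of `-β` are bounded
    -- by those of `θ`.
    · have h2 := inner_pos_of_repr_nonneg (α := α) (neg_ne_zero.2 (h.ne_zero hβ)) (by simpa using h1)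
        hx₀.1
      rw [inner_neg_left] at h2
      have h4 : (0 : ℝ) < n := by linarith
      have h4 : 0 < n := by exact_mod_cast h4
      have h4 : (1 : ℝ) ≤ n := by exact_mod_cast h4
      have h5 := repr_le_highest h hirr hα hθ (h.neg_mem hβ) i
      rw [map_neg, Finsupp.neg_apply] at h5
      nlinarith [hθ0 i]
  refine ⟨fun i => i.elim (n : ℝ) fun i => α.repr β i + n * α.repr θ i, ?_, ?_⟩
  · rintro (_ | i)
    · exact (Int.cast_nonneg hn0 : (0 : ℝ) ≤ n)
    · exact hc i
  · intro x
    rw [Fintype.sum_option, inner_eq_sum_repr (α := α) β]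
    simp only [Option.elim, extValue_none, extValue_some]
    rw [inner_eq_sum_repr (α := α) θ]
    simp only [add_mul, Finset.sum_add_distrib, mul_assoc, ← Finset.mul_sum]
    ring

theorem exists_inner_simple_eq (α : Module.Basis ι ℝ E) (c : ι → ℝ) :
    ∃ y : E, ∀ i, ⟪α i, y⟫_ℝ = c i := by
  classical
  refine ⟨∑ j, c j • coweight α (some j), fun i => ?_⟩
  simp [inner_sum, real_inner_smul_right, inner_coweight]

theorem exists_mem_alcove (hα : IsRootBasis Φ (Set.range α)) (hθ : IsHighestRoot Φ α θ) :
    ∃ x, x ∈ alcove α θ := by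
  have hm : 0 ≤ ∑ i, α.repr θ i := Finset.sum_nonneg fun i _ => highest_nonneg hα hθ i
  obtain ⟨y, hy⟩ := exists_inner_simple_eq α fun _ => 1 / (1 + ∑ i, α.repr θ i)
  refine ⟨y, fun i => by rw [hy]; positivity, ?_⟩
  rw [inner_eq_sum_repr (α := α)]
  simp only [hy, ← Finset.sum_mul]
  rw [mul_one_div, div_lt_one (by positivity)]
  linarith

theorem exists_mem_face (h : IsRootSet Φ) (hα : IsRootBasis Φ (Set.range α))
    (hθ : IsHighestRoot Φ α θ) (i : Option ι) :
    ∃ y, extValue α θ i y = 0 ∧ ∀ j, j ≠ i → 0 < extValue α θ j y := by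
  classical
  have hθ0 := highest_nonneg hα hθ
  have hm : 0 < ∑ i, α.repr θ i := by
    obtain ⟨j, hj⟩ := exists_repr_ne_zero (α := α) (h.ne_zero hθ.1)
    exact Finset.sum_pos' (fun i _ => hθ0 i)
      ⟨j, Finset.mem_univ _, lt_of_le_of_ne (hθ0 j) hj.symm⟩
  cases i with
  | none =>
    obtain ⟨y, hy⟩ := exists_inner_simple_eq α fun _ => 1 / ∑ i, α.repr θ i
    refine ⟨y, ?_, ?_⟩
    · rw [extValue_none, inner_eq_sum_repr (α := α)]
      simp only [hy, ← Finset.sum_mul]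
      rw [mul_one_div, div_self hm.ne', sub_self]
    · rintro (_ | j) hj
      · exact absurd rfl hj
      · rw [extValue_some, hy]
        positivity
  | some i =>
    obtain ⟨y, hy⟩ := exists_inner_simple_eq α
      fun j => if j = i then 0 else 1 / (1 + ∑ i, α.repr θ i)
    refine ⟨y, by rw [extValue_some, hy, if_pos rfl], ?_⟩
    rintro (_ | j) hj
    · rw [extValue_none, inner_eq_sum_repr (α := α), sub_pos]
      have h1 : ∑ j, α.repr θ j * ⟪α j, y⟫_ℝ ≤
          ∑ j, α.repr θ j * (1 / (1 + ∑ i, α.repr θ i)) := by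
        refine Finset.sum_le_sum fun j _ => mul_le_mul_of_nonneg_left ?_ (hθ0 j)
        rw [hy]
        split_ifs
        · positivity
        · exact le_rfl
      refine h1.trans_lt ?_
      rw [← Finset.sum_mul, mul_one_div, div_lt_one (by positivity)]
      linarith
    · rw [extValue_some, hy, if_neg (fun h => hj (congrArg some h))]
      positivity

theorem isom_inner_left (ω : E ≃ₗᵢ[ℝ] E) (x y : E) : ⟪x, ω y⟫_ℝ = ⟪ω⁻¹ x, y⟫_ℝ := by
  have : x = ω (ω⁻¹ x) := (ω.apply_symm_apply x).symm
  conv_lhs => rw [this]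
  exact ω.inner_map_map _ _

variable {ω : E ≃ₗᵢ[ℝ] E} {z : E}

/-- Pulled back by the affine map, each wall function is a nonnegative combination of wall
functions. A point inside the face `i` goes to a point where some wall function `k` vanishes, and
there only the coefficient at `i` can survive. So the pullback of `k` is a multiple of `i`, and
reducedness makes the factor `1`. -/
theorem exists_extSimple_map (h : IsRootSet Φ) (hirr : IsIrred Φ) (hred : IsReduced Φ)
    (hα : IsRootBasis Φ (Set.range α)) (hθ : IsHighestRoot Φ α θ) (hω : ω ∈ weylGroup Φ)
    (hz : z ∈ coweightLattice Φ) (hA : (fun x => z + ω x) '' alcove α θ = alcove α θ)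
    (i : Option ι) : ∃ k, ω (extSimple α θ i) = extSimple α θ k ∧
      ∀ x, extValue α θ k (z + ω x) = extValue α θ i x := by
  classical
  obtain ⟨x₀, hx₀⟩ := exists_mem_alcove hα hθ
  have hval : ∀ k, ∃ n : ℤ, ∀ x, extValue α θ k (z + ω x) = ⟪ω⁻¹ (extSimple α θ k), x⟫_ℝ + n := by
    intro k
    obtain ⟨n, hn⟩ := hz _ (extSimple_mem h hα hθ k)
    refine ⟨n + extConst k, fun x => ?_⟩
    rw [extValue, inner_add_right, isom_inner_left, hn]
    push_cast
    ring
  have hmem : ∀ k, ω⁻¹ (extSimple α θ k) ∈ Φ := fun k =>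
    (map_mem_of_mem_weylGroup h subset_rfl (inv_mem hω) _).2 (extSimple_mem h hα hθ k)
  have hcomb : ∀ k, ∃ c : Option ι → ℝ, (∀ i, 0 ≤ c i) ∧
      ∀ x, extValue α θ k (z + ω x) = ∑ i, c i * extValue α θ i x := by
    intro k
    obtain ⟨n, hn⟩ := hval k
    have h1 : z + ω x₀ ∈ alcove α θ := by
      rw [← hA]
      exact ⟨x₀, hx₀, rfl⟩
    have h2 := mem_alcove_iff.1 h1 k
    rw [hn] at h2
    obtain ⟨c, hc, hcx⟩ := exists_nonneg_combination h hirr hα hθ (hmem k) hx₀ h2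
    exact ⟨c, hc, fun x => by rw [hn, hcx]⟩
  choose c hc0 hc using hcomb
  obtain ⟨y, hy0, hy⟩ := exists_mem_face h hα hθ i
  have hynn : ∀ j, 0 ≤ extValue α θ j y := by
    intro j
    by_cases hj : j = i
    · rw [hj, hy0]
    · exact (hy j hj).le
  obtain ⟨k, hk⟩ : ∃ k, extValue α θ k (z + ω y) = 0 := by
    by_contra! hne
    have h1 : z + ω y ∈ alcove α θ := by
      rw [mem_alcove_iff]
      intro k
      refine lt_of_le_of_ne ?_ (hne k).symm
      rw [hc]
      exact Finset.sum_nonneg fun j _ => mul_nonneg (hc0 k j) (hynn j)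
    rw [← hA] at h1
    obtain ⟨x, hx, hxy⟩ := h1
    have h2 : x = y := ω.injective (add_left_cancel hxy)
    rw [h2] at hx
    have := mem_alcove_iff.1 hx i
    rw [hy0] at this
    exact lt_irrefl _ this
  have hck : ∀ j, j ≠ i → c k j = 0 := by
    intro j hj
    rw [hc] at hk
    have h1 := (Finset.sum_eq_zero_iff_of_nonneg
      fun j _ => mul_nonneg (hc0 k j) (hynn j)).1 hk j (Finset.mem_univ _)
    exact (mul_eq_zero.1 h1).resolve_right (hy j hj).ne'
  have hki : ∀ x, extValue α θ k (z + ω x) = c k i * extValue α θ i x := by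
    intro x
    rw [hc, Finset.sum_eq_single i]
    · intro j _ hj
      rw [hck j hj, zero_mul]
    · intro hi
      exact absurd (Finset.mem_univ _) hi
  have hlin : ω⁻¹ (extSimple α θ k) = c k i • extSimple α θ i := by
    obtain ⟨n, hn⟩ := hval k
    refine ext_inner_right ℝ fun x => ?_
    have h1 := hki x
    have h2 := hki 0
    rw [hn, extValue] at h1 h2
    rw [inner_zero_right, inner_zero_right] at h2
    rw [real_inner_smul_left]
    linarith
  have hpos : 0 < c k i := by
    refine lt_of_le_of_ne (hc0 k i) fun h0 => ?_
    rw [← h0, zero_smul] at hlin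
    exact h.ne_zero (hmem k) hlin
  have hone : c k i = 1 :=
    eq_one_of_smul_mem h hred (extSimple_mem h hα hθ i) hpos (hlin ▸ hmem k)
  refine ⟨k, ?_, fun x => by rw [hki, hone, one_mul]⟩
  rw [hone, one_smul] at hlin
  rw [← hlin]
  exact ω.apply_symm_apply _

end Alcove

/-! ### Means of orbits and the folding point -/

section Alcove

variable {E : Type*} [NormedAddCommGroup E] [InnerProductSpace ℝ E] {Φ : Set E}
variable {ι : Type*} [Fintype ι] {α : Module.Basis ι ℝ E} {θ : E}

/-- The affine map `x ↦ z + ω x`. -/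
def affMap (z : E) (ω : E ≃ₗᵢ[ℝ] E) (x : E) : E := z + ω x

/-- The mean of the first `orderOf ω` iterates of `x` under `x ↦ z + ω x`. -/
def orbitMean (z : E) (ω : E ≃ₗᵢ[ℝ] E) (x : E) : E :=
  (1 / (orderOf ω : ℝ)) • ∑ t ∈ Finset.range (orderOf ω), (affMap z ω)^[t] x

theorem iterate_affMap (z : E) (ω : E ≃ₗᵢ[ℝ] E) (t : ℕ) (x : E) :
    (affMap z ω)^[t] x = (affMap z ω)^[t] 0 + (ω ^ t) x := by
  induction t generalizing x with
  | zero => simp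
  | succ t ih =>
    rw [Function.iterate_succ_apply, ih (affMap z ω x), Function.iterate_succ_apply, ih (affMap z ω 0),
      affMap, affMap, map_zero, add_zero, map_add, pow_succ]
    rw [add_assoc]
    rfl

variable {ω : E ≃ₗᵢ[ℝ] E} {z : E}

theorem isom_mem_coweightLattice {x : E} (hω : ∀ β, ω β ∈ Φ ↔ β ∈ Φ)
    (hx : x ∈ coweightLattice Φ) : ω x ∈ coweightLattice Φ := by
  intro γ hγ
  rw [isom_inner_left]
  apply hx
  rw [← hω]
  have : ω (ω⁻¹ γ) = γ := ω.apply_symm_apply γ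
  rwa [this]

theorem iterate_zero_mem_coweightLattice (hω : ∀ β, ω β ∈ Φ ↔ β ∈ Φ)
    (hz : z ∈ coweightLattice Φ) (t : ℕ) : (affMap z ω)^[t] 0 ∈ coweightLattice Φ := by
  induction t with
  | zero => exact zero_mem _
  | succ t ih =>
    rw [Function.iterate_succ_apply']
    exact add_mem hz (isom_mem_coweightLattice hω ih)

theorem affMap_orbitMean (hd : 0 < orderOf ω) {x : E}
    (hx : (affMap z ω)^[orderOf ω] x = x) : affMap z ω (orbitMean z ω x) = orbitMean z ω x := by
  have hd' : (orderOf ω : ℝ) ≠ 0 := by positivity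
  have h1 : ∑ t ∈ Finset.range (orderOf ω), affMap z ω ((affMap z ω)^[t] x) =
      ∑ t ∈ Finset.range (orderOf ω), (affMap z ω)^[t] x := by
    have h2 := Finset.sum_range_succ' (fun t => (affMap z ω)^[t] x) (orderOf ω)
    rw [Finset.sum_range_succ, hx] at h2
    simp only [Function.iterate_succ_apply', Function.iterate_zero, id_eq] at h2
    exact (add_right_cancel h2).symm
  conv_rhs => rw [orbitMean, ← h1]
  simp only [affMap, Finset.sum_add_distrib, smul_add, Finset.sum_const, Finset.card_range]
  rw [orbitMean, map_smul, map_sum, ← Nat.cast_smul_eq_nsmul ℝ, smul_smul, one_div_mul_cancel hd', one_smul]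

theorem extValue_orbitMean (hd : 0 < orderOf ω) (i : Option ι) (x : E) :
    extValue α θ i (orbitMean z ω x) =
      (1 / (orderOf ω : ℝ)) * ∑ t ∈ Finset.range (orderOf ω),
        extValue α θ i ((affMap z ω)^[t] x) := by
  have hd' : (orderOf ω : ℝ) ≠ 0 := by positivity
  simp only [extValue, orbitMean, real_inner_smul_right, inner_sum, Finset.sum_add_distrib,
    Finset.sum_const, Finset.card_range, nsmul_eq_mul]
  field_simp

/-- A point `v` of the closed fundamental alcove that is fixed by an affine map
`x ↦ z + ω x` stabilizing the alcove, and is the mean of an orbit of special points. -/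
structure IsFoldingPoint (Φ : Set E) (α : Module.Basis ι ℝ E) (θ : E) (ω : E ≃ₗᵢ[ℝ] E) (v : E) :
    Prop where
  sub_mem : v - ω v ∈ coweightLattice Φ
  not_int : ∀ γ ∈ Φ, fold ω γ = 0 → ∀ n : ℤ, ⟪γ, v⟫_ℝ ≠ n
  mul_int : ∀ γ ∈ Φ, ∀ q g : ℕ, orderOf ω = g * q → (ω ^ q) γ = γ → ∃ n : ℤ, q * ⟪γ, v⟫_ℝ = n
  nonneg : ∀ i, 0 ≤ ⟪α i, v⟫_ℝ
  lt_one : ⟪θ, v⟫_ℝ < 1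
  pos : ∀ i, (∃ t : ℤ, (ω ^ t) (α i) = -θ) → 0 < ⟪α i, v⟫_ℝ

/-- The map `ω` permutes the extended simple roots. -/
theorem exists_extSimple_pow (h : IsRootSet Φ) (hirr : IsIrred Φ) (hred : IsReduced Φ)
    (hα : IsRootBasis Φ (Set.range α)) (hθ : IsHighestRoot Φ α θ) (hω : ω ∈ weylGroup Φ)
    (hz : z ∈ coweightLattice Φ) (hA : (fun x => z + ω x) '' alcove α θ = alcove α θ)
    (t : ℕ) (i : Option ι) : ∃ k, (ω ^ t) (extSimple α θ i) = extSimple α θ k ∧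
      ∀ x, extValue α θ k ((affMap z ω)^[t] x) = extValue α θ i x := by
  induction t with
  | zero => exact ⟨i, rfl, fun x => rfl⟩
  | succ t ih =>
    obtain ⟨k, hk, hkx⟩ := ih
    obtain ⟨l, hl, hlx⟩ := exists_extSimple_map h hirr hred hα hθ hω hz hA k
    refine ⟨l, ?_, fun x => ?_⟩
    · rw [pow_succ', ← hl, ← hk]
      rfl
    · rw [Function.iterate_succ_apply', affMap, hlx, hkx]

theorem eq_of_inner_simple {x y : E} (hxy : ∀ i, ⟪α i, x⟫_ℝ = ⟪α i, y⟫_ℝ) : x = y := by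
  rw [← sub_eq_zero, ← inner_self_eq_zero (𝕜 := ℝ), inner_eq_sum_repr (α := α)]
  refine Finset.sum_eq_zero fun i _ => ?_
  rw [inner_sub_right, hxy, sub_self, mul_zero]

/-- The point is the mean of the orbit of `0`. Orbit points of `0` are coweights in the closed
alcove, which controls the values at the mean; the mean `p` of an orbit inside the open alcove
serves as a regular fixed point for comparison. -/
theorem exists_isFoldingPoint (h : IsRootSystem Φ) (hirr : IsIrred Φ) (hred : IsReduced Φ)
    (hα : IsRootBasis Φ (Set.range α)) (hθ : IsHighestRoot Φ α θ)
    (hω : ω ∈ omegaGroup Φ α θ) : ∃ v, IsFoldingPoint Φ α θ ω v := by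
  obtain ⟨hW, z, hz, hA⟩ := hω
  have hr := h.isRootSet
  have hd : 0 < orderOf ω := orderOf_pos_of_mem_weylGroup h hW
  have hd' : (0 : ℝ) < 1 / (orderOf ω : ℝ) := by positivity
  have hmap := map_mem_of_mem_weylGroup hr subset_rfl hW
  have hinj := extSimple_injective hα hθ
  have hperm := exists_extSimple_pow hr hirr hred hα hθ hW hz hA
  -- As `ω ^ orderOf ω` fixes each simple root, this iterate preserves the values of all simple
  -- roots.
  have hper : ∀ x, (affMap z ω)^[orderOf ω] x = x := by
    intro x
    refine eq_of_inner_simple (α := α) fun i => ?_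
    obtain ⟨k, hk, hkx⟩ := hperm (orderOf ω) (some i)
    rw [pow_orderOf_eq_one] at hk
    have hk : extSimple α θ (some i) = extSimple α θ k := hk
    have h1 := hkx x
    rwa [← hinj hk, extValue_some, extValue_some] at h1
  obtain ⟨x₀, hx₀⟩ := exists_mem_alcove hα hθ
  set p := orbitMean z ω x₀ with hp
  set v := orbitMean z ω 0 with hv
  have hpfix : z + ω p = p := affMap_orbitMean hd (hper x₀)
  have hvfix : z + ω v = v := affMap_orbitMean hd (hper 0)
  have hpA : p ∈ alcove α θ := by
    rw [mem_alcove_iff]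
    intro i
    rw [extValue_orbitMean hd]
    refine mul_pos hd' (Finset.sum_pos (fun t ht => ?_) ⟨0, Finset.mem_range.2 hd⟩)
    clear ht
    suffices (affMap z ω)^[t] x₀ ∈ alcove α θ from mem_alcove_iff.1 this i
    induction t with
    | zero => exact hx₀
    | succ t ih =>
      rw [Function.iterate_succ_apply', ← hA]
      exact ⟨_, ih, rfl⟩
  -- the values of the affine simple roots along the orbit of `0`
  have hvals : ∀ i, ∀ s ≤ orderOf ω, ∀ k, (ω ^ s) (extSimple α θ i) = extSimple α θ k →
      extValue α θ i ((affMap z ω)^[orderOf ω - s] 0) = extValue α θ k 0 := by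
    intro i s hs k hk
    obtain ⟨l, hl, hlx⟩ := hperm s i
    rw [hk] at hl
    rw [hinj hl, ← hlx, ← Function.iterate_add_apply, Nat.add_sub_cancel' hs, hper]
  have hnn0 : ∀ k, 0 ≤ extValue α θ k 0 := by
    rintro (_ | k)
    · simp [extValue_none]
    · simp [extValue_some]
  have hnn : ∀ i, ∀ t < orderOf ω, 0 ≤ extValue α θ i ((affMap z ω)^[t] 0) := by
    intro i t ht
    obtain ⟨k, hk, -⟩ := hperm (orderOf ω - t) i
    have := hvals i (orderOf ω - t) (Nat.sub_le _ _) k hk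
    rw [Nat.sub_sub_self ht.le] at this
    rw [this]
    exact hnn0 k
  have hvpos : ∀ i, ∀ t < orderOf ω, 0 < extValue α θ i ((affMap z ω)^[t] 0) →
      0 < extValue α θ i v := by
    intro i t ht h1
    rw [hv, extValue_orbitMean hd]
    exact mul_pos hd' (Finset.sum_pos' (fun t ht => hnn i t (Finset.mem_range.1 ht))
      ⟨t, Finset.mem_range.2 ht, h1⟩)
  refine ⟨v, ?_, ?_, ?_, ?_, ?_, ?_⟩
  · have : v - ω v = z := sub_eq_iff_eq_add.2 hvfix.symm
    rwa [this]
  -- Both `v` and `p` are fixed by the affine map, so `v - p` is fixed by `ω` and orthogonal to `γ`.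
  -- Thus `γ` has the same value at `v` as at the regular point `p`.
  · intro γ hγ hfold n hn
    have h1 : ω (v - p) = v - p := by
      rw [map_sub]
      rw [← sub_eq_zero]
      have h2 : ω v = v - z := by rw [eq_sub_iff_add_eq', hvfix]
      have h3 : ω p = p - z := by rw [eq_sub_iff_add_eq', hpfix]
      rw [h2, h3]
      abel
    have h2 := inner_average hd γ h1
    have h3 : average ω γ = 0 := congrArg Subtype.val hfold
    rw [h3, inner_zero_left, inner_sub_right] at h2
    exact isRegular_of_mem_alcove hr hirr hα hθ hpA γ hγ n (by linarith)
  -- The values `b t` of `γ` along the orbit are integers with `b (q + t) = b q + b t`. Closing up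
  -- after `g * q` steps forces `b q = 0`, so the mean over the orbit is a mean of `q` integers.
  · intro γ hγ q g hqg hfix
    have hg0 : g ≠ 0 := by rintro rfl; omega
    set b : ℕ → ℝ := fun t => ⟪γ, (affMap z ω)^[t] 0⟫_ℝ with hb
    have hstep : ∀ t, b (q + t) = b q + b t := by
      intro t
      simp only [hb]
      rw [Function.iterate_add_apply, iterate_affMap z ω q, inner_add_right]
      congr 1
      conv_lhs => rw [← hfix]
      exact (ω ^ q).inner_map_map _ _
    have hmul : ∀ j : ℕ, b (j * q) = j * b q := by
      intro j
      induction j with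
      | zero => simp [hb]
      | succ j ih =>
        rw [Nat.succ_mul, add_comm, hstep, ih]
        push_cast
        ring
    have hbq : b q = 0 := by
      have h1 := hmul g
      have h2 : b (g * q) = 0 := by
        rw [← hqg]
        simp only [hb]
        rw [hper, inner_zero_right]
      rw [h2] at h1
      exact (mul_eq_zero.1 h1.symm).resolve_left (by exact_mod_cast hg0)
    have hsum : ∀ j : ℕ, ∑ t ∈ Finset.range (j * q), b t = j * ∑ t ∈ Finset.range q, b t := by
      intro j
      induction j with
      | zero => simp
      | succ j ih =>
        rw [Nat.succ_mul, add_comm, Finset.sum_range_add]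
        simp only [hstep, hbq, zero_add, ih]
        push_cast
        ring
    have hint : ∃ n : ℤ, ∑ t ∈ Finset.range q, b t = n := by
      have h1 : ∑ t ∈ Finset.range q, (affMap z ω)^[t] 0 ∈ coweightLattice Φ :=
        sum_mem fun t _ => iterate_zero_mem_coweightLattice hmap hz t
      obtain ⟨n, hn⟩ := h1 γ hγ
      exact ⟨n, by rw [← hn, inner_sum]⟩
    obtain ⟨n, hn⟩ := hint
    refine ⟨n, ?_⟩
    rw [hv, orbitMean, real_inner_smul_right, inner_sum]
    have h1 := hsum g
    rw [← hqg] at h1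
    rw [h1, hn, hqg]
    have hg : (g : ℝ) ≠ 0 := by exact_mod_cast hg0
    have hq : (q : ℝ) ≠ 0 := by
      have : q ≠ 0 := by rintro rfl; omega
      exact_mod_cast this
    push_cast
    field_simp
  · intro i
    rw [← extValue_some (θ := θ) (α := α), hv, extValue_orbitMean hd]
    exact mul_nonneg hd'.le (Finset.sum_nonneg fun t ht => hnn _ t (Finset.mem_range.1 ht))
  · have h1 := hvpos none 0 hd (by simp [extValue_none])
    rw [extValue_none] at h1
    linarith
  · rintro i ⟨t, ht⟩
    rw [← extValue_some (θ := θ) (α := α)]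
    have hd0 : (orderOf ω : ℤ) ≠ 0 := by exact_mod_cast hd.ne'
    obtain ⟨s, hs⟩ := Int.eq_ofNat_of_zero_le (Int.emod_nonneg t hd0)
    have hslt : s < orderOf ω := by
      have := Int.emod_lt_of_pos t (by exact_mod_cast hd : (0 : ℤ) < orderOf ω)
      rw [hs] at this
      exact_mod_cast this
    have hs1 : (ω ^ s) (extSimple α θ (some i)) = extSimple α θ none := by
      rw [← zpow_mod_orderOf, hs, zpow_natCast] at ht
      exact ht
    have hs0 : s ≠ 0 := by
      rintro rfl
      exact Option.some_ne_none i (hinj hs1)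
    -- At this orbit point `α i` takes the value of the wall function of `-θ` at `0`, which is `1`.
    refine hvpos (some i) (orderOf ω - s) (by omega) ?_
    rw [hvals _ s hslt.le none hs1]
    simp [extValue_none]

end Alcove

/-! ### The stabilizer of the fixed space in the Weyl group -/

section Stabilizer

variable {E : Type*} [NormedAddCommGroup E] [InnerProductSpace ℝ E] {Φ Γ : Set E}

theorem toAffine_mem_closure {g : E ≃ₗᵢ[ℝ] E} (hg : g ∈ weylGroup Γ) :
    g.toAffineIsometryEquiv ∈ Subgroup.closure (affReflections Γ) := by
  induction hg using Subgroup.closure_induction with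
  | mem t ht =>
    obtain ⟨γ, hγ, rfl⟩ := ht
    refine Subgroup.subset_closure ⟨γ, hγ, 0, ?_⟩
    ext x
    rw [affRefl_apply, LinearIsometryEquiv.coe_toAffineIsometryEquiv, refl_apply', Int.cast_zero,
      sub_zero]
  | one =>
    have : (1 : E ≃ₗᵢ[ℝ] E).toAffineIsometryEquiv = 1 := by ext x; rfl
    rw [this]
    exact one_mem _
  | mul a b _ _ iha ihb =>
    have : (a * b).toAffineIsometryEquiv = a.toAffineIsometryEquiv * b.toAffineIsometryEquiv := by
      ext x; rfl
    rw [this]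
    exact mul_mem iha ihb
  | inv a _ iha =>
    have : (a⁻¹).toAffineIsometryEquiv = (a.toAffineIsometryEquiv)⁻¹ := by
      ext x; rfl
    rw [this]
    exact inv_mem iha

theorem fixed_of_mem_weylGroup {p : E} (hp : ∀ γ ∈ Γ, ⟪γ, p⟫_ℝ = 0) {g : E ≃ₗᵢ[ℝ] E}
    (hg : g ∈ weylGroup Γ) : g p = p := by
  induction hg using Subgroup.closure_induction with
  | mem t ht =>
    obtain ⟨γ, hγ, rfl⟩ := ht
    rw [refl_apply', hp γ hγ, zero_smul, sub_zero]
  | one => rfl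
  | mul a b _ _ iha ihb =>
    change a (b p) = p
    rw [ihb, iha]
  | inv a _ iha =>
    conv_lhs => rw [← iha]
    exact a.symm_apply_apply p

theorem exists_pos_forall_mul_lt {κ : Type*} [Finite κ] (c a : κ → ℝ) (ha : ∀ k, 0 < a k) :
    ∃ δ : ℝ, 0 < δ ∧ ∀ k, δ * c k < a k := by
  have h1 : ∀ᶠ δ in nhdsWithin (0 : ℝ) (Set.Ioi 0), ∀ k, δ * c k < a k := by
    rw [Filter.eventually_all]
    intro k
    have hc : ContinuousAt (fun δ : ℝ => δ * c k) 0 := by fun_prop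
    exact (hc.eventually_lt_const (by simpa using ha k)).filter_mono nhdsWithin_le_nhds
  obtain ⟨δ, h2, h3⟩ := (h1.and self_mem_nhdsWithin).exists
  exact ⟨δ, h3, h2⟩

/-- The roots that are orthogonal to the fixed space of `ω`. -/
def vanishing (Φ : Set E) (ω : E ≃ₗᵢ[ℝ] E) : Set E := {γ | γ ∈ Φ ∧ fold ω γ = 0}

variable {ω : E ≃ₗᵢ[ℝ] E}

/-- An element of the Weyl group is a product of reflections that fix its fixed space. -/
theorem mem_weylGroup_vanishing (h : IsRootSystem Φ) (hω : ω ∈ weylGroup Φ) :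
    ω ∈ weylGroup (vanishing Φ ω) := by
  have hd : 0 < orderOf ω := orderOf_pos_of_mem_weylGroup h hω
  have hr := h.isRootSet
  have hfinΦ : Finite Φ := h.finite
  have hfinW := finite_weylGroup h
  have hsub : vanishing Φ ω ⊆ Φ := fun γ hγ => hγ.1
  have hle : weylGroup (vanishing Φ ω) ≤ weylGroup Φ :=
    Subgroup.closure_mono (Set.image_mono hsub)
  -- A general fixed point of `ω`: the only roots vanishing at it are those that vanish on the whole
  -- fixed space.
  obtain ⟨p₀, hp₀⟩ : ∃ p₀ : fixedSpace ω, ∀ γ ∈ Φ, fold ω γ ≠ 0 → ⟪γ, (p₀ : E)⟫_ℝ ≠ 0 := by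
    have : Finite {γ : Φ // fold ω γ ≠ 0} := inferInstance
    obtain ⟨e, he⟩ := exists_inner_ne_zero (fun γ : {γ : Φ // fold ω γ.1 ≠ 0} => fold ω γ.1.1)
      (fun γ => γ.2)
    refine ⟨e, fun γ hγ hγ0 => ?_⟩
    rw [← inner_fold hd]
    exact he ⟨⟨γ, hγ⟩, hγ0⟩
  obtain ⟨e, he⟩ := exists_inner_ne_zero (fun γ : Φ => γ.1) (fun γ => hr.ne_zero γ.2)
  have hvan : ∀ γ ∈ vanishing Φ ω, ⟪γ, (p₀ : E)⟫_ℝ = 0 := by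
    intro γ hγ
    rw [← inner_fold hd, hγ.2, inner_zero_left]
  obtain ⟨δ, hδ, hδlt⟩ := exists_pos_forall_mul_lt
    (fun γ : {γ : Φ // fold ω γ.1 ≠ 0} => ‖γ.1.1‖ * ‖e‖) (fun γ => |⟪γ.1.1, (p₀ : E)⟫_ℝ|)
    (fun γ => abs_pos.2 (hp₀ _ γ.1.2 γ.2))
  -- The small `δ` lets `p₀` decide the signs of the nonvanishing roots, and the general `e` those
  -- of the vanishing ones. Scaling by `ε` then keeps all root values below `1` in absolute value,
  -- so only hyperplanes through `0` can separate.
  set y₀ : E := p₀ + δ • e with hy₀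
  obtain ⟨ε, hε, hεlt⟩ := exists_pos_forall_mul_lt
    (fun γ : Φ => ‖γ.1‖ * ‖y₀‖) (fun _ => 1) (fun _ => one_pos)
  set y : E := ε • y₀ with hy
  have hsmall : ∀ g : E ≃ₗᵢ[ℝ] E, ∀ γ ∈ Φ, |⟪γ, g y⟫_ℝ| < 1 := by
    intro g γ hγ
    refine (abs_real_inner_le_norm _ _).trans_lt ?_
    rw [g.norm_map, hy, norm_smul, Real.norm_of_nonneg hε.le]
    have := hεlt ⟨γ, hγ⟩
    simp only at this
    linarith
  have hsign : ∀ g : E ≃ₗᵢ[ℝ] E, g p₀ = p₀ → ∀ γ ∈ Φ, fold ω γ ≠ 0 →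
      0 < ⟪γ, (p₀ : E)⟫_ℝ * ⟪γ, g y⟫_ℝ := by
    intro g hg γ hγ hγ0
    have h1 : |δ * ⟪γ, g e⟫_ℝ| < |⟪γ, (p₀ : E)⟫_ℝ| := by
      rw [abs_mul, abs_of_pos hδ]
      refine lt_of_le_of_lt ?_ (hδlt ⟨⟨γ, hγ⟩, hγ0⟩)
      refine mul_le_mul_of_nonneg_left ?_ hδ.le
      have := abs_real_inner_le_norm γ (g e)
      rwa [g.norm_map] at this
    have h2 : ⟪γ, g y⟫_ℝ = ε * (⟪γ, (p₀ : E)⟫_ℝ + δ * ⟪γ, g e⟫_ℝ) := by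
      rw [hy, hy₀, map_smul, map_add, map_smul, hg, real_inner_smul_right, inner_add_right,
        real_inner_smul_right]
    rw [h2]
    have h3 := hp₀ γ hγ hγ0
    have h4 := abs_lt.1 h1
    rcases h3.lt_or_gt with h5 | h5
    · rw [abs_of_neg h5] at h4
      exact mul_pos_of_neg_of_neg h5 (mul_neg_of_pos_of_neg hε (by linarith))
    · rw [abs_of_pos h5] at h4
      exact mul_pos h5 (mul_pos hε (by linarith))
  have hreg : IsRegular Φ y := by
    intro γ hγ n hn
    have h1 := hsmall 1 γ hγ
    change |⟪γ, y⟫_ℝ| < 1 at h1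
    have hn0 : n = 0 := by
      rw [hn] at h1
      have h1 : |n| < 1 := by exact_mod_cast h1
      exact Int.abs_lt_one_iff.1 h1
    rw [hn0, Int.cast_zero] at hn
    by_cases hγ0 : fold ω γ = 0
    · rw [hy, hy₀, real_inner_smul_right, inner_add_right, hvan γ ⟨hγ, hγ0⟩, zero_add,
        real_inner_smul_right] at hn
      exact mul_ne_zero hε.ne' (mul_ne_zero hδ.ne' (he ⟨γ, hγ⟩)) hn
    · have h2 := hsign 1 rfl γ hγ hγ0
      change 0 < _ * ⟪γ, y⟫_ℝ at h2
      rw [hn, mul_zero] at h2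
      exact lt_irrefl _ h2
  -- Maximality brings `w (ω e)` to the same side as `e` of every vanishing root: otherwise a
  -- further reflection would increase the inner product. Hence `w * ω` keeps `y` in its alcove and
  -- is trivial.
  obtain ⟨w, hw, hmax⟩ := Set.exists_max_image
    (weylGroup (vanishing Φ ω) : Set (E ≃ₗᵢ[ℝ] E)) (fun w => ⟪w (ω e), e⟫_ℝ)
    ((Set.toFinite (weylGroup Φ : Set (E ≃ₗᵢ[ℝ] E))).subset hle) ⟨1, one_mem _⟩
  set u := w * ω with hu
  have hup : u p₀ = p₀ := by
    change w (ω p₀) = p₀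
    rw [show ω p₀ = p₀ from p₀.2]
    exact fixed_of_mem_weylGroup hvan hw
  have huW : u ∈ weylGroup Φ := mul_mem (hle hw) hω
  have hsame : SameAlcove Φ y (u.toAffineIsometryEquiv y) := by
    rintro _ ⟨γ, hγ, n, rfl⟩ hs
    rw [separates_affRefl (hr.ne_zero hγ), LinearIsometryEquiv.coe_toAffineIsometryEquiv] at hs
    have h1 := abs_lt.1 (hsmall 1 γ hγ)
    change -1 < ⟪γ, y⟫_ℝ ∧ ⟪γ, y⟫_ℝ < 1 at h1
    have h2 := abs_lt.1 (hsmall u γ hγ)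
    rcases lt_trichotomy n 0 with hn | hn | hn
    · have : n ≤ -1 := by omega
      have : (n : ℝ) ≤ -1 := by exact_mod_cast this
      nlinarith
    · rw [hn, Int.cast_zero, sub_zero, sub_zero] at hs
      by_cases hγ0 : fold ω γ = 0
      · have hγv : γ ∈ vanishing Φ ω := ⟨hγ, hγ0⟩
        rw [hy, hy₀, map_smul, map_add, map_smul, hup, real_inner_smul_right,
          real_inner_smul_right, inner_add_right, inner_add_right, hvan γ hγv,
          real_inner_smul_right, real_inner_smul_right] at hs
        have h3 : ⟪γ, e⟫_ℝ * ⟪γ, u e⟫_ℝ < 0 := by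
          by_contra! h4
          have := mul_nonneg (mul_pos (mul_pos hε hδ) (mul_pos hε hδ)).le h4
          nlinarith
        have h4 := hmax (refl γ * w) (mul_mem (Subgroup.subset_closure ⟨γ, hγv, rfl⟩) hw)
        change ⟪refl γ (u e), e⟫_ℝ ≤ ⟪u e, e⟫_ℝ at h4
        rw [refl_apply', inner_sub_left, real_inner_smul_left, coroot, real_inner_smul_left] at h4
        have h5 : 0 < 2 / ⟪γ, γ⟫_ℝ := div_pos two_pos (real_inner_self_pos.2 (hr.ne_zero hγ))
        have h6 := mul_neg_of_pos_of_neg h5 h3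
        nlinarith
      · have h3 := hsign 1 rfl γ hγ hγ0
        have h4 := hsign u hup γ hγ hγ0
        change 0 < _ * ⟪γ, y⟫_ℝ at h3
        have h5 := mul_pos h3 h4
        have h6 := mul_self_nonneg ⟪γ, (p₀ : E)⟫_ℝ
        nlinarith
    · have : 1 ≤ n := by omega
      have : (1 : ℝ) ≤ n := by exact_mod_cast this
      nlinarith
  have h1 := eq_one_of_sameAlcove hr (toAffine_mem_closure huW) hreg hsame
  have h2 : u = 1 := by
    ext x
    exact congrArg (fun g : E ≃ᵃⁱ[ℝ] E => g x) h1
  have h3 : ω = w⁻¹ := eq_inv_of_mul_eq_one_right h2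
  have h4 := inv_mem hw
  rwa [← h3] at h4

end Stabilizer

/-! ### The folded roots form a root system -/

section FoldedSystem

variable {E : Type*} [NormedAddCommGroup E] [InnerProductSpace ℝ E] {Φ : Set E}
variable {ω : E ≃ₗᵢ[ℝ] E}

theorem refl_smul {c : ℝ} (hc : c ≠ 0) (γ : E) : refl (c • γ) = refl γ := by
  ext x
  rw [refl_apply, refl_apply, coroot_smul, real_inner_smul_left, smul_smul]
  congr 2
  field_simp

/-- The reflections in orthogonal roots do not disturb each other, so their product subtracts all
components at once. -/
theorem sub_sum_coroot_mem (h : IsRootSet Φ) {T : Finset E} (hT : ∀ γ ∈ T, γ ∈ Φ)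
    (horth : ∀ γ ∈ T, ∀ γ' ∈ T, γ ≠ γ' → ⟪γ, γ'⟫_ℝ = 0) {x : E} (hx : x ∈ Φ) :
    x - ∑ γ ∈ T, ⟪coroot γ, x⟫_ℝ • γ ∈ Φ := by
  classical
  induction T using Finset.induction_on with
  | empty => simpa using hx
  | insert δ T hδ ih =>
    have h1 := ih (fun γ hγ => hT γ (Finset.mem_insert_of_mem hγ)) fun γ hγ γ' hγ' =>
      horth γ (Finset.mem_insert_of_mem hγ) γ' (Finset.mem_insert_of_mem hγ')
    have h2 := h.refl_mem δ (hT δ (Finset.mem_insert_self _ _)) _ h1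
    have h3 : ⟪coroot δ, ∑ γ ∈ T, ⟪coroot γ, x⟫_ℝ • γ⟫_ℝ = 0 := by
      rw [inner_sum]
      refine Finset.sum_eq_zero fun γ hγ => ?_
      have : δ ≠ γ := by
        rintro rfl
        exact hδ hγ
      rw [real_inner_smul_right, coroot.eq_1 δ, real_inner_smul_left,
        horth δ (Finset.mem_insert_self _ _) γ (Finset.mem_insert_of_mem hγ) this, mul_zero, mul_zero]
    rw [refl_apply, inner_sub_right, h3, sub_zero] at h2
    rw [Finset.sum_insert hδ, add_comm, ← sub_sub]
    exact h2

theorem sum_eq_card_smul (hd : 0 < orderOf ω) {T : Finset E} (hstab : ∀ γ ∈ T, ω γ ∈ T)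
    {μ : fixedSpace ω} (hfold : ∀ γ ∈ T, fold ω γ = μ) :
    ∑ γ ∈ T, γ = (T.card : ℝ) • (μ : E) := by
  classical
  have himg : T.image ω = T := by
    refine Finset.eq_of_subset_of_card_le ?_ ?_
    · intro x hx
      obtain ⟨γ, hγ, rfl⟩ := Finset.mem_image.1 hx
      exact hstab γ hγ
    · rw [Finset.card_image_of_injective _ ω.injective]
  have h1 : ω (∑ γ ∈ T, γ) = ∑ γ ∈ T, γ := by
    conv_rhs => rw [← himg]
    rw [map_sum, Finset.sum_image fun x _ y _ hxy => ω.injective hxy]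
  have h2 := fold_of_fixed hd h1
  rw [fold_sum, Finset.sum_congr rfl hfold, Finset.sum_const, ← Nat.cast_smul_eq_nsmul ℝ] at h2
  exact h2.symm

/-- The sum over `T` is `T.card • μ`. Pairing it with one member gives `N = T.card * ⟪μ, μ⟫`, which
is the normalization needed for the coroot. -/
theorem sum_coroot_eq (hd : 0 < orderOf ω) {T : Finset E} (hT : T.Nonempty)
    (hstab : ∀ γ ∈ T, ω γ ∈ T) (horth : ∀ γ ∈ T, ∀ γ' ∈ T, γ ≠ γ' → ⟪γ, γ'⟫_ℝ = 0)
    {N : ℝ} (hN : ∀ γ ∈ T, ⟪γ, γ⟫_ℝ = N) {μ : fixedSpace ω} (hμ : μ ≠ 0)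
    (hfold : ∀ γ ∈ T, fold ω γ = μ) : ∑ γ ∈ T, coroot γ = ((coroot μ : fixedSpace ω) : E) := by
  have hsum := sum_eq_card_smul hd hstab hfold
  obtain ⟨γ₀, hγ₀⟩ := hT
  have h1 : ⟪γ₀, ∑ γ ∈ T, γ⟫_ℝ = N := by
    rw [inner_sum, Finset.sum_eq_single γ₀, hN γ₀ hγ₀]
    · intro γ hγ hne
      exact horth γ₀ hγ₀ γ hγ hne.symm
    · intro hn
      exact absurd hγ₀ hn
  rw [hsum, real_inner_smul_right, ← inner_fold hd, hfold γ₀ hγ₀] at h1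
  have h2 : ∀ γ ∈ T, coroot γ = (2 / N) • γ := by
    intro γ hγ
    rw [coroot, hN γ hγ]
  have hμμ : ⟪μ, μ⟫_ℝ ≠ 0 := inner_self_ne_zero.2 hμ
  have hc : (T.card : ℝ) ≠ 0 := by
    have := Finset.card_pos.2 ⟨γ₀, hγ₀⟩
    positivity
  rw [Finset.sum_congr rfl h2, ← Finset.smul_sum, hsum, smul_smul, ← h1, coroot]
  change _ = (2 / ⟪μ, μ⟫_ℝ) • (μ : E)
  congr 1
  field_simp

variable {ι : Type*} [Fintype ι] {α : Module.Basis ι ℝ E} {θ v : E}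

theorem pow_mem_roots (hω : ∀ β, ω β ∈ Φ ↔ β ∈ Φ) (t : ℕ) {β : E} (hβ : β ∈ Φ) :
    (ω ^ t) β ∈ Φ := by
  induction t with
  | zero => exact hβ
  | succ t ih =>
    rw [pow_succ']
    exact (hω _).2 ih

theorem IsFoldingPoint.pow_sub_int (hv : IsFoldingPoint Φ α θ ω v) (hω : ∀ β, ω β ∈ Φ ↔ β ∈ Φ)
    (t : ℕ) {β : E} (hβ : β ∈ Φ) : ∃ n : ℤ, ⟪(ω ^ t) β, v⟫_ℝ = ⟪β, v⟫_ℝ + n := by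
  induction t with
  | zero => exact ⟨0, by simp⟩
  | succ t ih =>
    obtain ⟨n, hn⟩ := ih
    have h1 := pow_mem_roots hω t hβ
    obtain ⟨m, hm⟩ := hv.sub_mem _ ((hω _).2 h1)
    refine ⟨n + m, ?_⟩
    rw [inner_sub_right, ω.inner_map_map, hn] at hm
    rw [pow_succ']
    change ⟪ω ((ω ^ t) β), v⟫_ℝ = _
    push_cast
    linarith

/-- Otherwise the difference would be a root with zero projection, yet integral at `v` because `v -
ω v` is a coweight. -/
theorem IsFoldingPoint.inner_pow_nonpos (hv : IsFoldingPoint Φ α θ ω v) (h : IsRootSet Φ)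
    (hd : 0 < orderOf ω) (hω : ∀ β, ω β ∈ Φ ↔ β ∈ Φ) (t : ℕ) {β : E} (hβ : β ∈ Φ)
    (hne : β ≠ (ω ^ t) β) : ⟪β, (ω ^ t) β⟫_ℝ ≤ 0 := by
  by_contra! h1
  have h2 := h.sub_mem hβ (pow_mem_roots hω t hβ) h1 hne
  obtain ⟨n, hn⟩ := hv.pow_sub_int hω t hβ
  refine hv.not_int _ h2 ?_ (-n) ?_
  · rw [fold_sub, fold_pow hd, sub_self]
  · rw [inner_sub_left, hn]
    push_cast
    ring

/-- A set of pairwise orthogonal roots whose reflections multiply to a lift of the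
reflection in the folded root of `β`. -/
structure IsReflectionLift (Φ : Set E) (ω : E ≃ₗᵢ[ℝ] E) (v β : E) (T : Finset E) (ε : ℝ) :
    Prop where
  eps : ε = 1 ∨ ε = 2
  mem : ∀ γ ∈ T, γ ∈ Φ
  orth : ∀ γ ∈ T, ∀ γ' ∈ T, γ ≠ γ' → ⟪γ, γ'⟫_ℝ = 0
  fold_eq : ∀ γ ∈ T, fold ω γ = ε • fold ω β
  int : ∀ γ ∈ T, ∃ n : ℤ, ⟪γ, v⟫_ℝ = ε * ⟪β, v⟫_ℝ + n
  sum_coroot : ∑ γ ∈ T, coroot γ = ((coroot (ε • fold ω β) : fixedSpace ω) : E)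

/-- An orthogonal orbit of `β` serves as `T` with `ε = 1`. Otherwise orbit members pair off into
`A₂` systems, and the sums of the pairs serve with `ε = 2`. -/
theorem IsFoldingPoint.exists_reflectionLift (hv : IsFoldingPoint Φ α θ ω v) (h : IsRootSet Φ)
    (hd : 0 < orderOf ω) (hω : ∀ β, ω β ∈ Φ ↔ β ∈ Φ) {β : E} (hβ : β ∈ Φ)
    (hβ0 : fold ω β ≠ 0) : ∃ T ε, IsReflectionLift Φ ω v β T ε := by
  classical
  set d := orderOf ω with hd'
  set lam := fold ω β with hlam
  set O : Finset E := (Finset.range d).image fun t => (ω ^ t) β with hO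
  have hmemO : ∀ t : ℕ, (ω ^ t) β ∈ O := by
    intro t
    refine Finset.mem_image.2 ⟨t % d, Finset.mem_range.2 (Nat.mod_lt _ hd), ?_⟩
    rw [hd', pow_mod_orderOf]
  have hOmem : ∀ a ∈ O, ∃ t : ℕ, (ω ^ t) β = a := by
    intro a ha
    obtain ⟨t, -, rfl⟩ := Finset.mem_image.1 ha
    exact ⟨t, rfl⟩
  have hOstab : ∀ a ∈ O, ω a ∈ O := by
    intro a ha
    obtain ⟨t, rfl⟩ := hOmem a ha
    have := hmemO (t + 1)
    rwa [pow_succ'] at this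
  have hOpow : ∀ t : ℕ, ∀ a ∈ O, (ω ^ t) a ∈ O := by
    intro t a ha
    obtain ⟨s, rfl⟩ := hOmem a ha
    have := hmemO (t + s)
    rwa [pow_add] at this
  have htrans : ∀ a ∈ O, ∀ b ∈ O, ∃ t : ℕ, (ω ^ t) a = b := by
    intro a ha b hb
    obtain ⟨s, rfl⟩ := hOmem a ha
    obtain ⟨t, rfl⟩ := hOmem b hb
    refine ⟨t + (d * s - s), ?_⟩
    change ((ω ^ (t + (d * s - s))) * (ω ^ s)) β = _
    rw [← pow_add, add_assoc, Nat.sub_add_cancel (Nat.le_mul_of_pos_left s hd), pow_add, pow_mul,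
      hd', pow_orderOf_eq_one, one_pow, mul_one]
  have hOΦ : ∀ a ∈ O, a ∈ Φ := by
    intro a ha
    obtain ⟨t, rfl⟩ := hOmem a ha
    exact pow_mem_roots hω t hβ
  have hOfold : ∀ a ∈ O, fold ω a = lam := by
    intro a ha
    obtain ⟨t, rfl⟩ := hOmem a ha
    exact fold_pow hd t β
  have hOnorm : ∀ a ∈ O, ⟪a, a⟫_ℝ = ⟪β, β⟫_ℝ := by
    intro a ha
    obtain ⟨t, rfl⟩ := hOmem a ha
    exact (ω ^ t).inner_map_map β β
  have hOint : ∀ a ∈ O, ∃ n : ℤ, ⟪a, v⟫_ℝ = ⟪β, v⟫_ℝ + n := by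
    intro a ha
    obtain ⟨t, rfl⟩ := hOmem a ha
    exact hv.pow_sub_int hω t hβ
  have hOneg : ∀ a ∈ O, ∀ b ∈ O, a ≠ b → ⟪a, b⟫_ℝ ≤ 0 := by
    intro a ha b hb hab
    obtain ⟨t, rfl⟩ := htrans a ha b hb
    exact hv.inner_pow_nonpos h hd hω t (hOΦ a ha) hab
  have hβO : β ∈ O := hmemO 0
  have hN : 0 < ⟪β, β⟫_ℝ := real_inner_self_pos.2 (h.ne_zero hβ)
  -- The orbit sum is a positive multiple of the common projection, so row sums of the Gram matrix
  -- are positive. With nonpositive off-diagonal entries, this leaves room for at most one nonzero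
  -- entry per row, equal to minus half the squared norm.
  have hsum : ∀ a ∈ O, 0 < ∑ b ∈ O, ⟪a, b⟫_ℝ := by
    intro a ha
    rw [← inner_sum, sum_eq_card_smul hd hOstab hOfold, real_inner_smul_right, ← inner_fold hd,
      hOfold a ha]
    exact mul_pos (by exact_mod_cast Finset.card_pos.2 ⟨β, hβO⟩) (real_inner_self_pos.2 hβ0)
  by_cases hcase : ∀ a ∈ O, ∀ b ∈ O, a ≠ b → ⟪a, b⟫_ℝ = 0
  · refine ⟨O, 1, Or.inl rfl, hOΦ, hcase, ?_, ?_, ?_⟩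
    · intro γ hγ
      rw [one_smul]
      exact hOfold γ hγ
    · intro γ hγ
      rw [one_mul]
      exact hOint γ hγ
    · rw [one_smul]
      exact sum_coroot_eq hd ⟨β, hβO⟩ hOstab hcase hOnorm hβ0 hOfold
  push Not at hcase
  obtain ⟨a₀, ha₀, b₀, hb₀, hab₀, hab₀'⟩ := hcase
  have hneg₀ : ⟪a₀, b₀⟫_ℝ < 0 := lt_of_le_of_ne (hOneg a₀ ha₀ b₀ hb₀ hab₀) hab₀'
  have hne : ∀ a b : E, ⟪a, b⟫_ℝ < 0 → a ≠ b := by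
    rintro a _ hab rfl
    exact absurd hab (not_lt.2 real_inner_self_nonneg)
  have hint : ∀ a ∈ O, ∀ b ∈ O, ∃ n : ℤ, n * ⟪β, β⟫_ℝ = 2 * ⟪a, b⟫_ℝ := by
    intro a ha b hb
    obtain ⟨n, hn⟩ := h.integral a (hOΦ a ha) b (hOΦ b hb)
    refine ⟨n, ?_⟩
    rw [← hn, ← hOnorm a ha, inner_coroot_mul a b (h.ne_zero (hOΦ a ha))]
  have hle : ∀ a ∈ O, ∀ b ∈ O, ⟪a, b⟫_ℝ < 0 → 2 * ⟪a, b⟫_ℝ ≤ -⟪β, β⟫_ℝ := by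
    intro a ha b hb hab
    obtain ⟨n, hn⟩ := hint a ha b hb
    have h1 : n < 0 := by
      have : (n : ℝ) < 0 := by
        by_contra! h2
        nlinarith
      exact_mod_cast this
    have h2 : n ≤ -1 := by omega
    have h2 : (n : ℝ) ≤ -1 := by exact_mod_cast h2
    nlinarith
  have hpart : ∀ a ∈ O, ∀ s : Finset E, s ⊆ O → a ∈ s → 0 < ∑ b ∈ s, ⟪a, b⟫_ℝ := by
    intro a ha s hs has
    refine (hsum a ha).trans_le ?_
    have h1 := Finset.sum_le_sum_of_subset_of_nonneg (f := fun b => -⟪a, b⟫_ℝ) hs (by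
      intro b hb hbs
      have hab : a ≠ b := by
        rintro rfl
        exact hbs has
      have := hOneg a ha b hb hab
      linarith)
    rw [Finset.sum_neg_distrib, Finset.sum_neg_distrib] at h1
    linarith
  have hval : ∀ a ∈ O, ∀ b ∈ O, ⟪a, b⟫_ℝ < 0 → 2 * ⟪a, b⟫_ℝ = -⟪β, β⟫_ℝ := by
    intro a ha b hb hab
    refine le_antisymm (hle a ha b hb hab) ?_
    have h1 := hpart a ha {a, b} (by
      intro x hx
      rcases Finset.mem_insert.1 hx with rfl | hx
      · exact ha
      · rwa [Finset.mem_singleton.1 hx]) (Finset.mem_insert_self _ _)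
    rw [Finset.sum_pair (hne a b hab), hOnorm a ha] at h1
    obtain ⟨n, hn⟩ := hint a ha b hb
    have h2 : (-2 : ℝ) < n := by
      by_contra! h3
      nlinarith
    have h2 : -2 < n := by exact_mod_cast h2
    have h2 : -1 ≤ n := by omega
    have h2 : (-1 : ℝ) ≤ n := by exact_mod_cast h2
    nlinarith
  have huniq : ∀ a ∈ O, ∀ b ∈ O, ∀ c ∈ O, ⟪a, b⟫_ℝ < 0 → ⟪a, c⟫_ℝ < 0 → b = c := by
    intro a ha b hb c hc hab hac
    by_contra hbc
    have h1 := hpart a ha {a, b, c} (by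
      intro x hx
      rcases Finset.mem_insert.1 hx with rfl | hx
      · exact ha
      rcases Finset.mem_insert.1 hx with rfl | hx
      · exact hb
      · rwa [Finset.mem_singleton.1 hx]) (Finset.mem_insert_self _ _)
    rw [Finset.sum_insert (by simp [hne a b hab, hne a c hac]), Finset.sum_pair hbc,
      hOnorm a ha] at h1
    have h2 := hle a ha b hb hab
    have h3 := hle a ha c hc hac
    linarith
  have horth : ∀ a ∈ O, ∀ b ∈ O, ∀ a' ∈ O, ∀ b' ∈ O, ⟪a, b⟫_ℝ < 0 → ⟪a', b'⟫_ℝ < 0 →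
      a + b ≠ a' + b' → ⟪a, a'⟫_ℝ = 0 := by
    intro a ha b hb a' ha' b' hb' hab hab' hne'
    by_cases haa : a = a'
    · subst haa
      exact absurd (by rw [huniq a ha b hb b' hb' hab hab']) hne'
    by_contra h1
    have h2 : ⟪a, a'⟫_ℝ < 0 := lt_of_le_of_ne (hOneg a ha a' ha' haa) h1
    have h3 := huniq a ha b hb a' ha' hab h2
    have h4 := huniq a' ha' b' hb' a ha hab' (by rwa [real_inner_comm])
    exact hne' (by rw [h3, h4, add_comm])
  set T : Finset E := ((O ×ˢ O).filter fun q => ⟪q.1, q.2⟫_ℝ < 0).image fun q => q.1 + q.2 with hT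
  have hTmem : ∀ γ, γ ∈ T ↔ ∃ a ∈ O, ∃ b ∈ O, ⟪a, b⟫_ℝ < 0 ∧ a + b = γ := by
    intro γ
    simp only [hT, Finset.mem_image, Finset.mem_filter, Finset.mem_product, Prod.exists]
    constructor
    · rintro ⟨a, b, ⟨⟨ha, hb⟩, hab⟩, rfl⟩
      exact ⟨a, ha, b, hb, hab, rfl⟩
    · rintro ⟨a, ha, b, hb, hab, rfl⟩
      exact ⟨a, b, ⟨⟨ha, hb⟩, hab⟩, rfl⟩
  have hTfold : ∀ γ ∈ T, fold ω γ = (2 : ℝ) • lam := by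
    intro γ hγ
    obtain ⟨a, ha, b, hb, hab, rfl⟩ := (hTmem γ).1 hγ
    rw [fold_add, hOfold a ha, hOfold b hb, two_smul]
  have hTorth : ∀ γ ∈ T, ∀ γ' ∈ T, γ ≠ γ' → ⟪γ, γ'⟫_ℝ = 0 := by
    intro γ hγ γ' hγ' hne'
    obtain ⟨a, ha, b, hb, hab, rfl⟩ := (hTmem γ).1 hγ
    obtain ⟨a', ha', b', hb', hab', rfl⟩ := (hTmem γ').1 hγ'
    have hba : ⟪b, a⟫_ℝ < 0 := by rwa [real_inner_comm]
    have hba' : ⟪b', a'⟫_ℝ < 0 := by rwa [real_inner_comm]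
    rw [inner_add_left, inner_add_right, inner_add_right,
      horth a ha b hb a' ha' b' hb' hab hab' hne',
      horth a ha b hb b' hb' a' ha' hab hba' (by rwa [add_comm b']),
      horth b hb a ha a' ha' b' hb' hba hab' (by rwa [add_comm b]),
      horth b hb a ha b' hb' a' ha' hba hba' (by rwa [add_comm b, add_comm b'])]
    norm_num
  refine ⟨T, 2, Or.inr rfl, ?_, hTorth, hTfold, ?_, ?_⟩
  · intro γ hγ
    obtain ⟨a, ha, b, hb, hab, rfl⟩ := (hTmem γ).1 hγ
    refine h.add_mem (hOΦ a ha) (hOΦ b hb) hab fun h1 => hβ0 ?_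
    have h2 := hOfold a ha
    rw [h1, fold_neg, hOfold b hb] at h2
    have h3 : (2 : ℝ) • lam = 0 := by linear_combination (norm := module) -h2
    exact (smul_eq_zero.1 h3).resolve_left two_ne_zero
  · intro γ hγ
    obtain ⟨a, ha, b, hb, hab, rfl⟩ := (hTmem γ).1 hγ
    obtain ⟨m, hm⟩ := hOint a ha
    obtain ⟨n, hn⟩ := hOint b hb
    refine ⟨m + n, ?_⟩
    rw [inner_add_left, hm, hn]
    push_cast
    ring
  · refine sum_coroot_eq hd ⟨a₀ + b₀, (hTmem _).2 ⟨a₀, ha₀, b₀, hb₀, hneg₀, rfl⟩⟩ ?_ hTorth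
      (N := ⟪β, β⟫_ℝ) ?_ (smul_ne_zero two_ne_zero hβ0) hTfold
    · intro γ hγ
      obtain ⟨a, ha, b, hb, hab, rfl⟩ := (hTmem γ).1 hγ
      refine (hTmem _).2 ⟨ω a, hOstab a ha, ω b, hOstab b hb, ?_, (map_add ω a b).symm⟩
      rwa [ω.inner_map_map]
    · intro γ hγ
      obtain ⟨a, ha, b, hb, hab, rfl⟩ := (hTmem γ).1 hγ
      have h1 := hval a ha b hb hab
      rw [inner_add_left, inner_add_right, inner_add_right, hOnorm a ha, hOnorm b hb,
        real_inner_comm a b]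
      linarith

theorem IsReflectionLift.inner_coroot_fold {β : E} {T : Finset E} {ε : ℝ}
    (hT : IsReflectionLift Φ ω v β T ε) (hd : 0 < orderOf ω) (x : E) :
    ⟪coroot (ε • fold ω β), fold ω x⟫_ℝ = ∑ γ ∈ T, ⟪coroot γ, x⟫_ℝ := by
  rw [real_inner_comm, inner_fold hd, ← hT.sum_coroot, inner_sum]
  exact Finset.sum_congr rfl fun γ _ => real_inner_comm _ _

/-- All members of `T` fold to `ε • fold ω β`, and the factor `ε` does not change the reflection. -/
theorem IsReflectionLift.fold_sub_sum {β : E} {T : Finset E} {ε : ℝ}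
    (hT : IsReflectionLift Φ ω v β T ε) (hd : 0 < orderOf ω) (x : E) :
    fold ω (x - ∑ γ ∈ T, ⟪coroot γ, x⟫_ℝ • γ) = refl (fold ω β) (fold ω x) := by
  have hε : ε ≠ 0 := by rcases hT.eps with h1 | h1 <;> rw [h1] <;> norm_num
  rw [← refl_smul hε, refl_apply, hT.inner_coroot_fold hd, fold_sub, fold_sum, Finset.sum_smul]
  congr 1
  refine Finset.sum_congr rfl fun γ hγ => ?_
  rw [fold_smul, hT.fold_eq γ hγ]

theorem IsReflectionLift.exists_int {β : E} {T : Finset E} {ε : ℝ}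
    (hT : IsReflectionLift Φ ω v β T ε) (h : IsRootSet Φ) {x : E} (hx : x ∈ Φ) :
    ∃ n : ℤ, ∑ γ ∈ T, ⟪coroot γ, x⟫_ℝ = n := by
  have h1 : ∀ γ : E, ∃ n : ℤ, γ ∈ T → ⟪coroot γ, x⟫_ℝ = n := by
    intro γ
    by_cases hγ : γ ∈ T
    · obtain ⟨n, hn⟩ := h.integral γ (hT.mem γ hγ) x hx
      exact ⟨n, fun _ => hn⟩
    · exact ⟨0, fun h => absurd h hγ⟩
  choose n hn using h1
  refine ⟨∑ γ ∈ T, n γ, ?_⟩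
  push_cast
  exact Finset.sum_congr rfl fun γ hγ => hn γ hγ

theorem IsFoldingPoint.isRootSystem (hv : IsFoldingPoint Φ α θ ω v) (h : IsRootSystem Φ)
    (hω : ω ∈ weylGroup Φ) : IsRootSystem (foldedRoots Φ ω) := by
  have hd : 0 < orderOf ω := orderOf_pos_of_mem_weylGroup h hω
  have hr := h.isRootSet
  have hmap := map_mem_of_mem_weylGroup hr subset_rfl hω
  refine ⟨?_, fun h0 => h0.1 rfl, ?_, ?_, ?_⟩
  · refine (h.finite.image (fold ω)).subset ?_
    rintro _ ⟨-, β, hβ, rfl⟩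
    exact ⟨β, hβ, rfl⟩
  · have h1 : Submodule.map (foldLin ω) (Submodule.span ℝ Φ) ≤
        Submodule.span ℝ (foldedRoots Φ ω) := by
      rw [Submodule.map_span, Submodule.span_le]
      rintro _ ⟨β, hβ, rfl⟩
      rw [foldLin_apply]
      by_cases h0 : fold ω β = 0
      · rw [h0]
        exact zero_mem _
      · exact Submodule.subset_span ⟨h0, β, hβ, rfl⟩
    rw [eq_top_iff]
    intro y _
    apply h1
    refine ⟨y, by rw [h.span_eq_top]; trivial, ?_⟩
    exact Subtype.ext (fold_of_fixed hd y.2)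
  · rintro _ ⟨h0, β, hβ, rfl⟩ _ ⟨h0', x, hx, rfl⟩
    obtain ⟨T, ε, hT⟩ := hv.exists_reflectionLift hr hd hmap hβ h0
    refine ⟨fun h1 => h0' ?_, _, sub_sum_coroot_mem hr hT.mem hT.orth hx, ?_⟩
    · exact (refl (fold ω β)).map_eq_zero_iff.1 h1
    · rw [hT.fold_sub_sum hd]
  · rintro _ ⟨h0, β, hβ, rfl⟩ _ ⟨h0', x, hx, rfl⟩
    obtain ⟨T, ε, hT⟩ := hv.exists_reflectionLift hr hd hmap hβ h0
    obtain ⟨n, hn⟩ := hT.exists_int hr hx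
    have h1 := hT.inner_coroot_fold hd x
    rw [hn, coroot_smul, real_inner_smul_left] at h1
    rcases hT.eps with he | he
    · exact ⟨n, by rw [he] at h1; linarith⟩
    -- The coroot of the folded root is twice the coroot of its double.
    · exact ⟨2 * n, by rw [he] at h1; push_cast; linarith⟩

end FoldedSystem

/-! ### Lifting a folded root to a root that takes an integral value at the folding point -/

section Lift

/-- Here `g` is the smallest gap between two members of `K`. Reflections extend that gap to a full
progression, and a member off the progression would create a smaller gap. -/
theorem exists_coset_of_reflection_closed {K : Set ℤ} {d : ℤ} (hd : 0 < d) {a : ℤ} (ha : a ∈ K)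
    (hrefl : ∀ x ∈ K, ∀ y ∈ K, 2 * x - y ∈ K) (hshift : ∀ x ∈ K, x + d ∈ K) :
    ∃ g : ℕ, 0 < g ∧ (g : ℤ) ∣ d ∧ ∀ x ∈ K, ∀ y : ℤ, y ∈ K ↔ (g : ℤ) ∣ y - x := by
  classical
  have hex : ∃ g : ℕ, 0 < g ∧ ∃ x ∈ K, x + g ∈ K := by
    refine ⟨d.toNat, by omega, a, ha, ?_⟩
    rw [Int.toNat_of_nonneg hd.le]
    exact hshift a ha
  set g := Nat.find hex with hg
  obtain ⟨hg0, b, hb, hbg⟩ := Nat.find_spec hex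
  rw [← hg] at hg0 hbg
  have hmin : ∀ n : ℕ, 0 < n → n < g → ∀ x ∈ K, x + n ∉ K := fun n h0 hn x hx hxn =>
    Nat.find_min hex hn ⟨h0, x, hx, hxn⟩
  have hup : ∀ n : ℕ, b + n * g ∈ K ∧ b + (n + 1) * g ∈ K := by
    intro n
    induction n with
    | zero => simpa using ⟨hb, hbg⟩
    | succ n ih =>
      refine ⟨by push_cast; exact ih.2, ?_⟩
      have := hrefl _ ih.2 _ ih.1
      convert this using 1
      push_cast
      ring
  have hall : ∀ k : ℤ, b + k * g ∈ K := by
    intro k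
    rcases Int.eq_nat_or_neg k with ⟨n, rfl | rfl⟩
    · exact (hup n).1
    · have := hrefl b hb _ (hup n).1
      convert this using 1
      ring
  have hdvd : ∀ x ∈ K, (g : ℤ) ∣ x - b := by
    intro x hx
    have hg0' : (0 : ℤ) < g := by exact_mod_cast hg0
    have h1 := Int.emod_nonneg (x - b) hg0'.ne'
    have h2 := Int.emod_lt_of_pos (x - b) hg0'
    obtain ⟨n, hn⟩ := Int.eq_ofNat_of_zero_le h1
    by_contra h3
    have h4 : n ≠ 0 := by
      rintro rfl
      exact h3 (Int.dvd_of_emod_eq_zero hn)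
    refine hmin n (by omega) (by omega) _ (hall ((x - b) / g)) ?_
    have h5 := Int.mul_ediv_add_emod (x - b) g
    have : b + (x - b) / g * g + n = x := by
      rw [← hn]
      linarith
    rwa [this]
  refine ⟨g, hg0, ?_, fun x hx y => ⟨fun hy => ?_, fun hy => ?_⟩⟩
  · have := dvd_sub (hdvd _ (hshift b hb)) (hdvd b hb)
    simpa using this
  · have := dvd_sub (hdvd y hy) (hdvd x hx)
    simpa using this
  · obtain ⟨k, hk⟩ := dvd_add hy (hdvd x hx)
    have := hall k
    convert this using 1
    linarith

variable {E : Type*} [NormedAddCommGroup E] [InnerProductSpace ℝ E] {Φ Γ : Set E}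
variable {ω : E ≃ₗᵢ[ℝ] E}

/-- A reflection moves a coweight by an integral multiple of a coroot, so the Weyl group acts
trivially on coweights modulo coroots. -/
theorem sub_map_mem_corootLattice (h : IsRootSet Γ) {w : E ≃ₗᵢ[ℝ] E} (hw : w ∈ weylGroup Γ) :
    ∀ x ∈ coweightLattice Γ, x - w x ∈ AddSubgroup.closure (coroot '' Γ) := by
  have hpres : ∀ g ∈ weylGroup Γ, ∀ x ∈ coweightLattice Γ, g x ∈ coweightLattice Γ :=
    fun g hg x hx => isom_mem_coweightLattice (map_mem_of_mem_weylGroup h subset_rfl hg) hx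
  induction hw using Subgroup.closure_induction with
  | mem t ht =>
    obtain ⟨γ, hγ, rfl⟩ := ht
    intro x hx
    obtain ⟨n, hn⟩ := hx γ hγ
    rw [refl_apply', sub_sub_cancel, hn, Int.cast_smul_eq_zsmul]
    exact zsmul_mem (AddSubgroup.subset_closure (Set.mem_image_of_mem _ hγ)) n
  | one =>
    intro x _
    change x - x ∈ _
    rw [sub_self]
    exact zero_mem _
  | mul a b _ hb iha ihb =>
    intro x hx
    have := add_mem (ihb x hx) (iha (b x) (hpres b hb x hx))
    rwa [sub_add_sub_cancel] at this
  | inv a ha iha =>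
    intro x hx
    have h1 := neg_mem (iha (a⁻¹ x) (hpres _ (inv_mem ha) x hx))
    have h2 : a (a⁻¹ x) = x := a.apply_symm_apply x
    rwa [h2, neg_sub] at h1

/-- Translation by a coroot is the product of the reflections at levels `1` and `0`. -/
theorem translation_mem_closure (h : IsRootSet Γ) {y : E}
    (hy : y ∈ AddSubgroup.closure (coroot '' Γ)) :
    AffineIsometryEquiv.constVAdd ℝ E y ∈ Subgroup.closure (affReflections Γ) := by
  induction hy using AddSubgroup.closure_induction with
  | mem y hy =>
    obtain ⟨γ, hγ, rfl⟩ := hy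
    have h1 : AffineIsometryEquiv.constVAdd ℝ E (coroot γ) = affRefl γ (1 : ℤ) * affRefl γ (0 : ℤ) := by
      ext x
      change coroot γ + x = affRefl γ (1 : ℤ) (affRefl γ (0 : ℤ) x)
      have h2 := inner_affRefl γ (h.ne_zero hγ) (0 : ℤ) x
      simp only [Int.cast_zero, sub_zero] at h2
      rw [affRefl_apply γ (1 : ℤ), Int.cast_zero, h2, affRefl_apply]
      push_cast
      module
    rw [h1]
    exact mul_mem (Subgroup.subset_closure ⟨γ, hγ, 1, rfl⟩)
      (Subgroup.subset_closure ⟨γ, hγ, 0, rfl⟩)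
  | zero =>
    rw [AffineIsometryEquiv.constVAdd_zero]
    exact one_mem _
  | add a b _ _ iha ihb =>
    have : AffineIsometryEquiv.constVAdd ℝ E (a + b) =
        AffineIsometryEquiv.constVAdd ℝ E a * AffineIsometryEquiv.constVAdd ℝ E b := by
      ext x
      exact add_assoc a b x
    rw [this]
    exact mul_mem iha ihb
  | neg a _ iha =>
    have : AffineIsometryEquiv.constVAdd ℝ E (-a) = (AffineIsometryEquiv.constVAdd ℝ E a)⁻¹ := by
      rw [eq_inv_iff_mul_eq_one]
      ext x
      exact neg_add_cancel_left a x
    rw [this]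
    exact inv_mem iha

/-- If `u ∈ W(Γ)` moves a regular point `v` by a coweight and `q v` is a coweight, then
`u ^ q = 1`. -/
theorem pow_apply_eq_self (h : IsRootSet Γ) {u : E ≃ₗᵢ[ℝ] E} (hu : u ∈ weylGroup Γ) {v : E}
    (hv : IsRegular Γ v) (huv : v - u v ∈ coweightLattice Γ) {q : ℕ}
    (hq : (q : ℝ) • v ∈ coweightLattice Γ) (x : E) : (u ^ q) x = x := by
  set Q := AddSubgroup.closure (coroot '' Γ) with hQ
  have h1 : (q : ℝ) • (v - u v) ∈ Q := by
    have := sub_map_mem_corootLattice h hu _ hq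
    rwa [map_smul, ← smul_sub] at this
  have h2 : ∀ s : ℕ, (u ^ s) (v - u v) - (v - u v) ∈ Q := by
    intro s
    have := neg_mem (sub_map_mem_corootLattice h (pow_mem hu s) _ huv)
    rwa [neg_sub] at this
  -- Modulo `Q` the coweight `v - u v` is fixed by `u`, so the displacements along the powers of `u`
  -- add up.
  have h3 : ∀ s : ℕ, v - (u ^ s) v - (s : ℝ) • (v - u v) ∈ Q := by
    intro s
    induction s with
    | zero => simp
    | succ s ih =>
      have h4 := add_mem ih (h2 s)
      have h5 : (u ^ (s + 1)) v = (u ^ s) (u v) := by rw [pow_succ]; rfl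
      have h6 : v - (u ^ s) v - (s : ℝ) • (v - u v) + ((u ^ s) (v - u v) - (v - u v)) =
          v - (u ^ (s + 1)) v - ((s + 1 : ℕ) : ℝ) • (v - u v) := by
        rw [h5, map_sub]
        push_cast
        module
      rwa [h6] at h4
  have h4 : v - (u ^ q) v ∈ Q := by
    have := add_mem (h3 q) h1
    rwa [sub_add_cancel] at this
  -- This element of the affine Weyl group fixes the regular point `v`, so it is trivial, and with
  -- it its linear part `u ^ q`.
  have h5 := mul_mem (translation_mem_closure h h4) (toAffine_mem_closure (pow_mem hu q))
  have happ : ∀ x, (AffineIsometryEquiv.constVAdd ℝ E (v - (u ^ q) v) *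
      (u ^ q).toAffineIsometryEquiv) x = v - (u ^ q) v + (u ^ q) x := fun x => rfl
  have h6 := eq_one_of_sameAlcove h h5 hv (by
    intro t _
    rw [happ, sub_add_cancel]
    exact not_lt.2 real_inner_self_nonneg)
  have h7 : ∀ x, v - (u ^ q) v + (u ^ q) x = x := by
    intro x
    rw [← happ, h6]
    rfl
  have h8 := h7 0
  rw [map_zero, add_zero] at h8
  have h9 := h7 x
  rwa [h8, zero_add] at h9

variable {ι : Type*} [Fintype ι] {α : Module.Basis ι ℝ E} {θ v : E}

/-- The root is minus the image of `β'` under the lifted reflection of `β`. On the common folded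
root the two signs cancel, while the values at `v` get reflected modulo integers. -/
theorem IsFoldingPoint.exists_reflected (hv : IsFoldingPoint Φ α θ ω v) (h : IsRootSet Φ)
    (hd : 0 < orderOf ω) (hω : ∀ β, ω β ∈ Φ ↔ β ∈ Φ) {β β' : E} (hβ : β ∈ Φ) (hβ' : β' ∈ Φ)
    (hβ0 : fold ω β ≠ 0) (hfold : fold ω β' = fold ω β) :
    ∃ δ ∈ Φ, fold ω δ = fold ω β ∧ ∃ n : ℤ, ⟪δ, v⟫_ℝ = 2 * ⟪β, v⟫_ℝ - ⟪β', v⟫_ℝ + n := by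
  obtain ⟨T, ε, hT⟩ := hv.exists_reflectionLift h hd hω hβ hβ0
  refine ⟨_, h.neg_mem (sub_sum_coroot_mem h hT.mem hT.orth hβ'), ?_, ?_⟩
  · rw [fold_neg, hT.fold_sub_sum hd, hfold, refl_self hβ0, neg_neg]
  · have h1 : ∀ γ : E, ∃ n : ℤ, γ ∈ T →
        ⟪coroot γ, β'⟫_ℝ * ⟪γ, v⟫_ℝ = ⟪coroot γ, β'⟫_ℝ * (ε * ⟪β, v⟫_ℝ) + n := by
      intro γ
      by_cases hγ : γ ∈ T
      · obtain ⟨m, hm⟩ := h.integral γ (hT.mem γ hγ) β' hβ'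
        obtain ⟨n, hn⟩ := hT.int γ hγ
        refine ⟨m * n, fun _ => ?_⟩
        rw [hm, hn]
        push_cast
        ring
      · exact ⟨0, fun h => absurd h hγ⟩
    choose n hn using h1
    refine ⟨∑ γ ∈ T, n γ, ?_⟩
    have hε : ε ≠ 0 := by rcases hT.eps with h1 | h1 <;> rw [h1] <;> norm_num
    have h2 : (∑ γ ∈ T, ⟪coroot γ, β'⟫_ℝ) * ε = 2 := by
      rw [← hT.inner_coroot_fold hd, hfold, coroot_smul, real_inner_smul_left, real_inner_comm,
        inner_self_coroot hβ0]
      field_simp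
    have h3 : ⟪∑ γ ∈ T, ⟪coroot γ, β'⟫_ℝ • γ, v⟫_ℝ = 2 * ⟪β, v⟫_ℝ + ∑ γ ∈ T, (n γ : ℝ) := by
      rw [← h2, sum_inner]
      simp only [real_inner_smul_left]
      rw [Finset.sum_congr rfl hn, Finset.sum_add_distrib, ← Finset.sum_mul]
      ring
    rw [inner_neg_left, inner_sub_left, h3]
    push_cast
    ring

/-- Reflections in roots of `V` outside `Γ` fix `F` pointwise, so they can be dropped from any word
for `w`. -/
theorem exists_weylGroup_agreeing {F V : Set E}
    (hF : ∀ γ ∈ Γ, ∀ x ∈ F, refl γ x ∈ F) (horth : ∀ γ ∈ V, γ ∉ Γ → ∀ x ∈ F, ⟪γ, x⟫_ℝ = 0)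
    {w : E ≃ₗᵢ[ℝ] E} (hw : w ∈ weylGroup V) :
    ∃ u ∈ weylGroup Γ, ∀ x ∈ F, w x = u x ∧ u x ∈ F ∧ u⁻¹ x ∈ F := by
  have hpres : ∀ u ∈ weylGroup Γ, ∀ x ∈ F, u x ∈ F ∧ u⁻¹ x ∈ F := by
    intro u hu
    induction hu using Subgroup.closure_induction with
    | mem t ht =>
      obtain ⟨γ, hγ, rfl⟩ := ht
      intro x hx
      rw [refl_inv]
      exact ⟨hF γ hγ x hx, hF γ hγ x hx⟩
    | one => intro x hx; exact ⟨hx, by simpa using hx⟩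
    | mul a b _ _ iha ihb =>
      intro x hx
      rw [mul_inv_rev]
      exact ⟨(iha _ (ihb x hx).1).1, (ihb _ (iha x hx).2).2⟩
    | inv a _ iha =>
      intro x hx
      rw [inv_inv]
      exact (iha x hx).symm
  suffices ∃ u ∈ weylGroup Γ, ∀ x ∈ F, w x = u x by
    obtain ⟨u, hu, hux⟩ := this
    exact ⟨u, hu, fun x hx => ⟨hux x hx, hpres u hu x hx⟩⟩
  induction hw using Subgroup.closure_induction with
  | mem t ht =>
    obtain ⟨γ, hγ, rfl⟩ := ht
    by_cases h1 : γ ∈ Γ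
    · exact ⟨refl γ, Subgroup.subset_closure ⟨γ, h1, rfl⟩, fun x _ => rfl⟩
    · refine ⟨1, one_mem _, fun x hx => ?_⟩
      rw [refl_apply', horth γ hγ h1 x hx, zero_smul, sub_zero]
      rfl
  | one => exact ⟨1, one_mem _, fun x _ => rfl⟩
  | mul a b _ _ iha ihb =>
    obtain ⟨u₁, hu₁, h1⟩ := iha
    obtain ⟨u₂, hu₂, h2⟩ := ihb
    refine ⟨u₁ * u₂, mul_mem hu₁ hu₂, fun x hx => ?_⟩
    change a (b x) = u₁ (u₂ x)
    rw [h2 x hx, h1 _ (hpres u₂ hu₂ x hx).1]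
  | inv a _ iha =>
    obtain ⟨u, hu, h1⟩ := iha
    refine ⟨u⁻¹, inv_mem hu, fun x hx => ?_⟩
    have h2 := h1 _ (hpres u hu x hx).2
    have h3 : u (u⁻¹ x) = x := u.apply_symm_apply x
    rw [h3] at h2
    have h4 : a⁻¹ (a (u⁻¹ x)) = u⁻¹ x := a.symm_apply_apply _
    rwa [h2] at h4

/-- Every folded root comes from a root that takes an integral value at the folding point. -/
theorem IsFoldingPoint.exists_integral_lift (hv : IsFoldingPoint Φ α θ ω v) (h : IsRootSystem Φ)
    (hω : ω ∈ weylGroup Φ) {β : E} (hβ : β ∈ Φ) (hβ0 : fold ω β ≠ 0) :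
    ∃ β' ∈ Φ, fold ω β' = fold ω β ∧ ∃ n : ℤ, ⟪β', v⟫_ℝ = n := by
  have hd : 0 < orderOf ω := orderOf_pos_of_mem_weylGroup h hω
  have hr := h.isRootSet
  have hmap := map_mem_of_mem_weylGroup hr subset_rfl hω
  set d := orderOf ω with hddef
  have hdint : ∀ γ ∈ Φ, ∃ n : ℤ, d * ⟪γ, v⟫_ℝ = n := fun γ hγ =>
    hv.mul_int γ hγ d 1 (one_mul _).symm (by rw [hddef, pow_orderOf_eq_one]; rfl)
  set F : Set E := {x | x ∈ Φ ∧ fold ω x = fold ω β} with hF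
  -- `K` records the values at `v` over the fibre `F`, scaled by `d` and modulo `d`. An integral
  -- lift exists exactly when `0 ∈ K`. By `exists_reflected` it is a coset of the multiples of some
  -- `g`, with `d = g * q`.
  set K : Set ℤ := {k | ∃ x ∈ F, ∃ n : ℤ, (k : ℝ) = d * ⟪x, v⟫_ℝ + d * n} with hK
  obtain ⟨a, ha⟩ := hdint β hβ
  have haK : a ∈ K := ⟨β, ⟨hβ, rfl⟩, 0, by rw [← ha]; simp⟩
  have hd0 : (0 : ℤ) < d := by exact_mod_cast hd
  obtain ⟨g, hg, ⟨q', hq'⟩, hcoset⟩ := exists_coset_of_reflection_closed hd0 haK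
    (by
      rintro x ⟨γ, ⟨hγ, hγf⟩, m, hm⟩ y ⟨γ', ⟨hγ', hγf'⟩, m', hm'⟩
      obtain ⟨δ, hδ, hδf, n, hn⟩ := hv.exists_reflected hr hd hmap hγ hγ' (by rwa [hγf])
        (by rw [hγf, hγf'])
      refine ⟨δ, ⟨hδ, hδf.trans hγf⟩, 2 * m - m' - n, ?_⟩
      push_cast
      rw [hn, hm, hm']
      ring)
    (by
      rintro x ⟨γ, hγ, m, hm⟩
      refine ⟨γ, hγ, m + 1, ?_⟩
      push_cast
      rw [hm]
      ring)
  have hg0 : (0 : ℤ) < g := by exact_mod_cast hg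
  obtain ⟨q, rfl⟩ : ∃ q : ℕ, q' = q := Int.eq_ofNat_of_zero_le (by
    by_contra! h1
    have := mul_neg_of_pos_of_neg hg0 h1
    omega)
  have hdq : d = g * q := by exact_mod_cast hq'
  have hgR : (g : ℝ) ≠ 0 := by exact_mod_cast hg.ne'
  have hdR : (d : ℝ) = g * q := by exact_mod_cast hdq
  -- Only these roots matter for the action of `ω` on the fibre. Each is a difference of two members
  -- of `F`, so its value at `v`, times `d`, is a multiple of `g`; hence `q • v` is a coweight of
  -- `Γ`.
  set Γ : Set E := {γ | γ ∈ vanishing Φ ω ∧ ∃ x ∈ F, ⟪γ, x⟫_ℝ ≠ 0} with hΓ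
  have hFrefl : ∀ γ ∈ vanishing Φ ω, ∀ x ∈ F, refl γ x ∈ F := by
    rintro γ ⟨hγ, hγ0⟩ x ⟨hx, hxf⟩
    refine ⟨hr.refl_mem γ hγ x hx, ?_⟩
    rw [refl_apply, fold_sub, fold_smul, hγ0, smul_zero, sub_zero, hxf]
  have hΓr : IsRootSet Γ := by
    refine ⟨hr.finite.subset fun γ hγ => hγ.1.1, fun h0 => hr.zero_notMem h0.1.1, ?_, ?_⟩
    · rintro γ ⟨hγ, -⟩ δ ⟨⟨hδ, hδ0⟩, x, hx, hδx⟩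
      refine ⟨⟨hr.refl_mem γ hγ.1 δ hδ, ?_⟩, refl γ x, hFrefl γ hγ x hx, ?_⟩
      · rw [refl_apply, fold_sub, fold_smul, hδ0, hγ.2, smul_zero, sub_zero]
      · rwa [(refl γ).inner_map_map]
    · intro γ hγ δ hδ
      exact hr.integral γ hγ.1.1 δ hδ.1.1
  have hdiff : ∀ γ ∈ Γ, ∃ x ∈ F, ∃ y ∈ F, γ = x - y := by
    rintro γ ⟨⟨hγ, hγ0⟩, x, ⟨hx, hxf⟩, hγx⟩
    have hne : fold ω x ≠ fold ω γ := by rw [hγ0, hxf]; exact hβ0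
    have hne' : fold ω x ≠ fold ω (-γ) := by rw [fold_neg, hγ0, neg_zero, hxf]; exact hβ0
    rcases hγx.lt_or_gt with h1 | h1
    · refine ⟨x + γ, ⟨hr.add_mem hx hγ (by rwa [real_inner_comm]) ?_, ?_⟩, x, ⟨hx, hxf⟩, by abel⟩
      · intro h2
        exact hne' (congrArg _ h2)
      · rw [fold_add, hγ0, add_zero, hxf]
    · refine ⟨x, ⟨hx, hxf⟩, x - γ, ⟨hr.sub_mem hx hγ (by rwa [real_inner_comm]) ?_, ?_⟩, by abel⟩
      · intro h2
        exact hne (congrArg _ h2)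
      · rw [fold_sub, hγ0, sub_zero, hxf]
  obtain ⟨u, hu, hux⟩ := exists_weylGroup_agreeing (Γ := Γ) (F := F)
    (fun γ hγ => hFrefl γ hγ.1) (by
      intro γ hγ hγΓ x hx
      by_contra h1
      exact hγΓ ⟨hγ, x, hx, h1⟩) (mem_weylGroup_vanishing h hω)
  have hreg : IsRegular Γ v := fun γ hγ n => hv.not_int γ hγ.1.1 hγ.1.2 n
  have hFint : ∀ x ∈ F, ∃ n : ℤ, ⟪x, v - u v⟫_ℝ = n := by
    intro x hx
    obtain ⟨n, hn⟩ := hv.sub_mem x hx.1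
    refine ⟨n, ?_⟩
    have h1 : ω⁻¹ x = u⁻¹ x := by
      have h2 := (hux _ (hux x hx).2.2).1
      have h3 : u (u⁻¹ x) = x := u.apply_symm_apply x
      rw [h3] at h2
      have h4 : ω⁻¹ (ω (u⁻¹ x)) = u⁻¹ x := ω.symm_apply_apply _
      rwa [h2] at h4
    rw [← hn, inner_sub_right, inner_sub_right, isom_inner_left, isom_inner_left, h1]
  have huv : v - u v ∈ coweightLattice Γ := by
    intro γ hγ
    obtain ⟨x, hx, y, hy, rfl⟩ := hdiff γ hγ
    obtain ⟨m, hm⟩ := hFint x hx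
    obtain ⟨n, hn⟩ := hFint y hy
    exact ⟨m - n, by rw [inner_sub_left, hm, hn]; push_cast; rfl⟩
  have hqv : (q : ℝ) • v ∈ coweightLattice Γ := by
    intro γ hγ
    obtain ⟨x, hx, y, hy, rfl⟩ := hdiff γ hγ
    obtain ⟨m, hm⟩ := hdint x hx.1
    obtain ⟨n, hn⟩ := hdint y hy.1
    have hnK : n ∈ K := ⟨y, hy, 0, by rw [← hn]; simp⟩
    have hmK : m ∈ K := ⟨x, hx, 0, by rw [← hm]; simp⟩
    obtain ⟨k, hk⟩ := (hcoset n hnK m).1 hmK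
    refine ⟨k, ?_⟩
    have hk : (m : ℝ) - n = g * k := by exact_mod_cast hk
    rw [real_inner_smul_right, inner_sub_left]
    apply mul_left_cancel₀ hgR
    rw [← hk, ← hm, ← hn, hdR]
    ring
  have hpow : ∀ t : ℕ, (u ^ t) β ∈ F ∧ (ω ^ t) β = (u ^ t) β := by
    intro t
    induction t with
    | zero => exact ⟨⟨hβ, rfl⟩, rfl⟩
    | succ t ih =>
      rw [pow_succ', pow_succ']
      change u ((u ^ t) β) ∈ F ∧ ω ((ω ^ t) β) = u ((u ^ t) β)
      rw [ih.2]
      exact ⟨(hux _ ih.1).2.1, (hux _ ih.1).1⟩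
  -- On `F` the map `ω` agrees with `u`, whose `q`-th power is trivial. Then `q * ⟪β, v⟫` is an
  -- integer, so `g` divides `a` and the coset `K` contains `0`.
  have hfix : (ω ^ q) β = β := by
    rw [(hpow q).2]
    exact pow_apply_eq_self hΓr hu hreg huv hqv β
  obtain ⟨n, hn⟩ := hv.mul_int β hβ q g hdq hfix
  have hag : a = g * n := by
    have : (a : ℝ) = g * n := by
      rw [← ha, ← hn, hdR]
      ring
    exact_mod_cast this
  have h0 : (0 : ℤ) ∈ K := (hcoset a haK 0).2 ⟨-n, by rw [hag]; ring⟩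
  obtain ⟨x, hx, m, hm⟩ := h0
  refine ⟨x, hx.1, hx.2, -m, ?_⟩
  have hd0 : (d : ℝ) ≠ 0 := by exact_mod_cast hd.ne'
  apply mul_left_cancel₀ hd0
  push_cast at hm ⊢
  linarith

end Lift

/-! ### The folded simple roots and the folded coweights -/

section Final

variable {E : Type*} [NormedAddCommGroup E] [InnerProductSpace ℝ E] {Φ : Set E}
variable {ω : E ≃ₗᵢ[ℝ] E} {ι : Type*} [Fintype ι] {α : Module.Basis ι ℝ E} {θ v : E}

theorem fold_zpow (hd : 0 < orderOf ω) (t : ℤ) (x : E) : fold ω ((ω ^ t) x) = fold ω x := by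
  have hd0 : (orderOf ω : ℤ) ≠ 0 := by exact_mod_cast hd.ne'
  obtain ⟨s, hs⟩ := Int.eq_ofNat_of_zero_le (Int.emod_nonneg t hd0)
  rw [← zpow_mod_orderOf, hs, zpow_natCast, fold_pow hd]

/-- The value at `v` is an integer in `[0, 1)`, so every term of the sum vanishes. Simple roots in
the orbit of `-θ` are positive at `v`, so they cannot occur. -/
theorem IsFoldingPoint.fold_mem_closure_of_nonneg (hv : IsFoldingPoint Φ α θ ω v)
    (h : IsRootSet Φ) (hirr : IsIrred Φ) (hα : IsRootBasis Φ (Set.range α))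
    (hθ : IsHighestRoot Φ α θ) {c : ι → ℕ} (hγ : ∑ i, c i • α i ∈ Φ) {n : ℤ}
    (hn : ⟪∑ i, c i • α i, v⟫_ℝ = n) :
    fold ω (∑ i, c i • α i) ∈ AddSubmonoid.closure (foldedSimple α θ ω) := by
  have h1 : ⟪∑ i, c i • α i, v⟫_ℝ = ∑ i, c i * ⟪α i, v⟫_ℝ := by
    simp only [sum_inner, ← Nat.cast_smul_eq_nsmul ℝ, real_inner_smul_left]
  have hnn : ∀ i ∈ Finset.univ, 0 ≤ (c i : ℝ) * ⟪α i, v⟫_ℝ := fun i _ =>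
    mul_nonneg (Nat.cast_nonneg _) (hv.nonneg i)
  have h2 := (inner_le_inner_highest h hirr hα hθ hγ hv.nonneg).trans_lt hv.lt_one
  have h3 : 0 ≤ ⟪∑ i, c i • α i, v⟫_ℝ := by
    rw [h1]
    exact Finset.sum_nonneg hnn
  have hn0 : n = 0 := by
    rw [hn] at h2 h3
    have h2 : n < 1 := by exact_mod_cast h2
    have h3 : 0 ≤ n := by exact_mod_cast h3
    omega
  rw [hn, hn0, Int.cast_zero] at h1
  have h4 := (Finset.sum_eq_zero_iff_of_nonneg hnn).1 h1.symm
  rw [fold_sum]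
  refine sum_mem fun i hi => ?_
  by_cases hS : ∃ t : ℤ, (ω ^ t) (α i) = -θ
  · have h5 := (mul_eq_zero.1 (h4 i hi)).resolve_right (hv.pos i hS).ne'
    have h5 : c i = 0 := by exact_mod_cast h5
    rw [h5, zero_smul, show fold ω (0 : E) = 0 from (foldLin ω).map_zero]
    exact zero_mem _
  · have h5 : fold ω (c i • α i) = c i • fold ω (α i) := map_nsmul (foldLin ω) _ _
    rw [h5]
    have h6 : fold ω (α i) ∈ foldedSimple α θ ω := ⟨i, fun t ht => hS ⟨t, ht⟩, rfl⟩
    exact nsmul_mem (AddSubmonoid.subset_closure h6) _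

theorem IsFoldingPoint.mem_or_neg_mem (hv : IsFoldingPoint Φ α θ ω v)
    (h : IsRootSystem Φ) (hirr : IsIrred Φ) (hα : IsRootBasis Φ (Set.range α))
    (hθ : IsHighestRoot Φ α θ) (hω : ω ∈ weylGroup Φ) {γ : fixedSpace ω}
    (hγ : γ ∈ foldedRoots Φ ω) : γ ∈ AddSubmonoid.closure (foldedSimple α θ ω) ∨
      -γ ∈ AddSubmonoid.closure (foldedSimple α θ ω) := by
  obtain ⟨h0, β, hβ, rfl⟩ := hγ
  have hr := h.isRootSet
  obtain ⟨δ, hδ, hδf, n, hn⟩ := hv.exists_integral_lift h hω hβ h0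
  rw [← hδf]
  rcases hα.mem_or_neg_mem δ hδ with h1 | h1
  · obtain ⟨c, rfl⟩ := exists_nat_of_mem_closure h1
    exact Or.inl (hv.fold_mem_closure_of_nonneg hr hirr hα hθ hδ hn)
  · obtain ⟨c, hc⟩ := exists_nat_of_mem_closure h1
    right
    rw [← fold_neg, hc]
    refine hv.fold_mem_closure_of_nonneg hr hirr hα hθ (n := -n) ?_ ?_
    · rw [← hc]
      exact hr.neg_mem hδ
    · rw [← hc, inner_neg_left, hn]
      push_cast
      rfl

theorem mem_indexOrbit {i k : Option ι} : k ∈ indexOrbit α θ ω i ↔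
    ∃ t : ℤ, (ω ^ t) (extSimple α θ i) = extSimple α θ k := by
  simp [indexOrbit]

theorem zpow_mul_apply (s t : ℤ) (x : E) : (ω ^ s) ((ω ^ t) x) = (ω ^ (s + t)) x := by
  rw [zpow_add]
  rfl

theorem mem_indexOrbit_iff_of_map {i j k : Option ι} {t : ℤ}
    (h : (ω ^ t) (extSimple α θ j) = extSimple α θ k) :
    k ∈ indexOrbit α θ ω i ↔ j ∈ indexOrbit α θ ω i := by
  rw [mem_indexOrbit, mem_indexOrbit]
  constructor
  · rintro ⟨s, hs⟩
    refine ⟨-t + s, ?_⟩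
    rw [← zpow_mul_apply, hs, ← h, zpow_mul_apply, neg_add_cancel, zpow_zero]
    rfl
  · rintro ⟨s, hs⟩
    refine ⟨t + s, ?_⟩
    rw [← zpow_mul_apply, hs, h]

/-- The folded simple roots and the folded coweights are dual to each other. -/
theorem inner_fold_foldedCoweight [DecidableEq (Option ι)] (hd : 0 < orderOf ω)
    (hperm : ∀ (t : ℕ) (i : Option ι), ∃ k, (ω ^ t) (extSimple α θ i) = extSimple α θ k)
    {j : ι} (hj : ∀ t : ℤ, (ω ^ t) (α j) ≠ -θ) (i : Option ι) :
    ⟪fold ω (α j), foldedCoweight α θ ω i⟫_ℝ =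
      if some j ∈ indexOrbit α θ ω i then 1 else 0 := by
  classical
  have hsum : ∀ k : ι, ⟪∑ s ∈ indexOrbit α θ ω i, coweight α s, α k⟫_ℝ =
      if some k ∈ indexOrbit α θ ω i then 1 else 0 := by
    intro k
    have h1 : ∀ s, ⟪coweight α s, α k⟫_ℝ = if some k = s then 1 else 0 := by
      rintro (_ | s)
      · simp [coweight]
      · rw [real_inner_comm, inner_coweight]
        simp
    rw [sum_inner, Finset.sum_congr rfl fun s _ => h1 s, Finset.sum_ite_eq]
  -- The average is moved from the coweights to `α j`: its images are again simple roots, in the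
  -- same index orbit.
  have hterm : ∀ t ∈ Finset.Icc 1 (orderOf ω),
      ⟪∑ s ∈ indexOrbit α θ ω i, coweight α s, (ω ^ t) (α j)⟫_ℝ =
        if some j ∈ indexOrbit α θ ω i then 1 else 0 := by
    intro t _
    obtain ⟨k, hk⟩ := hperm t (some j)
    have hk' : (ω ^ (t : ℤ)) (extSimple α θ (some j)) = extSimple α θ k := by
      rwa [zpow_natCast]
    cases k with
    | none => exact absurd hk' (hj t)
    | some k =>
      have h1 : (ω ^ t) (α j) = α k := hk
      rw [h1, hsum]
      exact if_congr (mem_indexOrbit_iff_of_map hk') rfl rfl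
  rw [real_inner_comm, foldedCoweight, inner_fold hd]
  change ⟪_, average ω (α j)⟫_ℝ = _
  have hd0 : (orderOf ω : ℝ) ≠ 0 := by positivity
  rw [average, real_inner_smul_right, inner_sum, Finset.sum_congr rfl hterm, Finset.sum_const,
    Nat.card_Icc, Nat.add_sub_cancel, nsmul_eq_mul, ← mul_assoc, one_div_mul_cancel hd0, one_mul]

theorem finite_foldedSimple : (foldedSimple α θ ω).Finite := by
  refine (Set.finite_range fun i => fold ω (α i)).subset ?_
  rintro _ ⟨i, -, rfl⟩
  exact ⟨i, rfl⟩

/-- The family is indexed by vectors, not indices, since all simple roots of one orbit fold to the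
same vector. -/
theorem exists_dual_family (hd : 0 < orderOf ω)
    (hperm : ∀ (t : ℕ) (i : Option ι), ∃ k, (ω ^ t) (extSimple α θ i) = extSimple α θ k) :
    ∃ π : fixedSpace ω → fixedSpace ω, ∀ δ ∈ foldedSimple α θ ω,
      π δ ∈ foldedCoweights α θ ω ∧ ⟪δ, π δ⟫_ℝ = 1 ∧
        ∀ δ' ∈ foldedSimple α θ ω, δ' ≠ δ → ⟪δ', π δ⟫_ℝ = 0 := by
  classical
  have h : ∀ δ ∈ foldedSimple α θ ω, ∃ p ∈ foldedCoweights α θ ω, ⟪δ, p⟫_ℝ = 1 ∧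
      ∀ δ' ∈ foldedSimple α θ ω, δ' ≠ δ → ⟪δ', p⟫_ℝ = 0 := by
    rintro _ ⟨i, hi, rfl⟩
    refine ⟨foldedCoweight α θ ω (some i), ⟨some i, fun h1 => ?_, rfl⟩, ?_, ?_⟩
    · obtain ⟨t, ht⟩ := mem_indexOrbit.1 h1
      exact hi t ht
    · rw [inner_fold_foldedCoweight hd hperm hi, if_pos]
      exact mem_indexOrbit.2 ⟨0, rfl⟩
    · rintro _ ⟨j, hj, rfl⟩ hne
      rw [inner_fold_foldedCoweight hd hperm hj, if_neg]
      intro h1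
      obtain ⟨t, ht⟩ := mem_indexOrbit.1 h1
      have ht : (ω ^ t) (α i) = α j := ht
      rw [← ht, fold_zpow hd] at hne
      exact hne rfl
  choose! π hπ using h
  exact ⟨π, hπ⟩

theorem inner_int_of_mem_closure [DecidableEq (Option ι)] (hd : 0 < orderOf ω)
    (hperm : ∀ (t : ℕ) (i : Option ι), ∃ k, (ω ^ t) (extSimple α θ i) = extSimple α θ k)
    (i : Option ι) {x : fixedSpace ω} (hx : x ∈ AddSubmonoid.closure (foldedSimple α θ ω)) :
    ∃ n : ℤ, ⟪x, foldedCoweight α θ ω i⟫_ℝ = n := by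
  induction hx using AddSubmonoid.closure_induction with
  | mem x hx =>
    obtain ⟨j, hj, rfl⟩ := hx
    refine ⟨if some j ∈ indexOrbit α θ ω i then 1 else 0, ?_⟩
    rw [inner_fold_foldedCoweight hd hperm hj]
    split_ifs <;> simp
  | zero => exact ⟨0, by simp⟩
  | add x y _ _ hx hy =>
    obtain ⟨m, hm⟩ := hx
    obtain ⟨n, hn⟩ := hy
    exact ⟨m + n, by rw [inner_add_left, hm, hn]; push_cast; rfl⟩

end Final

end FoldedRoots

end

/-! ### The theorem, by duality with the folded coweights -/

theorem theorem4p1 {E : Type*} [NormedAddCommGroup E] [InnerProductSpace ℝ E]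
    [FiniteDimensional ℝ E] {ι : Type*} [Fintype ι]
    (Φ : Set E) (hΦ : FoldedRoots.IsRootSystem Φ)
    (hirr : FoldedRoots.IsIrred Φ) (hred : FoldedRoots.IsReduced Φ)
    (α : Module.Basis ι ℝ E) (hα : FoldedRoots.IsRootBasis Φ (Set.range α))
    (θ : E) (hθ : FoldedRoots.IsHighestRoot Φ α θ)
    (ω : E ≃ₗᵢ[ℝ] E) (hω : ω ∈ FoldedRoots.omegaGroup Φ α θ) :
    FoldedRoots.IsRootSystem (FoldedRoots.foldedRoots Φ ω) ∧
    FoldedRoots.IsRootBasis (FoldedRoots.foldedRoots Φ ω) (FoldedRoots.foldedSimple α θ ω) ∧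
    AddSubgroup.closure (FoldedRoots.foldedCoweights α θ ω) =
      FoldedRoots.coweightLattice (FoldedRoots.foldedRoots Φ ω) := by
  classical
  obtain ⟨v, hv⟩ := FoldedRoots.exists_isFoldingPoint hΦ hirr hred hα hθ hω
  obtain ⟨hW, z, hz, hA⟩ := hω
  have hr := hΦ.isRootSet
  have hd : 0 < orderOf ω := FoldedRoots.orderOf_pos_of_mem_weylGroup hΦ hW
  have hperm : ∀ (t : ℕ) (i : Option ι), ∃ k,
      (ω ^ t) (FoldedRoots.extSimple α θ i) = FoldedRoots.extSimple α θ k := fun t i =>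
    (FoldedRoots.exists_extSimple_pow hr hirr hred hα hθ hW hz hA t i).imp fun _ h => h.1
  have hroot := hv.isRootSystem hΦ hW
  have hmem : ∀ γ ∈ FoldedRoots.foldedRoots Φ ω, _ := fun γ hγ =>
    hv.mem_or_neg_mem hΦ hirr hα hθ hW hγ
  obtain ⟨π, hπd⟩ := FoldedRoots.exists_dual_family hd hperm
  have hπ := fun δ hδ => (hπd δ hδ).1
  have hdual := fun δ hδ => (hπd δ hδ).2
  have hsub : FoldedRoots.foldedSimple α θ ω ⊆ FoldedRoots.foldedRoots Φ ω := by
    intro δ hδ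
    have h1 := (hdual δ hδ).1
    obtain ⟨i, -, rfl⟩ := hδ
    refine ⟨fun h0 => ?_, α i, FoldedRoots.simple_mem hα i, rfl⟩
    rw [h0, inner_zero_left] at h1
    exact zero_ne_one h1
  have hspan : Submodule.span ℝ (FoldedRoots.foldedSimple α θ ω) = ⊤ := by
    rw [eq_top_iff, ← hroot.span_eq_top, Submodule.span_le]
    have hle : AddSubmonoid.closure (FoldedRoots.foldedSimple α θ ω) ≤
        (Submodule.span ℝ (FoldedRoots.foldedSimple α θ ω)).toAddSubmonoid :=
      (AddSubmonoid.closure_le).2 Submodule.subset_span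
    intro γ hγ
    rcases hmem γ hγ with h1 | h1
    · exact hle h1
    · have h2 : -γ ∈ Submodule.span ℝ (FoldedRoots.foldedSimple α θ ω) := hle h1
      exact neg_mem_iff.1 h2
  have hint : ∀ i, ∀ γ ∈ FoldedRoots.foldedRoots Φ ω,
      ∃ n : ℤ, ⟪γ, FoldedRoots.foldedCoweight α θ ω i⟫_ℝ = n := by
    intro i γ hγ
    rcases hmem γ hγ with h1 | h1
    · exact FoldedRoots.inner_int_of_mem_closure hd hperm i h1
    · obtain ⟨n, hn⟩ := FoldedRoots.inner_int_of_mem_closure hd hperm i h1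
      refine ⟨-n, ?_⟩
      rw [inner_neg_left] at hn
      push_cast
      linarith
  refine ⟨hroot, ⟨hsub, ?_, hspan, hmem, ?_⟩, le_antisymm ?_ ?_⟩
  · rw [LinearIndepOn, linearIndependent_iff']
    intro s g hg δ hδ
    have h1 := congrArg (fun x => ⟪x, π δ⟫_ℝ) hg
    simp only [sum_inner, real_inner_smul_left, inner_zero_left, id_eq] at h1
    rw [Finset.sum_eq_single δ] at h1
    · rwa [(hdual δ δ.2).1, mul_one] at h1
    · intro δ' _ hne
      rw [(hdual δ δ.2).2 δ' δ'.2 (fun h => hne (Subtype.ext h)), mul_zero]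
    · intro h2
      exact absurd hδ h2
  -- The half of `δ` would pair with the dual folded coweight to `1/2`, but folded roots pair
  -- integrally with folded coweights.
  · intro δ hδ hhalf
    obtain ⟨i, -, hi⟩ := hπ δ hδ
    obtain ⟨n, hn⟩ := hint i _ hhalf
    rw [← hi, real_inner_smul_left, (hdual δ hδ).1, mul_one] at hn
    have h1 : (1 : ℝ) = 2 * n := by linarith
    have h1 : (1 : ℤ) = 2 * n := by exact_mod_cast h1
    omega
  · rw [AddSubgroup.closure_le]
    rintro _ ⟨i, -, rfl⟩
    exact hint i
  · intro x hx
    have h1 : ∀ δ : FoldedRoots.fixedSpace ω, ∃ n : ℤ,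
        δ ∈ FoldedRoots.foldedSimple α θ ω → ⟪δ, x⟫_ℝ = n := by
      intro δ
      by_cases hδ : δ ∈ FoldedRoots.foldedSimple α θ ω
      · obtain ⟨n, hn⟩ := hx δ (hsub hδ)
        exact ⟨n, fun _ => hn⟩
      · exact ⟨0, fun h => absurd h hδ⟩
    choose n hn using h1
    have hfin : (FoldedRoots.foldedSimple α θ ω).Finite := FoldedRoots.finite_foldedSimple
    -- Expansion in the dual basis: the difference is orthogonal to the folded simple roots, which
    -- span.
    have h2 : x = ∑ δ ∈ hfin.toFinset, n δ • π δ := by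
      rw [← sub_eq_zero]
      have h3 : ∀ y ∈ Submodule.span ℝ (FoldedRoots.foldedSimple α θ ω),
          ⟪y, x - ∑ δ ∈ hfin.toFinset, n δ • π δ⟫_ℝ = 0 := by
        intro y hy
        induction hy using Submodule.span_induction with
        | mem δ hδ =>
          rw [inner_sub_right, hn δ hδ, inner_sum, Finset.sum_eq_single δ]
          · rw [← Int.cast_smul_eq_zsmul ℝ, real_inner_smul_right, (hdual δ hδ).1, mul_one, sub_self]
          · intro δ' hδ' hne
            rw [← Int.cast_smul_eq_zsmul ℝ, real_inner_smul_right,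
              (hdual δ' (hfin.mem_toFinset.1 hδ')).2 δ hδ hne.symm, mul_zero]
          · intro h4
            exact absurd (hfin.mem_toFinset.2 hδ) h4
        | zero => exact inner_zero_left _
        | add a b _ _ ha hb => rw [inner_add_left, ha, hb, add_zero]
        | smul c a _ ha => rw [real_inner_smul_left, ha, mul_zero]
      exact inner_self_eq_zero.1 (h3 _ (by rw [hspan]; trivial))
    rw [h2]
    exact sum_mem fun δ hδ => zsmul_mem (AddSubgroup.subset_closure
      (hπ δ (hfin.mem_toFinset.1 hδ))) _
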